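/- Let $\Gamma$ be a (discrete) group of type $FP_\infty(\mathbb Q)$, i.e. for every $m$ the trivial module $\mathbb Q$ has a projective $\mathbb Q\Gamma$-resolution that is finitely generated in degrees up to $m$, and let $n>0$ be an integer. Say that $\Gamma$ has property $[T_n]$ if $H^j(\Gamma,V)=0$ for every unitary representation $V$ of $\Gamma$ and every $1\le j\le n$, and property $(T_n)$ if the same holds for every unitary representation $V$ without nonzero $\Gamma$-invariant vectors. Let $C^*\Gamma$ be the maximal group C*-algebra, $W^*\Gamma=(C^*\Gamma)^{**}$ its von Neumann envelope, and let $C^*_0\Gamma\subset C^*\Gamma$ and $W^*_0\Gamma\subset W^*\Gamma$ be the kernels of the homomorphisms to $\mathbb C$ induced by the trivial representation. All of these, and all C*-algebras $A$ below, are regarded as subspaces of $W^*\Gamma$ with the norm topology, on which $\Gamma$ acts by left multiplication. For a Banach $\Gamma$-module $V$, $H^k(\Gamma,V)$ carries its canonical topology (the quotient topology on cocycles modulo coboundaries, where cochains $\Gamma^k\to V$ have the topology of pointwise convergence) and $H_0(\Gamma,V)=V/\operatorname{span}\{\gamma v-v : \gamma\in\Gamma,\ v\in V\}$ carries the quotient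 topology. (a) The following are equivalent: 1. $\Gamma$ has property $[T_n]$. 2. $H^k(\Gamma,C^*\Gamma)=0$ for all $1\le k\le n$, and $H^{n+1}(\Gamma,C^*\Gamma)$ is Hausdorff. 3. $H_k(\Gamma,C^*\Gamma)=0$ for all $1\le k\le n$, and $H_0(\Gamma,C^*\Gamma)$ is Hausdorff. (b) The following are equivalent: 1. $\Gamma$ has property $(T_n)$. 2. $H^k(\Gamma,C_0^*\Gamma)=0$ for all $1\le k\le n$, and $H^{n+1}(\Gamma,C_0^*\Gamma)$ is Hausdorff. 3. $H_k(\Gamma,C_0^*\Gamma)=0$ for all $1\le k\le n$, and $H_0(\Gamma,C_0^*\Gamma)$ is Hausdorff. (c) The equivalence (a) also holds with $C^*\Gamma$ replaced by any C*-algebra $A$ with $C^*\Gamma\subset A\subset W^*\Gamma$, and the equivalence (b) also holds with $C^*_0\Gamma$ replaced by any C*-algebra $A$ with $C^*_0\Gamma\subset A\subset W^*_0\Gamma$. -/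

import Mathlib

open CategoryTheory

noncomputable section

/-! ### Finiteness properties -/

/-- `Γ` is of type `FP_n(ℚ)`: the trivial module `ℚ` has a projective `ℚΓ`-resolution that is
finitely generated in degrees up to `n`. -/
def IsTypeFP (Γ : Type) [Group Γ] (n : ℕ) : Prop :=
  ∃ P : ProjectiveResolution (Rep.trivial ℚ Γ ℚ),
    ∀ i ≤ n, Module.Finite (MonoidAlgebra ℚ Γ) (P.complex.X i).ρ.asModule

/-- `Γ` is of type `FP_∞(ℚ)`. -/
def IsTypeFPInfty (Γ : Type) [Group Γ] : Prop := ∀ n : ℕ, IsTypeFP Γ n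

/-! ### The topologies on group cohomology and on zeroth group homology -/

section Topology

variable {Γ : Type} [Group Γ] {V : Type} [AddCommGroup V] [Module ℂ V] [TopologicalSpace V]

/-- The canonical topology on `H^n(Γ, V)` for a topological `Γ`-module `V` (`Γ` discrete): cochains
`Γⁿ → V` carry the topology of pointwise convergence, cocycles the subspace topology, and
`H^n(Γ, V)` the quotient topology. -/
abbrev cohomologyTopology (ρ : Representation ℂ Γ V) (n : ℕ) :
    TopologicalSpace (groupCohomology (Rep.of ρ) n) :=
  TopologicalSpace.coinduced (groupCohomology.π (Rep.of ρ) n).hom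
    (TopologicalSpace.induced
      (fun z => ((groupCohomology.iCocycles (Rep.of ρ) n).hom z : (Fin n → Γ) → V))
      Pi.topologicalSpace)

/-- `H^n(Γ, V)` is Hausdorff. -/
def CohomologyHausdorff (ρ : Representation ℂ Γ V) (n : ℕ) : Prop :=
  @T2Space (groupCohomology (Rep.of ρ) n) (cohomologyTopology ρ n)

/-- The canonical topology on `H_0(Γ, V)`, the quotient of `V` by the span of all `γ v - v`:
the quotient topology. -/
abbrev homologyZeroTopology (ρ : Representation ℂ Γ V) :
    TopologicalSpace (groupHomology (Rep.of ρ) 0) :=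
  TopologicalSpace.coinduced (fun v : V => (groupHomology.H0π (Rep.of ρ)).hom v) inferInstance

/-- `H_0(Γ, V)` is Hausdorff. -/
def HomologyZeroHausdorff (ρ : Representation ℂ Γ V) : Prop :=
  @T2Space (groupHomology (Rep.of ρ) 0) (homologyZeroTopology ρ)

/-- `H^k(Γ, V) = 0` for `1 ≤ k ≤ n` and `H^{n+1}(Γ, V)` is Hausdorff. -/
def CohomologyCriterion (ρ : Representation ℂ Γ V) (n : ℕ) : Prop :=
  (∀ k, 1 ≤ k → k ≤ n → Subsingleton (groupCohomology (Rep.of ρ) k)) ∧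
    CohomologyHausdorff ρ (n + 1)

/-- `H_k(Γ, V) = 0` for `1 ≤ k ≤ n` and `H_0(Γ, V)` is Hausdorff. -/
def HomologyCriterion (ρ : Representation ℂ Γ V) (n : ℕ) : Prop :=
  (∀ k, 1 ≤ k → k ≤ n → Subsingleton (groupHomology (Rep.of ρ) k)) ∧
    HomologyZeroHausdorff ρ

end Topology

/-! ### Higher property T -/

/-- The linear representation underlying a unitary representation. -/
def unitaryRep {Γ : Type} [Group Γ] {V : Type} [NormedAddCommGroup V] [InnerProductSpace ℂ V]
    [CompleteSpace V] (π : Γ →* unitary (V →L[ℂ] V)) : Representation ℂ Γ V where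
  toFun g := ((π g : V →L[ℂ] V) : V →ₗ[ℂ] V)
  map_one' := by ext v; simp
  map_mul' g h := by ext v; simp

/-- Property `[T_n]`: `H^j(Γ, V) = 0` for every unitary representation `V` and `1 ≤ j ≤ n`. -/
def HasPropertyBracketT (Γ : Type) [Group Γ] (n : ℕ) : Prop :=
  ∀ (V : Type) [NormedAddCommGroup V] [InnerProductSpace ℂ V] [CompleteSpace V]
    (π : Γ →* unitary (V →L[ℂ] V)) (j : ℕ), 1 ≤ j → j ≤ n →
    Subsingleton (groupCohomology (Rep.of (unitaryRep π)) j)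

/-- Property `(T_n)`: `H^j(Γ, V) = 0` for every unitary representation `V` without nonzero
invariant vectors and `1 ≤ j ≤ n`. -/
def HasPropertyT (Γ : Type) [Group Γ] (n : ℕ) : Prop :=
  ∀ (V : Type) [NormedAddCommGroup V] [InnerProductSpace ℂ V] [CompleteSpace V]
    (π : Γ →* unitary (V →L[ℂ] V)),
    (∀ v : V, (∀ g : Γ, (π g : V →L[ℂ] V) v = v) → v = 0) →
    ∀ j : ℕ, 1 ≤ j → j ≤ n → Subsingleton (groupCohomology (Rep.of (unitaryRep π)) j)

/-! ### The maximal C*-algebra and its von Neumann envelope -/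

/-- A Hilbert space of dimension `max |Γ| ℵ₀`, so that every cyclic unitary representation of `Γ`
is a subrepresentation of a unitary representation on this space. -/
abbrev BigHilbert (Γ : Type) : Type := lp (fun _ : Γ × ℕ => ℂ) 2

/-- Bounded operators on `BigHilbert Γ`. -/
abbrev BigOp (Γ : Type) : Type := BigHilbert Γ →L[ℂ] BigHilbert Γ

instance (Γ : Type) [Group Γ] : Nontrivial (BigHilbert Γ) := by
  classical
  refine ⟨⟨lp.single 2 ((1 : Γ), 0) (1 : ℂ), 0, fun h => ?_⟩⟩
  have h1 := congrArg (fun f : BigHilbert Γ => f ((1 : Γ), 0)) h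
  simp at h1

/-- The unitary representations of `Γ` on `BigHilbert Γ`. -/
abbrev BigRep (Γ : Type) [Group Γ] : Type := Γ →* unitary (BigOp Γ)

/-- The C*-algebra of uniformly bounded families `(T_π)_π` of operators, one for each
`π : BigRep Γ`, with pointwise operations and the supremum norm. -/
def BoundedFamily (Γ : Type) [Group Γ] : Type := lp (fun _ : BigRep Γ => BigOp Γ) ⊤

instance (Γ : Type) [Group Γ] : NormedRing (BoundedFamily Γ) :=
  inferInstanceAs (NormedRing (lp (fun _ : BigRep Γ => BigOp Γ) ⊤))

instance (Γ : Type) [Group Γ] : StarRing (BoundedFamily Γ) :=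
  inferInstanceAs (StarRing (lp (fun _ : BigRep Γ => BigOp Γ) ⊤))

instance (Γ : Type) [Group Γ] : CompleteSpace (BoundedFamily Γ) :=
  inferInstanceAs (CompleteSpace (lp (fun _ : BigRep Γ => BigOp Γ) ⊤))

instance (Γ : Type) [Group Γ] : CStarRing (BoundedFamily Γ) :=
  inferInstanceAs (CStarRing (lp (fun _ : BigRep Γ => BigOp Γ) ⊤))

instance (Γ : Type) [Group Γ] : NormedAlgebra ℂ (BoundedFamily Γ) :=
  inferInstanceAs (NormedAlgebra ℂ (lp (fun _ : BigRep Γ => BigOp Γ) ⊤))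

instance (Γ : Type) [Group Γ] : StarModule ℂ (BoundedFamily Γ) :=
  inferInstanceAs (StarModule ℂ (lp (fun _ : BigRep Γ => BigOp Γ) ⊤))

instance (Γ : Type) [Group Γ] : CStarAlgebra (BoundedFamily Γ) where

/-- The component `T_π` of a family `T`. -/
def BoundedFamily.app {Γ : Type} [Group Γ] (T : BoundedFamily Γ) (π : BigRep Γ) : BigOp Γ :=
  T.val π

theorem BoundedFamily.ext {Γ : Type} [Group Γ] {T U : BoundedFamily Γ}
    (h : ∀ π, T.app π = U.app π) : T = U :=
  Subtype.ext (funext h)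

section Envelope

variable (Γ : Type) [Group Γ]

variable {Γ} in
/-- The image `(π(g))_π` of `g : Γ`. -/
def groupElt (g : Γ) : BoundedFamily Γ :=
  ⟨fun π => (π g : BigOp Γ), memℓp_infty ⟨1, by
    rintro _ ⟨π, rfl⟩
    exact CStarRing.norm_of_mem_unitary (π g).2 |>.le⟩⟩

/-- The von Neumann envelope `W*Γ` of `C*Γ`: the bounded endomorphisms of the forgetful functor from
unitary representations to Hilbert spaces, i.e. the bounded families `(T_π)_π` that commute with all
bounded intertwiners `S : π → σ`. Equivalently, it is the bicommutant of `Γ` in the direct sum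
of all `π : BigRep Γ`, which is quasi-equivalent to the universal representation of `C*Γ`. -/
def WStar : StarSubalgebra ℂ (BoundedFamily Γ) where
  carrier := {T | ∀ (π σ : BigRep Γ) (S : BigOp Γ),
    (∀ g : Γ, S * (π g : BigOp Γ) = (σ g : BigOp Γ) * S) → S * T.app π = T.app σ * S}
  mul_mem' := by
    intro T U hT hU π σ S hS
    have h1 := hT π σ S hS
    have h2 := hU π σ S hS
    change S * (T.app π * U.app π) = (T.app σ * U.app σ) * S
    rw [← mul_assoc, h1, mul_assoc, h2, mul_assoc]
  add_mem' := by
    intro T U hT hU π σ S hS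
    change S * (T.app π + U.app π) = (T.app σ + U.app σ) * S
    rw [mul_add, add_mul, hT π σ S hS, hU π σ S hS]
  algebraMap_mem' := by
    intro c π σ S _
    change S * (algebraMap ℂ (BigOp Γ) c) = (algebraMap ℂ (BigOp Γ) c) * S
    exact (Algebra.commutes c S).symm
  star_mem' := by
    intro T hT π σ S hS
    have hS' : ∀ g : Γ, star S * (σ g : BigOp Γ) = (π g : BigOp Γ) * star S := by
      intro g
      have h := congrArg star (hS g⁻¹)
      have hs : ∀ τ : BigRep Γ, star (τ g⁻¹ : BigOp Γ) = (τ g : BigOp Γ) := by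
        intro τ
        rw [map_inv, ← Unitary.star_eq_inv, Unitary.coe_star, star_star]
      rw [star_mul, star_mul, hs, hs] at h
      exact h.symm
    have h := congrArg star (hT σ π (star S) hS')
    change S * star (T.app π) = star (T.app σ) * S
    simpa [star_mul] using h.symm

/-- The maximal group C*-algebra `C*Γ`: the norm closure of the image of the group algebra `ℂΓ`,
the norm of `x` being the supremum of `‖π(x)‖` over all unitary representations. -/
def CStar : StarSubalgebra ℂ (BoundedFamily Γ) :=
  (StarAlgebra.adjoin ℂ (Set.range (groupElt (Γ := Γ)))).topologicalClosure

/-- The families that vanish at the trivial representation. -/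
def trivialKernel : NonUnitalStarSubalgebra ℂ (BoundedFamily Γ) where
  carrier := {T | T.app (1 : BigRep Γ) = 0}
  zero_mem' := rfl
  add_mem' := by
    intro T U hT hU
    change T.app (1 : BigRep Γ) + U.app (1 : BigRep Γ) = 0
    rw [Set.mem_ofPred_eq] at hT hU
    rw [hT, hU, add_zero]
  mul_mem' := by
    intro T U hT hU
    change T.app (1 : BigRep Γ) * U.app (1 : BigRep Γ) = 0
    rw [Set.mem_ofPred_eq] at hT
    rw [hT, zero_mul]
  smul_mem' := by
    intro c T hT
    change c • T.app (1 : BigRep Γ) = 0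
    rw [Set.mem_ofPred_eq] at hT
    rw [hT, smul_zero]
  star_mem' := by
    intro T hT
    change star (T.app (1 : BigRep Γ)) = 0
    rw [Set.mem_ofPred_eq] at hT
    rw [hT, star_zero]

/-- The augmentation ideal `C*₀Γ`, the kernel of the trivial representation on `C*Γ`. -/
def CStarAug : NonUnitalStarSubalgebra ℂ (BoundedFamily Γ) :=
  (CStar Γ).toNonUnitalStarSubalgebra ⊓ trivialKernel Γ

/-- The augmentation ideal `W*₀Γ`, the kernel of the trivial representation on `W*Γ`. -/
def WStarAug : NonUnitalStarSubalgebra ℂ (BoundedFamily Γ) :=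
  (WStar Γ).toNonUnitalStarSubalgebra ⊓ trivialKernel Γ

theorem cstarAug_le_cstar : CStarAug Γ ≤ (CStar Γ).toNonUnitalStarSubalgebra := inf_le_left

variable {Γ}

theorem groupElt_one : groupElt (1 : Γ) = 1 := by
  refine BoundedFamily.ext fun π => ?_
  change ((π 1 : unitary (BigOp Γ)) : BigOp Γ) = 1
  simp

theorem groupElt_mul (g h : Γ) : groupElt (g * h) = groupElt g * groupElt h := by
  refine BoundedFamily.ext fun π => ?_
  change ((π (g * h) : unitary (BigOp Γ)) : BigOp Γ) = (π g : BigOp Γ) * (π h : BigOp Γ)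
  simp

theorem groupElt_sub_one_mem (g : Γ) : groupElt g - 1 ∈ CStarAug Γ := by
  refine ⟨?_, ?_⟩
  · change groupElt g - 1 ∈ CStar Γ
    refine sub_mem ?_ (one_mem _)
    exact StarSubalgebra.le_topologicalClosure _ (StarAlgebra.subset_adjoin ℂ _ ⟨g, rfl⟩)
  · change (((1 : BigRep Γ) g : unitary (BigOp Γ)) : BigOp Γ) - 1 = 0
    simp

theorem groupElt_mul_mem {A : NonUnitalStarSubalgebra ℂ (BoundedFamily Γ)} (hA : CStarAug Γ ≤ A)
    (g : Γ) {a : BoundedFamily Γ} (ha : a ∈ A) : groupElt g * a ∈ A := by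
  have h := add_mem (mul_mem (hA (groupElt_sub_one_mem g)) ha) ha
  rwa [sub_mul, one_mul, sub_add_cancel] at h

/-- The action of `Γ` by left multiplication on a subalgebra containing `C*₀Γ`. -/
def leftMulRep (A : NonUnitalStarSubalgebra ℂ (BoundedFamily Γ)) (hA : CStarAug Γ ≤ A) :
    Representation ℂ Γ A where
  toFun g :=
    { toFun := fun a => ⟨groupElt g * a, groupElt_mul_mem hA g a.2⟩
      map_add' := fun a b => Subtype.ext (mul_add _ _ _)
      map_smul' := fun c a => Subtype.ext (mul_smul_comm _ _ _) }
  map_one' := by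
    ext1 a
    exact Subtype.ext ((congrArg (· * (a : BoundedFamily Γ)) groupElt_one).trans (one_mul _))
  map_mul' g h := by
    ext1 a
    exact Subtype.ext ((congrArg (· * (a : BoundedFamily Γ)) (groupElt_mul g h)).trans
      (mul_assoc _ _ _))

end Envelope

end

/-!
The proof reduces all conditions to the existence of one algebraic object, a contraction over a
C*-algebra.

As `Γ` is of type `FP_∞(ℚ)`, the bar resolution is homotopy equivalent to a resolution by projective
modules, which are finitely generated up to degree `n + 1`; in such a resolution the differentials
are given by finite matrices `D k` over `ℚΓ` and the projective modules by idempotent matrices `q k`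
(`FiniteModel`, `IsTypeFP.nonempty_finiteModel`). The comparison maps are continuous, so that group
cohomology and homology and their Hausdorff properties can be read off from the finite model:
cochains are columns on which the `D k` act, and chains are columns on which the adjoints of the
`D k` act.

Let `A` be a C*-algebra on which `Γ` acts through unitary elements, with a unit `e`. The complex
is contractible over `A` in degree `k + 1` if `e q = G D (k + 1) + D k Y` with matrices `G` and `Y`
over `A` (`FiniteModel.RelContractible`). Such a contraction forces cohomology and homology with
coefficients in `A`, or in a larger algebra with the same unit, to vanish, and the ranges of the
differentials and of their adjoints to be closed. Conversely, a matrix over `A` with closed range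
has a generalized inverse over `A`, by the open mapping theorem and functional calculus
(`exists_mul_mul_eq_self_of_isClosed_range`, `exists_matrix_mul_mul_eq_self`). If cohomology
vanishes in the degrees `1, …, n` and is Hausdorff in degree `n + 1`, then generalized inverses and
contractions can be found by descending induction on the degree, and for homology by ascending
induction (`FiniteModel.contractibleUpTo_of_cohomologyCriterion`,
`FiniteModel.contractibleUpTo_of_homologyCriterion`).

A contraction over `A` acts on every unitary representation on `BigHilbert Γ`. A cocycle of the
finite model in any unitary representation involves finitely many vectors, the closed span of the
orbits of which embeds in `BigHilbert Γ`; so contractions over `A` imply the vanishing of the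
cohomology of unitary representations (`FiniteModel.RelContractible.cochainExact`).

For the converse, let the cohomology of unitary representations vanish in degree `k + 1`. Then the
Laplacian is injective on the part of any representation on which `e` is the identity. It is even
bounded below uniformly in the representation, since otherwise a limit of representations along an
ultrafilter, given by the GNS construction, would have a nonzero harmonic vector
(`FiniteModel.exists_norm_le_laplacian`). So the Laplacian has a closed range, hence an inverse over
`C*Γ` or `C*₀Γ`, from which Hodge theory makes a contraction
(`FiniteModel.relContractible_of_left_inverse`).

For property `[T_n]` the unit is `e = 1`. For property `(T_n)` each of the conditions has to provide
the unit `e` of the augmentation ideal, the complement of the Kazhdan projection. It is determined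
by the invariance of `1 - e`. In the case of cohomology, `g ↦ g - 1` is a cocycle with values in
`A`, and `e` is an element of which it is the coboundary. In the case of homology, the
generators of the augmentation ideal form a column whose adjoint has a closed range, so it has a
generalized inverse.
In the case of representations, the vanishing of the first cohomology of the direct sum of all
representations gives a Kazhdan constant, so that this column itself has a closed range.
-/

noncomputable section

/-! ### Finite models of the bar resolution -/

/-- The free left `ℚΓ`-module on a type `X`. -/
abbrev FreeMod (Γ : Type) [Group Γ] (X : Type) : Type := X →₀ MonoidAlgebra ℚ Γ

section BarComplex

variable {Γ : Type} [Group Γ]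

/-- The `ℚΓ`-linear map underlying a morphism of rational representations. -/
def asModuleMap {A B : Rep.{0} ℚ Γ} (φ : A ⟶ B) :
    A.ρ.asModule →ₗ[MonoidAlgebra ℚ Γ] B.ρ.asModule :=
  (Rep.toModuleMonoidAlgebra.map φ).hom

theorem asModuleMap_comp {A B C : Rep.{0} ℚ Γ} (φ : A ⟶ B) (ψ : B ⟶ C) :
    asModuleMap (φ ≫ ψ) = asModuleMap ψ ∘ₗ asModuleMap φ := rfl

theorem asModuleMap_add {A B : Rep.{0} ℚ Γ} (φ ψ : A ⟶ B) :
    asModuleMap (φ + ψ) = asModuleMap φ + asModuleMap ψ := rfl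

theorem asModuleMap_zero (A B : Rep.{0} ℚ Γ) : asModuleMap (0 : A ⟶ B) = 0 := rfl

variable (Γ)

/-- The degree `n` part of the bar resolution, as a free `ℚΓ`-module on `Γⁿ`. -/
def barEquiv (n : ℕ) :
    (Rep.free ℚ Γ (Fin n → Γ)).ρ.asModule ≃ₗ[MonoidAlgebra ℚ Γ] FreeMod Γ (Fin n → Γ) :=
  (Representation.finsuppLEquivFreeAsModule ℚ Γ (Fin n → Γ)).symm

/-- The differential of the bar resolution. -/
def barD (n : ℕ) :
    FreeMod Γ (Fin (n + 1) → Γ) →ₗ[MonoidAlgebra ℚ Γ] FreeMod Γ (Fin n → Γ) :=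
  (barEquiv Γ n).toLinearMap ∘ₗ asModuleMap (Rep.barComplex.d ℚ Γ n) ∘ₗ
    (barEquiv Γ (n + 1)).symm.toLinearMap

theorem barD_single (n : ℕ) (x : Fin (n + 1) → Γ) :
    barD Γ n (Finsupp.single x 1) =
      Finsupp.single (fun i => x i.succ) (MonoidAlgebra.single (x 0) 1) +
      ∑ j : Fin (n + 1), Finsupp.single (j.contractNth (· * ·) x)
        (MonoidAlgebra.single (1 : Γ) ((-1 : ℚ) ^ ((j : ℕ) + 1))) :=
  Rep.barComplex.d_single (k := ℚ) n x

/-- A complex of free `ℚΓ`-modules with idempotents `q k`, the images of which form a complex that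
is chain homotopy equivalent to the bar resolution, and whose terms are finitely generated in
degrees up to `m`. The complex of the images is a projective resolution of `ℚ`. -/
structure FiniteModel (m : ℕ) where
  /-- the basis in each degree -/
  X : ℕ → Type
  finite : ∀ k ≤ m, Finite (X k)
  /-- the differential -/
  d : ∀ k, FreeMod Γ (X (k + 1)) →ₗ[MonoidAlgebra ℚ Γ] FreeMod Γ (X k)
  /-- the idempotent that cuts out the projective summand -/
  q : ∀ k, FreeMod Γ (X k) →ₗ[MonoidAlgebra ℚ Γ] FreeMod Γ (X k)
  /-- the comparison map to the bar resolution -/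
  f : ∀ k, FreeMod Γ (X k) →ₗ[MonoidAlgebra ℚ Γ] FreeMod Γ (Fin k → Γ)
  /-- the comparison map from the bar resolution -/
  g : ∀ k, FreeMod Γ (Fin k → Γ) →ₗ[MonoidAlgebra ℚ Γ] FreeMod Γ (X k)
  /-- the homotopy on the bar resolution -/
  h : ∀ k, FreeMod Γ (Fin k → Γ) →ₗ[MonoidAlgebra ℚ Γ] FreeMod Γ (Fin (k + 1) → Γ)
  /-- the homotopy on the finite model -/
  h' : ∀ k, FreeMod Γ (X k) →ₗ[MonoidAlgebra ℚ Γ] FreeMod Γ (X (k + 1))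
  q_q : ∀ k, q k ∘ₗ q k = q k
  q_d : ∀ k, q k ∘ₗ d k = d k
  d_q : ∀ k, d k ∘ₗ q (k + 1) = d k
  d_d : ∀ k, d k ∘ₗ d (k + 1) = 0
  f_q : ∀ k, f k ∘ₗ q k = f k
  q_g : ∀ k, q k ∘ₗ g k = g k
  f_d : ∀ k, f k ∘ₗ d k = barD Γ k ∘ₗ f (k + 1)
  g_d : ∀ k, g k ∘ₗ barD Γ k = d k ∘ₗ g (k + 1)
  fg_zero : f 0 ∘ₗ g 0 = LinearMap.id + barD Γ 0 ∘ₗ h 0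
  fg_succ : ∀ k, f (k + 1) ∘ₗ g (k + 1) =
    LinearMap.id + barD Γ (k + 1) ∘ₗ h (k + 1) + h k ∘ₗ barD Γ k
  gf_zero : g 0 ∘ₗ f 0 = q 0 + d 0 ∘ₗ h' 0
  gf_succ : ∀ k, g (k + 1) ∘ₗ f (k + 1) = q (k + 1) + d (k + 1) ∘ₗ h' (k + 1) + h' k ∘ₗ d k

end BarComplex

theorem barD_comp_barD (Γ : Type) [Group Γ] (k : ℕ) : barD Γ k ∘ₗ barD Γ (k + 1) = 0 := by
  have h : Rep.barComplex.d ℚ Γ (k + 1) ≫ Rep.barComplex.d ℚ Γ k = 0 := by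
    rw [← Rep.barComplex.d_def, ← Rep.barComplex.d_def]
    exact (Rep.barComplex ℚ Γ).d_comp_d _ _ _
  have h2 := congrArg asModuleMap h
  rw [asModuleMap_comp, asModuleMap_zero] at h2
  ext1 x
  apply LinearMap.ext
  intro u
  have h3 := LinearMap.congr_fun h2 ((barEquiv Γ (k + 1 + 1)).symm (Finsupp.single x u))
  simp only [barD, LinearMap.comp_apply, LinearEquiv.coe_coe, LinearEquiv.symm_apply_apply]
  exact (congrArg (barEquiv Γ k) h3).trans (map_zero _)

/-- A projective module is a retract of a free module, of finite rank if the module is finite. -/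
theorem exists_free_retract (R : Type) [Ring R] (P : Type) [AddCommGroup P] [Module R P]
    [Module.Projective R P] : ∃ (X : Type) (i : P →ₗ[R] (X →₀ R)) (r : (X →₀ R) →ₗ[R] P),
      r ∘ₗ i = LinearMap.id ∧ (Module.Finite R P → Finite X) := by
  classical
  by_cases hP : Module.Finite R P
  · obtain ⟨n, r, hr⟩ := Module.Finite.exists_fin' R P
    let r' : (Fin n →₀ R) →ₗ[R] P := r ∘ₗ (Finsupp.linearEquivFunOnFinite R R (Fin n)).toLinearMap
    have hr' : Function.Surjective r' := hr.comp (LinearEquiv.surjective _)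
    obtain ⟨i, hi⟩ := Module.projective_lifting_property r' LinearMap.id hr'
    exact ⟨Fin n, i, r', hi, fun _ => inferInstance⟩
  · obtain ⟨i, hi⟩ := Module.projective_def'.1 (inferInstance : Module.Projective R P)
    exact ⟨P, i, _, hi, fun h => absurd h hP⟩

section HomotopyComponents

variable {Γ : Type} [Group Γ] {K L : ChainComplex (Rep.{0} ℚ Γ) ℕ}

theorem asModuleMap_comm (φ : K ⟶ L) (k : ℕ) (x : (K.X (k + 1)).ρ.asModule) :
    asModuleMap (φ.f k) (asModuleMap (K.d (k + 1) k) x) =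
      asModuleMap (L.d (k + 1) k) (asModuleMap (φ.f (k + 1)) x) :=
  (LinearMap.congr_fun (congrArg asModuleMap (φ.comm (k + 1) k)) x).symm

theorem asModuleMap_homotopy_zero {φ : K ⟶ K} (S : Homotopy φ (𝟙 K)) (x : (K.X 0).ρ.asModule) :
    asModuleMap (φ.f 0) x = x + asModuleMap (K.d 1 0) (asModuleMap (S.hom 0 1) x) := by
  have h := S.comm 0
  rw [Homotopy.dNext_zero_chainComplex, Homotopy.prevD_chainComplex, zero_add, add_comm] at h
  exact LinearMap.congr_fun (congrArg asModuleMap h) x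

theorem asModuleMap_homotopy_succ {φ : K ⟶ K} (S : Homotopy φ (𝟙 K)) (k : ℕ)
    (x : (K.X (k + 1)).ρ.asModule) :
    asModuleMap (φ.f (k + 1)) x =
      x + asModuleMap (K.d (k + 2) (k + 1)) (asModuleMap (S.hom (k + 1) (k + 2)) x) +
        asModuleMap (S.hom k (k + 1)) (asModuleMap (K.d (k + 1) k) x) := by
  have h := S.comm (k + 1)
  rw [Homotopy.dNext_succ_chainComplex, Homotopy.prevD_chainComplex] at h
  rw [h, asModuleMap_add, asModuleMap_add]
  change asModuleMap (S.hom k (k + 1)) (asModuleMap (K.d (k + 1) k) x) +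
    asModuleMap (K.d (k + 2) (k + 1)) (asModuleMap (S.hom (k + 1) (k + 2)) x) + x = _
  abel

end HomotopyComponents

theorem IsTypeFP.nonempty_finiteModel {Γ : Type} [Group Γ] {m : ℕ} (hΓ : IsTypeFP Γ m) :
    Nonempty (FiniteModel Γ m) := by
  obtain ⟨P, hP⟩ := hΓ
  have hproj : ∀ k, Module.Projective (MonoidAlgebra ℚ Γ) (P.complex.X k).ρ.asModule := by
    intro k
    have h1 : Projective (Rep.toModuleMonoidAlgebra.obj (P.complex.X k)) :=
      Rep.equivalenceModuleMonoidAlgebra.map_projective_iff (P.complex.X k) |>.2 (P.projective k)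
    exact IsProjective.iff_projective _ |>.2 h1
  choose X i r hir hfin using fun k =>
    exists_free_retract (MonoidAlgebra ℚ Γ) (P.complex.X k).ρ.asModule
  have hri : ∀ k (x : (P.complex.X k).ρ.asModule), r k (i k x) = x :=
    fun k x => LinearMap.congr_fun (hir k) x
  obtain ⟨Q, H, b, hB⟩ : ∃ (Q : ChainComplex (Rep.{0} ℚ Γ) ℕ) (_ : HomotopyEquiv P.complex Q)
      (b : ∀ k, (Q.X k).ρ.asModule ≃ₗ[MonoidAlgebra ℚ Γ] FreeMod Γ (Fin k → Γ)),
      ∀ k x, barD Γ k x = b k (asModuleMap (Q.d (k + 1) k) ((b (k + 1)).symm x)) := by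
    refine ⟨Rep.barComplex ℚ Γ, P.homotopyEquiv (Rep.barResolution ℚ Γ), barEquiv Γ, ?_⟩
    intro k x
    rw [Rep.barComplex.d_def]
    rfl
  have hDD : ∀ k x, asModuleMap (P.complex.d (k + 1) k)
      (asModuleMap (P.complex.d (k + 1 + 1) (k + 1)) x) = 0 := fun k x =>
    LinearMap.congr_fun (congrArg asModuleMap (P.complex.d_comp_d (k + 1 + 1) (k + 1) k)) x
  have hFG0 := asModuleMap_homotopy_zero H.homotopyInvHomId
  have hGF0 := asModuleMap_homotopy_zero H.homotopyHomInvId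
  have hFG := asModuleMap_homotopy_succ H.homotopyInvHomId
  have hGF := asModuleMap_homotopy_succ H.homotopyHomInvId
  simp only [HomologicalComplex.comp_f, asModuleMap_comp, LinearMap.comp_apply] at hFG0 hGF0 hFG hGF
  refine ⟨{ X := X
            finite := fun k hk => hfin k (hP k hk)
            d := fun k => i k ∘ₗ asModuleMap (P.complex.d (k + 1) k) ∘ₗ r (k + 1)
            q := fun k => i k ∘ₗ r k
            f := fun k => (b k).toLinearMap ∘ₗ asModuleMap (H.hom.f k) ∘ₗ r k
            g := fun k => i k ∘ₗ asModuleMap (H.inv.f k) ∘ₗ (b k).symm.toLinearMap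
            h := fun k => (b (k + 1)).toLinearMap ∘ₗ
              asModuleMap (H.homotopyInvHomId.hom k (k + 1)) ∘ₗ (b k).symm.toLinearMap
            h' := fun k => i (k + 1) ∘ₗ asModuleMap (H.homotopyHomInvId.hom k (k + 1)) ∘ₗ r k
            q_q := fun k => ?_
            q_d := fun k => ?_
            d_q := fun k => ?_
            d_d := fun k => ?_
            f_q := fun k => ?_
            q_g := fun k => ?_
            f_d := fun k => ?_
            g_d := fun k => ?_
            fg_zero := ?_
            fg_succ := fun k => ?_
            gf_zero := ?_
            gf_succ := fun k => ?_ }⟩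
  all_goals
    refine LinearMap.ext fun x => ?_
    simp only [LinearMap.comp_apply, LinearMap.add_apply, LinearMap.zero_apply,
      LinearEquiv.coe_coe, hri, hDD, asModuleMap_comm, hB, LinearEquiv.symm_apply_apply,
      map_zero, LinearMap.id_apply, hFG0, hGF0, hFG, hGF, map_add, LinearEquiv.apply_symm_apply]

/-! ### The rational group ring acting on a complex algebra -/

section GroupRing

variable {Γ : Type} [Group Γ] {B : Type} [Ring B] [Algebra ℂ B]

/-- The ring homomorphism `ℚΓ → B` that extends a homomorphism `u` from `Γ` to the multiplicative
monoid of a complex algebra `B`. -/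
def groupRingHom (u : Γ →* B) : MonoidAlgebra ℚ Γ →+* B :=
  MonoidAlgebra.liftNCRingHom ((algebraMap ℂ B).comp (algebraMap ℚ ℂ)) u
    fun _ _ => Algebra.commutes _ _

theorem groupRingHom_single (u : Γ →* B) (g : Γ) (c : ℚ) :
    groupRingHom u (MonoidAlgebra.single g c) = (c : ℂ) • u g := by
  refine (MonoidAlgebra.liftNC_single _ _ _ _).trans ?_
  simp [Algebra.smul_def]

/-- The anti-automorphism of `ℚΓ` that inverts group elements. -/
def groupRingInv : MonoidAlgebra ℚ Γ →+* (MonoidAlgebra ℚ Γ)ᵐᵒᵖ :=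
  MonoidAlgebra.liftNCRingHom (algebraMap ℚ _)
    { toFun := fun g => MulOpposite.op (MonoidAlgebra.single g⁻¹ 1)
      map_one' := by simp [MonoidAlgebra.one_def]
      map_mul' := fun g h => by
        rw [← MulOpposite.op_mul, MonoidAlgebra.single_mul_single, mul_inv_rev, one_mul] }
    fun _ _ => Algebra.commutes _ _

theorem groupRingInv_single (g : Γ) (c : ℚ) :
    (groupRingInv (MonoidAlgebra.single g c)).unop = MonoidAlgebra.single g⁻¹ c := by
  refine (congrArg MulOpposite.unop (MonoidAlgebra.liftNC_single _ _ _ _)).trans ?_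
  simp

theorem map_groupRingHom {C F : Type} [Ring C] [Algebra ℂ C] [FunLike F B C] [AlgHomClass F ℂ B C]
    (θ : F) (u : Γ →* B) (v : Γ →* C) (h : ∀ g, θ (u g) = v g) (r : MonoidAlgebra ℚ Γ) :
    θ (groupRingHom u r) = groupRingHom v r := by
  induction r using MonoidAlgebra.induction_linear with
  | zero => simp
  | add a b ha hb => simp [ha, hb]
  | single g c => rw [groupRingHom_single, groupRingHom_single, map_smul, h]

theorem star_groupRingHom [StarRing B] [StarModule ℂ B] (u : Γ →* B)
    (h : ∀ g, star (u g) = u g⁻¹) (r : MonoidAlgebra ℚ Γ) :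
    star (groupRingHom u r) = groupRingHom u (groupRingInv r).unop := by
  induction r using MonoidAlgebra.induction_linear with
  | zero => simp
  | add a b ha hb => simp [ha, hb]
  | single g c =>
    rw [groupRingHom_single, groupRingInv_single, groupRingHom_single, star_smul, h]
    simp

end GroupRing

/-! ### Cochains and chains with values in a module -/

section PullPush

variable {Γ : Type} [Group Γ] {V : Type} [AddCommGroup V] [Module ℂ V]
variable (α : MonoidAlgebra ℚ Γ →+* Module.End ℂ V) {X Y Z : Type}

/-- The extension of a function `c : X → V` to a `ℚΓ`-linear map on the free module on `X`. -/
def evalCochain (c : X → V) : FreeMod Γ X →+ V :=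
  Finsupp.liftAddHom fun x => ((LinearMap.applyₗ (c x)).toAddMonoidHom.comp α.toAddMonoidHom)

theorem evalCochain_single (c : X → V) (x : X) (r : MonoidAlgebra ℚ Γ) :
    evalCochain α c (Finsupp.single x r) = α r (c x) := by
  simp [evalCochain]

theorem evalCochain_smul (c : X → V) (r : MonoidAlgebra ℚ Γ) (u : FreeMod Γ X) :
    evalCochain α c (r • u) = α r (evalCochain α c u) := by
  induction u using Finsupp.induction_linear with
  | zero => simp
  | add a b ha hb => simp [ha, hb]
  | single x s =>
    rw [Finsupp.smul_single, smul_eq_mul, evalCochain_single, evalCochain_single, map_mul]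
    rfl

theorem evalCochain_eq_sum [Fintype X] (c : X → V) (u : FreeMod Γ X) :
    evalCochain α c u = ∑ x, α (u x) (c x) := by
  rw [evalCochain, Finsupp.liftAddHom_apply, Finsupp.sum_fintype]
  · rfl
  · simp

/-- The map on `V`-valued cochains induced by a map of free `ℚΓ`-modules, where `V`-valued cochains
on `X` are `ℚΓ`-linear maps from the free module on `X` to `V`. -/
def pull (φ : FreeMod Γ X →ₗ[MonoidAlgebra ℚ Γ] FreeMod Γ Y) : (Y → V) →ₗ[ℂ] (X → V) where
  toFun c x := evalCochain α c (φ (Finsupp.single x 1))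
  map_add' c c' := by
    ext x
    change evalCochain α (c + c') (φ (Finsupp.single x 1)) =
      evalCochain α c (φ (Finsupp.single x 1)) + evalCochain α c' (φ (Finsupp.single x 1))
    generalize φ (Finsupp.single x 1) = u
    induction u using Finsupp.induction_linear with
    | zero => simp
    | add a b ha hb =>
      simp only [map_add] at ha hb ⊢
      rw [ha, hb]
      abel
    | single x s => simp [evalCochain_single]
  map_smul' t c := by
    ext x
    change evalCochain α (t • c) (φ (Finsupp.single x 1)) =
      t • evalCochain α c (φ (Finsupp.single x 1))
    generalize φ (Finsupp.single x 1) = u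
    induction u using Finsupp.induction_linear with
    | zero => simp
    | add a b ha hb =>
      simp only [map_add, smul_add] at ha hb ⊢
      rw [ha, hb]
    | single x s => simp [evalCochain_single]

theorem pull_apply (φ : FreeMod Γ X →ₗ[MonoidAlgebra ℚ Γ] FreeMod Γ Y) (c : Y → V) (x : X) :
    pull α φ c x = evalCochain α c (φ (Finsupp.single x 1)) := rfl

theorem evalCochain_pull (φ : FreeMod Γ X →ₗ[MonoidAlgebra ℚ Γ] FreeMod Γ Y) (c : Y → V)
    (u : FreeMod Γ X) : evalCochain α (pull α φ c) u = evalCochain α c (φ u) := by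
  induction u using Finsupp.induction_linear with
  | zero => simp
  | add a b ha hb => simp [ha, hb]
  | single x s =>
    rw [evalCochain_single, pull_apply, ← evalCochain_smul, ← map_smul, Finsupp.smul_single,
      smul_eq_mul, mul_one]

theorem pull_comp (φ : FreeMod Γ X →ₗ[MonoidAlgebra ℚ Γ] FreeMod Γ Y)
    (ψ : FreeMod Γ Y →ₗ[MonoidAlgebra ℚ Γ] FreeMod Γ Z) (c : Z → V) :
    pull α (ψ ∘ₗ φ) c = pull α φ (pull α ψ c) := by
  ext x
  rw [pull_apply, pull_apply, evalCochain_pull, LinearMap.comp_apply]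

theorem pull_id (c : X → V) : pull α LinearMap.id c = c := by
  ext x
  simp [pull_apply, evalCochain_single]

theorem pull_add (φ ψ : FreeMod Γ X →ₗ[MonoidAlgebra ℚ Γ] FreeMod Γ Y) (c : Y → V) :
    pull α (φ + ψ) c = pull α φ c + pull α ψ c := by
  ext x
  simp [pull_apply]

theorem pull_zero (c : Y → V) :
    pull α (0 : FreeMod Γ X →ₗ[MonoidAlgebra ℚ Γ] FreeMod Γ Y) c = 0 := by
  ext x
  simp [pull_apply]

theorem continuous_pull [TopologicalSpace V] [IsTopologicalAddGroup V]
    (hα : ∀ r, Continuous (α r)) (φ : FreeMod Γ X →ₗ[MonoidAlgebra ℚ Γ] FreeMod Γ Y) :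
    Continuous (pull α φ : (Y → V) → (X → V)) := by
  refine continuous_pi fun x => ?_
  change Continuous fun c : Y → V => evalCochain α c (φ (Finsupp.single x 1))
  generalize φ (Finsupp.single x 1) = u
  induction u using Finsupp.induction_linear with
  | zero => simpa using continuous_const
  | add a b ha hb =>
    simp only [map_add]
    exact ha.add hb
  | single x s =>
    simp only [evalCochain_single]
    exact (hα s).comp (continuous_apply x)

/-- The chain `u ⊗ v`, where the chains on `X` with values in `V` are the tensor product over `ℚΓ`
of the free module on `X`, made a right module by inverting group elements, with `V`. -/
def tensorChain : FreeMod Γ X →+ (V →ₗ[ℂ] (X →₀ V)) :=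
  Finsupp.liftAddHom fun x =>
    { toFun := fun r => Finsupp.lsingle x ∘ₗ α (groupRingInv r).unop
      map_zero' := by simp
      map_add' := fun r s => by simp [LinearMap.comp_add] }

theorem tensorChain_single (x : X) (r : MonoidAlgebra ℚ Γ) (v : V) :
    tensorChain α (Finsupp.single x r) v = Finsupp.single x (α (groupRingInv r).unop v) := by
  simp [tensorChain]

theorem tensorChain_smul (r : MonoidAlgebra ℚ Γ) (u : FreeMod Γ X) (v : V) :
    tensorChain α (r • u) v = tensorChain α u (α (groupRingInv r).unop v) := by
  induction u using Finsupp.induction_linear with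
  | zero => simp
  | add a b ha hb => simp [ha, hb]
  | single x s =>
    rw [Finsupp.smul_single, smul_eq_mul, tensorChain_single, tensorChain_single, map_mul,
      MulOpposite.unop_mul, map_mul]
    rfl

theorem tensorChain_apply (u : FreeMod Γ X) (v : V) (x : X) :
    tensorChain α u v x = α (groupRingInv (u x)).unop v := by
  classical
  induction u using Finsupp.induction_linear with
  | zero => simp
  | add a b ha hb => simp [ha, hb]
  | single y s =>
    rw [tensorChain_single, Finsupp.single_apply, Finsupp.single_apply]
    split_ifs <;> simp

/-- The map on `V`-valued chains induced by a map of free `ℚΓ`-modules. -/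
def push (φ : FreeMod Γ X →ₗ[MonoidAlgebra ℚ Γ] FreeMod Γ Y) : (X →₀ V) →ₗ[ℂ] (Y →₀ V) :=
  Finsupp.lsum ℂ fun x => tensorChain α (φ (Finsupp.single x 1))

theorem push_single (φ : FreeMod Γ X →ₗ[MonoidAlgebra ℚ Γ] FreeMod Γ Y) (x : X) (v : V) :
    push α φ (Finsupp.single x v) = tensorChain α (φ (Finsupp.single x 1)) v := by
  simp [push]

theorem push_tensorChain (φ : FreeMod Γ X →ₗ[MonoidAlgebra ℚ Γ] FreeMod Γ Y) (u : FreeMod Γ X)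
    (v : V) : push α φ (tensorChain α u v) = tensorChain α (φ u) v := by
  induction u using Finsupp.induction_linear with
  | zero => simp
  | add a b ha hb => simp [ha, hb]
  | single x s =>
    rw [tensorChain_single, push_single, ← tensorChain_smul, ← map_smul, Finsupp.smul_single,
      smul_eq_mul, mul_one]

theorem push_comp (φ : FreeMod Γ X →ₗ[MonoidAlgebra ℚ Γ] FreeMod Γ Y)
    (ψ : FreeMod Γ Y →ₗ[MonoidAlgebra ℚ Γ] FreeMod Γ Z) (c : X →₀ V) :
    push α (ψ ∘ₗ φ) c = push α ψ (push α φ c) := by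
  induction c using Finsupp.induction_linear with
  | zero => simp
  | add a b ha hb => simp [ha, hb]
  | single x v => rw [push_single, push_single, push_tensorChain, LinearMap.comp_apply]

theorem push_id (c : X →₀ V) : push α LinearMap.id c = c := by
  induction c using Finsupp.induction_linear with
  | zero => simp
  | add a b ha hb => simp [ha, hb]
  | single x v => simp [push_single, tensorChain_single]

theorem push_add (φ ψ : FreeMod Γ X →ₗ[MonoidAlgebra ℚ Γ] FreeMod Γ Y) (c : X →₀ V) :
    push α (φ + ψ) c = push α φ c + push α ψ c := by
  induction c using Finsupp.induction_linear with
  | zero => simp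
  | add a b ha hb => rw [map_add, map_add, map_add, ha, hb]; abel
  | single x v => simp [push_single]

theorem push_apply [Fintype X] (φ : FreeMod Γ X →ₗ[MonoidAlgebra ℚ Γ] FreeMod Γ Y) (c : X →₀ V)
    (y : Y) : push α φ c y = ∑ x, α (groupRingInv (φ (Finsupp.single x 1) y)).unop (c x) := by
  rw [push, Finsupp.lsum_apply, Finsupp.sum_fintype _ _ (by simp), Finsupp.finsetSum_apply]
  simp [tensorChain_apply]

end PullPush

/-! ### Group cohomology and group homology in terms of the bar resolution -/

section Bar

variable {Γ : Type} [Group Γ] {V : Type} [AddCommGroup V] [Module ℂ V]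

/-- The action of `ℚΓ` on a complex representation of `Γ`. -/
def repHom (ρ : Representation ℂ Γ V) : MonoidAlgebra ℚ Γ →+* Module.End ℂ V := groupRingHom ρ

theorem repHom_single (ρ : Representation ℂ Γ V) (g : Γ) (c : ℚ) (v : V) :
    repHom ρ (MonoidAlgebra.single g c) v = (c : ℂ) • ρ g v := by
  rw [repHom, groupRingHom_single, LinearMap.smul_apply]

/-- The map induced by the differential of the bar resolution on cochains is the differential of
the inhomogeneous cochains. -/
theorem pull_barD (ρ : Representation ℂ Γ V) (n : ℕ) (c : (Fin n → Γ) → V) :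
    pull (repHom ρ) (barD Γ n) c = (inhomogeneousCochains.d (Rep.of ρ) n).hom c := by
  ext g
  rw [pull_apply, barD_single, inhomogeneousCochains.d_hom_apply]
  simp [evalCochain_single, repHom_single]

theorem push_barD (ρ : Representation ℂ Γ V) (n : ℕ) (c : (Fin (n + 1) → Γ) →₀ V) :
    push (repHom ρ) (barD Γ n) c = (groupHomology.inhomogeneousChains.d (Rep.of ρ) n).hom c := by
  induction c using Finsupp.induction_linear with
  | zero => simp
  | add a b ha hb => rw [map_add, map_add, ha, hb]
  | single g v =>
    rw [push_single, barD_single]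
    refine Eq.trans ?_ (groupHomology.inhomogeneousChains.d_single (A := Rep.of ρ) n g v).symm
    simp [tensorChain_single, repHom_single, groupRingInv_single]

theorem pull_barD_eq_d (ρ : Representation ℂ Γ V) (n : ℕ) (c : (Fin n → Γ) → V) :
    pull (repHom ρ) (barD Γ n) c =
      ((groupCohomology.inhomogeneousCochains (Rep.of ρ)).d n (n + 1)).hom c := by
  rw [groupCohomology.inhomogeneousCochains.d_def, pull_barD]

theorem push_barD_eq_d (ρ : Representation ℂ Γ V) (n : ℕ) (c : (Fin (n + 1) → Γ) →₀ V) :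
    push (repHom ρ) (barD Γ n) c =
      ((groupHomology.inhomogeneousChains (Rep.of ρ)).d (n + 1) n).hom c := by
  rw [groupHomology.inhomogeneousChains.d_def, push_barD]

theorem subsingleton_groupCohomology_succ_iff (ρ : Representation ℂ Γ V) (n : ℕ) :
    Subsingleton (groupCohomology (Rep.of ρ) (n + 1)) ↔
      ∀ c : (Fin (n + 1) → Γ) → V, pull (repHom ρ) (barD Γ (n + 1)) c = 0 →
        ∃ b, pull (repHom ρ) (barD Γ n) b = c := by
  rw [← ModuleCat.isZero_iff_subsingleton, groupCohomology,
    ← HomologicalComplex.exactAt_iff_isZero_homology,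
    HomologicalComplex.exactAt_iff' _ n (n + 1) (n + 2) (by simp) (by simp),
    ShortComplex.moduleCat_exact_iff]
  constructor
  · intro h c hc
    obtain ⟨b, hb⟩ := h c ((pull_barD_eq_d ρ (n + 1) c).symm.trans hc)
    exact ⟨b, (pull_barD_eq_d ρ n b).trans hb⟩
  · intro h c hc
    obtain ⟨b, hb⟩ := h c ((pull_barD_eq_d ρ (n + 1) c).trans hc)
    exact ⟨b, (pull_barD_eq_d ρ n b).symm.trans hb⟩

theorem subsingleton_groupHomology_succ_iff (ρ : Representation ℂ Γ V) (n : ℕ) :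
    Subsingleton (groupHomology (Rep.of ρ) (n + 1)) ↔
      ∀ c : (Fin (n + 1) → Γ) →₀ V, push (repHom ρ) (barD Γ n) c = 0 →
        ∃ b, push (repHom ρ) (barD Γ (n + 1)) b = c := by
  rw [← ModuleCat.isZero_iff_subsingleton, groupHomology,
    ← HomologicalComplex.exactAt_iff_isZero_homology,
    HomologicalComplex.exactAt_iff' _ (n + 2) (n + 1) n (by simp) (by simp),
    ShortComplex.moduleCat_exact_iff]
  constructor
  · intro h c hc
    obtain ⟨b, hb⟩ := h c ((push_barD_eq_d ρ n c).symm.trans hc)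
    exact ⟨b, (push_barD_eq_d ρ (n + 1) b).trans hb⟩
  · intro h c hc
    obtain ⟨b, hb⟩ := h c ((push_barD_eq_d ρ n c).trans hc)
    exact ⟨b, (push_barD_eq_d ρ (n + 1) b).symm.trans hb⟩

/-- The quotient topology on a quotient of a topological abelian group is Hausdorff if and only if
the kernel is closed. -/
theorem t2Space_coinduced_iff {Z H : Type} [AddCommGroup Z] [TopologicalSpace Z]
    [IsTopologicalAddGroup Z] [AddCommGroup H] (p : Z →+ H) (hp : Function.Surjective p) :
    @T2Space H (TopologicalSpace.coinduced p inferInstance) ↔ IsClosed {z | p z = 0} := by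
  let _ : TopologicalSpace H := TopologicalSpace.coinduced p inferInstance
  have hq : Topology.IsQuotientMap p := ⟨⟨rfl⟩, hp⟩
  constructor
  · intro h
    exact isClosed_singleton.preimage hq.continuous
  · intro h
    have ho : IsOpenQuotientMap p := by
      refine ⟨hp, hq.continuous, fun U hU => ?_⟩
      rw [← hq.isOpen_preimage]
      have : p ⁻¹' (p '' U) = ⋃ z ∈ {z | p z = 0}, (fun w => w + z) ⁻¹' U := by
        ext w
        simp only [Set.mem_preimage, Set.mem_image, Set.mem_iUnion, Set.mem_ofPred_eq, exists_prop]
        constructor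
        · rintro ⟨u, hu, hw⟩
          exact ⟨u - w, by rw [map_sub, hw, sub_self], by simpa using hu⟩
        · rintro ⟨z, hz, hu⟩
          exact ⟨w + z, hu, by rw [map_add, hz, add_zero]⟩
      rw [this]
      exact isOpen_biUnion fun z _ => hU.preimage (continuous_id.add continuous_const)
    refine (t2Space_iff_of_isOpenQuotientMap ho).2 ?_
    have : {q : Z × Z | p q.1 = p q.2} = (fun q : Z × Z => q.1 - q.2) ⁻¹' {z | p z = 0} := by
      ext q
      simp [sub_eq_zero]
    rw [this]
    exact h.preimage (continuous_fst.sub continuous_snd)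

variable [TopologicalSpace V] [IsTopologicalAddGroup V]

theorem continuous_repHom {ρ : Representation ℂ Γ V} [ContinuousConstSMul ℂ V]
    (hρ : ∀ g, Continuous (ρ g)) (r : MonoidAlgebra ℚ Γ) : Continuous (repHom ρ r) := by
  induction r using MonoidAlgebra.induction_linear with
  | zero =>
    rw [map_zero]
    exact continuous_const
  | add a b ha hb =>
    simp only [map_add]
    exact ha.add hb
  | single g c =>
    have : (repHom ρ (MonoidAlgebra.single g c) : V → V) = fun v => (c : ℂ) • ρ g v :=
      funext (repHom_single ρ g c)
    rw [this]
    exact (hρ g).const_smul _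

/-- `H^{n+1}` is Hausdorff if and only if the coboundaries are closed in the cochains: the cocycles
are a closed subspace, and the kernel of the projection to cohomology consists of coboundaries. -/
theorem cohomologyHausdorff_succ_iff {ρ : Representation ℂ Γ V} [ContinuousConstSMul ℂ V]
    [T2Space V] (hρ : ∀ g, Continuous (ρ g)) (n : ℕ) :
    CohomologyHausdorff ρ (n + 1) ↔ IsClosed (Set.range (pull (repHom ρ) (barD Γ n))) := by
  let K := groupCohomology.inhomogeneousCochains (Rep.of ρ)
  let i : K.cycles (n + 1) →+ ((Fin (n + 1) → Γ) → V) :=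
    (K.iCycles (n + 1)).hom.toAddMonoidHom
  let p : K.cycles (n + 1) →+ K.homology (n + 1) :=
    (K.homologyπ (n + 1)).hom.toAddMonoidHom
  let _ : TopologicalSpace (K.cycles (n + 1)) :=
    TopologicalSpace.induced i Pi.topologicalSpace
  have htg : IsTopologicalAddGroup (K.cycles (n + 1)) :=
    topologicalAddGroup_induced i
  have hpsurj : Function.Surjective p :=
    (ModuleCat.epi_iff_surjective (K.homologyπ (n + 1))).1 inferInstance
  have hinj : Function.Injective i :=
    (ModuleCat.mono_iff_injective (K.iCycles (n + 1))).1 inferInstance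
  have hrange : Set.range i = {c | pull (repHom ρ) (barD Γ (n + 1)) c = 0} := by
    ext c
    rw [Set.mem_range, Set.mem_ofPred_eq, pull_barD]
    constructor
    · rintro ⟨z, rfl⟩
      have h := K.iCycles_d (n + 1) (n + 2)
      rw [groupCohomology.inhomogeneousCochains.d_def] at h
      exact LinearMap.congr_fun (congrArg ModuleCat.Hom.hom h) z
    · intro h
      exact ⟨groupCohomology.cocyclesMk (A := Rep.of ρ) c h,
        groupCohomology.iCocycles_mk (A := Rep.of ρ) c h⟩
  have hclosed : Topology.IsClosedEmbedding i := by
    refine ⟨⟨⟨rfl⟩, hinj⟩, ?_⟩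
    rw [hrange]
    exact isClosed_eq (continuous_pull _ (continuous_repHom hρ) _) continuous_const
  have hker : ∀ z, p z = 0 ↔ i z ∈ Set.range (pull (repHom ρ) (barD Γ n)) := by
    intro z
    have h1 : K.homologyι (n + 1) (K.homologyπ (n + 1) z) =
        K.pOpcycles (n + 1) (K.iCycles (n + 1) z) :=
      LinearMap.congr_fun (congrArg ModuleCat.Hom.hom (K.homology_π_ι (n + 1))) z
    have h2 : Function.Injective (K.homologyι (n + 1)) :=
      (ModuleCat.mono_iff_injective _).1 inferInstance
    have h3 : K.homologyπ (n + 1) z = 0 ↔ K.pOpcycles (n + 1) (K.iCycles (n + 1) z) = 0 := by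
      rw [← h1, map_eq_zero_iff _ h2]
    refine h3.trans ?_
    have h4 := (ShortComplex.exact_of_g_is_cokernel
      (ShortComplex.mk (K.d n (n + 1)) (K.pOpcycles (n + 1)) (K.d_pOpcycles _ _))
      (K.opcyclesIsCokernel n (n + 1) (by simp))).moduleCat_range_eq_ker
    refine (SetLike.ext_iff.1 h4 (K.iCycles (n + 1) z)).symm.trans ?_
    exact exists_congr fun b => Eq.congr_left (pull_barD_eq_d ρ n b).symm
  have himage : i '' {z | p z = 0} = Set.range (pull (repHom ρ) (barD Γ n)) := by
    refine Set.Subset.antisymm ?_ ?_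
    · rintro _ ⟨z, hz, rfl⟩
      exact (hker z).1 hz
    · rintro c hc
      have hci : c ∈ Set.range i := by
        rw [hrange]
        obtain ⟨b, rfl⟩ := hc
        rw [Set.mem_ofPred_eq, ← pull_comp, barD_comp_barD, pull_zero]
      obtain ⟨z, rfl⟩ := hci
      exact ⟨z, (hker z).2 hc, rfl⟩
  rw [← himage, ← hclosed.isClosed_iff_image_isClosed]
  exact t2Space_coinduced_iff p hpsurj

theorem homologyZeroHausdorff_iff (ρ : Representation ℂ Γ V) :
    HomologyZeroHausdorff ρ ↔
      IsClosed {v : V | Finsupp.single default v ∈ Set.range (push (repHom ρ) (barD Γ 0))} := by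
  have hsurj : Function.Surjective (groupHomology.H0π (Rep.of ρ)).hom :=
    (ModuleCat.epi_iff_surjective _).1 inferInstance
  have hker : ∀ v : V, (groupHomology.H0π (Rep.of ρ)).hom v = 0 ↔
      v ∈ Representation.Coinvariants.ker ρ := by
    intro v
    have h := LinearMap.congr_fun
      (congrArg ModuleCat.Hom.hom (groupHomology.H0π_comp_H0Iso_hom (Rep.of ρ))) v
    have hinj : Function.Injective (groupHomology.H0Iso (Rep.of ρ)).hom.hom :=
      (ModuleCat.mono_iff_injective _).1 inferInstance
    rw [← map_eq_zero_iff (groupHomology.H0Iso (Rep.of ρ)).hom.hom hinj]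
    refine Iff.trans ?_ (Representation.Coinvariants.mk_eq_zero ρ)
    exact Eq.congr_left h
  have hset : {v : V | (groupHomology.H0π (Rep.of ρ)).hom v = 0} =
      {v : V | Finsupp.single default v ∈ Set.range (push (repHom ρ) (barD Γ 0))} := by
    ext v
    rw [Set.mem_ofPred_eq, Set.mem_ofPred_eq, hker]
    have hsingle : ∀ (x : Fin 1 → Γ) (w : V), push (repHom ρ) (barD Γ 0) (Finsupp.single x w) =
        Finsupp.single default (ρ (x 0)⁻¹ w - w) := by
      intro x w
      rw [push_single, barD_single]
      have hd : ∀ f : Fin 0 → Γ, f = default := fun f => Subsingleton.elim _ _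
      simp [tensorChain_single, repHom_single, groupRingInv_single, sub_eq_add_neg,
        hd (fun i => x i.succ), hd (Fin.contractNth 0 _ x)]
    constructor
    · intro hv
      induction hv using Submodule.span_induction with
      | mem v hv =>
        obtain ⟨⟨g, w⟩, rfl⟩ := hv
        exact ⟨Finsupp.single (fun _ => g⁻¹) w, by rw [hsingle, inv_inv]⟩
      | zero => exact ⟨0, by simp⟩
      | add a b _ _ ha hb =>
        obtain ⟨a', ha'⟩ := ha
        obtain ⟨b', hb'⟩ := hb
        exact ⟨a' + b', by rw [map_add, ha', hb', Finsupp.single_add]⟩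
      | smul t a _ ha =>
        obtain ⟨a', ha'⟩ := ha
        exact ⟨t • a', by rw [map_smul, ha', Finsupp.smul_single]⟩
    · rintro ⟨c, hc⟩
      have : push (repHom ρ) (barD Γ 0) c default ∈ Representation.Coinvariants.ker ρ := by
        clear hc
        induction c using Finsupp.induction_linear with
        | zero => simp
        | add a b ha hb =>
          rw [map_add]
          exact add_mem ha hb
        | single x w =>
          rw [hsingle, Finsupp.single_eq_same]
          exact Representation.Coinvariants.sub_mem_ker _ _
      rwa [hc, Finsupp.single_eq_same] at this
  rw [← hset]
  exact t2Space_coinduced_iff (groupHomology.H0π (Rep.of ρ)).hom.toAddMonoidHom hsurj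

end Bar

/-! ### Comparison of the finite model with the bar resolution -/

theorem single_default_eq {Γ V : Type} [AddCommGroup V] (c : (Fin 0 → Γ) →₀ V) :
    Finsupp.single default (c default) = c := by
  refine Finsupp.ext fun i => ?_
  rw [Subsingleton.elim i default, Finsupp.single_eq_same]

namespace FiniteModel

variable {Γ : Type} [Group Γ] {m : ℕ} (M : FiniteModel Γ m) {V : Type} [AddCommGroup V]
  [Module ℂ V]

section Identities

variable (α : MonoidAlgebra ℚ Γ →+* Module.End ℂ V) (k : ℕ)

theorem pull_d_d (c : M.X k → V) : pull α (M.d (k + 1)) (pull α (M.d k) c) = 0 := by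
  rw [← pull_comp, M.d_d, pull_zero]

theorem pull_q_d (c : M.X k → V) : pull α (M.q (k + 1)) (pull α (M.d k) c) = pull α (M.d k) c := by
  rw [← pull_comp, M.d_q]

theorem pull_f_barD (c : (Fin k → Γ) → V) :
    pull α (M.f (k + 1)) (pull α (barD Γ k) c) = pull α (M.d k) (pull α (M.f k) c) := by
  rw [← pull_comp, ← pull_comp, M.f_d]

theorem pull_g_d (c : M.X k → V) :
    pull α (M.g (k + 1)) (pull α (M.d k) c) = pull α (barD Γ k) (pull α (M.g k) c) := by
  rw [← pull_comp, ← pull_comp, M.g_d]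

theorem pull_g_f (c : (Fin (k + 1) → Γ) → V) (hc : pull α (barD Γ (k + 1)) c = 0) :
    pull α (M.g (k + 1)) (pull α (M.f (k + 1)) c) = c + pull α (barD Γ k) (pull α (M.h k) c) := by
  rw [← pull_comp, M.fg_succ, pull_add, pull_add, pull_id, pull_comp, pull_comp, hc, map_zero,
    add_zero]

theorem pull_f_g (c : M.X (k + 1) → V) (hc : pull α (M.d (k + 1)) c = 0) :
    pull α (M.f (k + 1)) (pull α (M.g (k + 1)) c) =
      pull α (M.q (k + 1)) c + pull α (M.d k) (pull α (M.h' k) c) := by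
  rw [← pull_comp, M.gf_succ, pull_add, pull_add, pull_comp, pull_comp, hc, map_zero, add_zero]

theorem push_q_d (c : M.X (k + 1) →₀ V) : push α (M.q k) (push α (M.d k) c) = push α (M.d k) c := by
  rw [← push_comp, M.q_d]

theorem push_g_barD (c : (Fin (k + 1) → Γ) →₀ V) :
    push α (M.g k) (push α (barD Γ k) c) = push α (M.d k) (push α (M.g (k + 1)) c) := by
  rw [← push_comp, ← push_comp, M.g_d]

theorem push_f_d (c : M.X (k + 1) →₀ V) :
    push α (M.f k) (push α (M.d k) c) = push α (barD Γ k) (push α (M.f (k + 1)) c) := by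
  rw [← push_comp, ← push_comp, M.f_d]

theorem push_f_g (c : (Fin (k + 1) → Γ) →₀ V) (hc : push α (barD Γ k) c = 0) :
    push α (M.f (k + 1)) (push α (M.g (k + 1)) c) =
      c + push α (barD Γ (k + 1)) (push α (M.h (k + 1)) c) := by
  rw [← push_comp, M.fg_succ, push_add, push_add, push_id, push_comp, push_comp, hc, map_zero,
    add_zero]

theorem push_g_f (c : M.X (k + 1) →₀ V) (hc : push α (M.d k) c = 0) :
    push α (M.g (k + 1)) (push α (M.f (k + 1)) c) =
      push α (M.q (k + 1)) c + push α (M.d (k + 1)) (push α (M.h' (k + 1)) c) := by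
  rw [← push_comp, M.gf_succ, push_add, push_add, push_comp, push_comp, hc, map_zero, add_zero]

end Identities

/-- The cohomology of the finite model in degree `k + 1` with coefficients in `V` vanishes. -/
def CochainExact (α : MonoidAlgebra ℚ Γ →+* Module.End ℂ V) (k : ℕ) : Prop :=
  ∀ c : M.X (k + 1) → V, pull α (M.q (k + 1)) c = c → pull α (M.d (k + 1)) c = 0 →
    ∃ b, pull α (M.d k) b = c

/-- The homology of the finite model in degree `k + 1` with coefficients in `V` vanishes. -/
def ChainExact (α : MonoidAlgebra ℚ Γ →+* Module.End ℂ V) (k : ℕ) : Prop :=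
  ∀ c : M.X (k + 1) →₀ V, push α (M.q (k + 1)) c = c → push α (M.d k) c = 0 →
    ∃ b, push α (M.d (k + 1)) b = c

theorem subsingleton_groupCohomology_iff (ρ : Representation ℂ Γ V) (k : ℕ) :
    Subsingleton (groupCohomology (Rep.of ρ) (k + 1)) ↔ M.CochainExact (repHom ρ) k := by
  rw [subsingleton_groupCohomology_succ_iff]
  constructor
  · intro h c hq hd
    obtain ⟨b, hb⟩ := h (pull _ (M.g (k + 1)) c) (by rw [← M.pull_g_d, hd, map_zero])
    refine ⟨pull (repHom ρ) (M.f k) b - pull (repHom ρ) (M.h' k) c, ?_⟩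
    rw [map_sub, ← M.pull_f_barD, hb, M.pull_f_g _ k c hd, hq, add_sub_cancel_right]
  · intro h c hc
    obtain ⟨b, hb⟩ := h (pull _ (M.f (k + 1)) c) (by rw [← pull_comp, M.f_q])
      (by rw [← M.pull_f_barD, hc, map_zero])
    refine ⟨pull (repHom ρ) (M.g k) b - pull (repHom ρ) (M.h k) c, ?_⟩
    rw [map_sub, ← M.pull_g_d, hb, M.pull_g_f _ k c hc, add_sub_cancel_right]

theorem subsingleton_groupHomology_iff (ρ : Representation ℂ Γ V) (k : ℕ) :
    Subsingleton (groupHomology (Rep.of ρ) (k + 1)) ↔ M.ChainExact (repHom ρ) k := by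
  rw [subsingleton_groupHomology_succ_iff]
  constructor
  · intro h c hq hd
    obtain ⟨b, hb⟩ := h (push _ (M.f (k + 1)) c) (by rw [← M.push_f_d, hd, map_zero])
    refine ⟨push (repHom ρ) (M.g (k + 2)) b - push (repHom ρ) (M.h' (k + 1)) c, ?_⟩
    rw [map_sub, ← M.push_g_barD, hb, M.push_g_f _ k c hd, hq, add_sub_cancel_right]
  · intro h c hc
    obtain ⟨b, hb⟩ := h (push _ (M.g (k + 1)) c) (by rw [← push_comp, M.q_g])
      (by rw [← M.push_g_barD, hc, map_zero])
    refine ⟨push (repHom ρ) (M.f (k + 2)) b - push (repHom ρ) (M.h (k + 1)) c, ?_⟩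
    rw [map_sub, ← M.push_f_d, hb, M.push_f_g _ k c hc, add_sub_cancel_right]

variable [TopologicalSpace V] [IsTopologicalAddGroup V]

/-- The coboundaries of the bar resolution are closed if and only if those of the finite model are:
a cochain map and its homotopy inverse are continuous and turn the closures of the coboundaries into
each other, and the cochain homotopies send cocycles to cochains. -/
theorem isClosed_range_pull_iff [T2Space V] {α : MonoidAlgebra ℚ Γ →+* Module.End ℂ V}
    (hα : ∀ r, Continuous (α r)) (k : ℕ) :
    IsClosed (Set.range (pull α (barD Γ k))) ↔ IsClosed (Set.range (pull α (M.d k))) := by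
  constructor
  · intro h
    refine isClosed_of_closure_subset fun c hc => ?_
    have hd : pull α (M.d (k + 1)) c = 0 := by
      have hs : IsClosed {c | pull α (M.d (k + 1)) c = 0} :=
        isClosed_eq (continuous_pull α hα _) continuous_const
      exact closure_minimal (by rintro _ ⟨b, rfl⟩; exact M.pull_d_d α k b) hs hc
    have hq : pull α (M.q (k + 1)) c = c := by
      have hs : IsClosed {c | pull α (M.q (k + 1)) c = c} :=
        isClosed_eq (continuous_pull α hα _) continuous_id
      exact closure_minimal (by rintro _ ⟨b, rfl⟩; exact M.pull_q_d α k b) hs hc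
    have hg : pull α (M.g (k + 1)) c ∈ Set.range (pull α (barD Γ k)) := by
      have hs : IsClosed {c | pull α (M.g (k + 1)) c ∈ Set.range (pull α (barD Γ k))} :=
        h.preimage (continuous_pull α hα _)
      exact closure_minimal
        (by rintro _ ⟨b, rfl⟩; exact ⟨_, (M.pull_g_d α k b).symm⟩) hs hc
    obtain ⟨b, hb⟩ := hg
    refine ⟨pull α (M.f k) b - pull α (M.h' k) c, ?_⟩
    rw [map_sub, ← M.pull_f_barD, hb, M.pull_f_g _ k c hd, hq, add_sub_cancel_right]
  · intro h
    refine isClosed_of_closure_subset fun c hc => ?_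
    have hd : pull α (barD Γ (k + 1)) c = 0 := by
      have hs : IsClosed {c | pull α (barD Γ (k + 1)) c = 0} :=
        isClosed_eq (continuous_pull α hα _) continuous_const
      refine closure_minimal ?_ hs hc
      rintro _ ⟨b, rfl⟩
      rw [Set.mem_ofPred_eq, ← pull_comp, barD_comp_barD, pull_zero]
    have hf : pull α (M.f (k + 1)) c ∈ Set.range (pull α (M.d k)) := by
      have hs : IsClosed {c | pull α (M.f (k + 1)) c ∈ Set.range (pull α (M.d k))} :=
        h.preimage (continuous_pull α hα _)
      exact closure_minimal
        (by rintro _ ⟨b, rfl⟩; exact ⟨_, (M.pull_f_barD α k b).symm⟩) hs hc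
    obtain ⟨b, hb⟩ := hf
    refine ⟨pull α (M.g k) b - pull α (M.h k) c, ?_⟩
    rw [map_sub, ← M.pull_g_d, hb, M.pull_g_f _ k c hd, add_sub_cancel_right]

theorem cohomologyHausdorff_iff [T2Space V] [ContinuousConstSMul ℂ V] {ρ : Representation ℂ Γ V}
    (hρ : ∀ g, Continuous (ρ g)) (k : ℕ) :
    CohomologyHausdorff ρ (k + 1) ↔ IsClosed (Set.range (pull (repHom ρ) (M.d k))) := by
  rw [cohomologyHausdorff_succ_iff hρ, M.isClosed_range_pull_iff (continuous_repHom hρ)]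

theorem homologyZeroHausdorff_iff [T2Space V] [ContinuousConstSMul ℂ V] {ρ : Representation ℂ Γ V}
    (hρ : ∀ g, Continuous (ρ g)) [Finite (M.X 0)] :
    HomologyZeroHausdorff ρ ↔ IsClosed {c : M.X 0 → V |
      Finsupp.equivFunOnFinite.symm c ∈ Set.range (push (repHom ρ) (M.d 0))} := by
  have := Fintype.ofFinite (M.X 0)
  rw [_root_.homologyZeroHausdorff_iff]
  have hα := continuous_repHom hρ
  set α := repHom ρ
  have hcont {Y : Type} (φ : FreeMod Γ (M.X 0) →ₗ[MonoidAlgebra ℚ Γ] FreeMod Γ Y) (y : Y) :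
      Continuous fun c : M.X 0 → V => push α φ (Finsupp.equivFunOnFinite.symm c) y := by
    simp only [push_apply]
    exact continuous_finsetSum _ fun x _ => (hα _).comp (continuous_apply x)
  constructor
  · intro h
    refine isClosed_of_closure_subset fun c hc => ?_
    have hq : push α (M.q 0) (Finsupp.equivFunOnFinite.symm c) =
        Finsupp.equivFunOnFinite.symm c := by
      have hs : IsClosed {c : M.X 0 → V | ∀ x,
          push α (M.q 0) (Finsupp.equivFunOnFinite.symm c) x = c x} := by
        simp only [Set.ofPred_forall]
        exact isClosed_iInter fun x => isClosed_eq (hcont _ x) (continuous_apply x)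
      refine Finsupp.ext fun x => closure_minimal ?_ hs hc x
      rintro c ⟨b, hb⟩ x
      rw [← hb, M.push_q_d, hb]
      rfl
    have hf : push α (M.f 0) (Finsupp.equivFunOnFinite.symm c) default ∈
        {v | Finsupp.single default v ∈ Set.range (push α (barD Γ 0))} := by
      refine closure_minimal ?_ (h.preimage (hcont (M.f 0) default)) hc
      rintro c ⟨b, hb⟩
      rw [Set.mem_preimage, Set.mem_ofPred_eq, single_default_eq, ← hb, M.push_f_d]
      exact ⟨_, rfl⟩
    obtain ⟨b, hb⟩ := hf
    rw [single_default_eq] at hb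
    refine ⟨push α (M.g 1) b - push α (M.h' 0) (Finsupp.equivFunOnFinite.symm c), ?_⟩
    rw [map_sub, ← M.push_g_barD, hb, ← push_comp, M.gf_zero, push_add, push_comp, hq,
      add_sub_cancel_right]
  · intro h
    refine isClosed_of_closure_subset fun v hv => ?_
    have hc : Continuous fun v : V => fun x =>
        push α (M.g 0) (Finsupp.single (default : Fin 0 → Γ) v) x := by
      refine continuous_pi fun x => ?_
      simp only [push_apply]
      refine continuous_finsetSum _ fun i _ => (hα _).comp ?_
      rw [Subsingleton.elim i default]
      simpa using continuous_id'
    have hg := closure_minimal (t := _) ?_ (h.preimage hc) hv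
    · obtain ⟨b, hb⟩ := hg
      have hb' : push α (M.d 0) b = push α (M.g 0) (Finsupp.single (default : Fin 0 → Γ) v) := by
        rw [hb]; ext x; rfl
      refine ⟨push α (M.f 1) b - push α (M.h 0) (Finsupp.single (default : Fin 0 → Γ) v), ?_⟩
      rw [map_sub, ← M.push_f_d, hb', ← push_comp, M.fg_zero, push_add, push_comp, push_id,
        add_sub_cancel_right]
    · rintro v ⟨b, hb⟩
      refine ⟨push α (M.g 1) b, ?_⟩
      rw [← M.push_g_barD, hb]
      ext x; rfl

end FiniteModel

/-! ### Relatively regular elements and matrices of C*-algebras -/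

section Regular

variable {B : Type} [CStarAlgebra B] {S : NonUnitalStarSubalgebra ℂ B}

/-- If left multiplication by `x` has closed range on `S`, then every element of the range has a
preimage of comparable norm, by the open mapping theorem. -/
theorem exists_norm_le_of_isClosed_range (hS : IsClosed (S : Set B)) (x : B)
    (hx : IsClosed ((fun s => x * s) '' (S : Set B))) :
    ∃ C : ℝ, 0 < C ∧ ∀ s ∈ S, ∃ y ∈ S, x * y = x * s ∧ ‖y‖ ≤ C * ‖x * s‖ := by
  let E : Submodule ℂ B := S.toNonUnitalSubalgebra.toSubmodule
  have : CompleteSpace E := hS.completeSpace_coe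
  let f : E →L[ℂ] B := (ContinuousLinearMap.mul ℂ B x).comp E.subtypeL
  have hf : (f.range : Set B) = (fun s => x * s) '' (S : Set B) := by
    ext b
    constructor
    · rintro ⟨s, rfl⟩
      exact ⟨s, s.2, rfl⟩
    · rintro ⟨s, hs, rfl⟩
      exact ⟨⟨s, hs⟩, rfl⟩
  have : CompleteSpace f.range := by
    have : IsClosed (f.range : Set B) := hf ▸ hx
    exact this.completeSpace_coe
  obtain ⟨C, hC, h⟩ := f.rangeRestrict.exists_preimage_norm_le
    (by rintro ⟨_, s, rfl⟩; exact ⟨s, rfl⟩)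
  refine ⟨C, hC, fun s hs => ?_⟩
  obtain ⟨y, hy, hyC⟩ := h ⟨x * s, ⟨⟨s, hs⟩, rfl⟩⟩
  exact ⟨y, y.2, congrArg Subtype.val hy, hyC⟩

/-- If left multiplication by `x` has closed range, then `0` is isolated in the spectrum of
`x* x`. -/
theorem exists_gap_of_isClosed_range (hS : IsClosed (S : Set B)) {x : B} (hxS : x ∈ S)
    (hx : IsClosed ((fun s => x * s) '' (S : Set B))) :
    ∃ ε : ℝ, 0 < ε ∧ ∀ t ∈ quasispectrum ℝ (star x * x), t ≠ 0 → ε ≤ |t| := by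
  obtain ⟨C, hC, hy⟩ := exists_norm_le_of_isClosed_range hS x hx
  refine ⟨1 / (2 * C ^ 2), by positivity, fun t₀ ht₀ h0 => ?_⟩
  have hh : IsSelfAdjoint (star x * x) := .star_mul_self x
  set h := star x * x with hdef
  have hpos : 0 < |t₀| := abs_pos.2 h0
  -- A bump function around `t₀`, and its quotient by `t`.
  let f : ℝ → ℝ := fun t => max 0 (1 - 2 * |t - t₀| / |t₀|)
  let k : ℝ → ℝ := fun t => f t * (t / max (t ^ 2) (t₀ ^ 2 / 4))
  have hf : Continuous f := by fun_prop
  have hden (t : ℝ) : max (t ^ 2) (t₀ ^ 2 / 4) ≠ 0 :=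
    (lt_max_of_lt_right (by positivity)).ne'
  have hk : Continuous k := hf.mul (continuous_id.div (by fun_prop) hden)
  have hf0 : f 0 = 0 := by
    have : 1 - 2 * |0 - t₀| / |t₀| = -1 := by
      rw [zero_sub, abs_neg]; field_simp; norm_num
    simp only [f, this]; norm_num
  have hk0 : k 0 = 0 := by simp [k]
  have hf1 : f t₀ = 1 := by simp [f]
  have hfsupp (t : ℝ) (ht : f t ≠ 0) : |t - t₀| < |t₀| / 2 := by
    by_contra! hlt
    refine ht (max_eq_left ?_)
    rw [sub_nonpos, le_div_iff₀ hpos]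
    linarith
  have hfle (t : ℝ) : |f t| ≤ 1 := by
    rw [abs_of_nonneg (le_max_left _ _)]
    refine max_le zero_le_one (sub_le_self _ (by positivity))
  have hkf (t : ℝ) : k t * t = f t := by
    by_cases ht : f t = 0
    · simp [k, ht]
    have h1 := hfsupp t ht
    have h2 : |t₀| / 2 ≤ |t| := by
      have := abs_sub_abs_le_abs_sub t₀ t
      rw [abs_sub_comm] at this
      linarith
    have h3 : t₀ ^ 2 / 4 ≤ t ^ 2 := by
      rw [← sq_abs t, ← sq_abs t₀]
      nlinarith
    have h4 := hden t
    simp only [k]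
    rw [max_eq_left h3] at h4 ⊢
    have h5 : t ≠ 0 := by rintro rfl; exact h4 (by norm_num)
    field_simp
  have hfS : cfcₙ f h ∈ S := by
    have : IsClosed (S : Set B) := hS
    exact cfcₙ_mem f (mul_mem (star_mem hxS) hxS)
  obtain ⟨y, -, hxy, hyn⟩ := hy _ hfS
  have hkh : cfcₙ k h * h = cfcₙ f h := by
    conv_lhs => rw [← cfcₙ_id' ℝ h]
    rw [cfcₙ_id' ℝ h]
    nth_rw 2 [← cfcₙ_id' ℝ h]
    rw [← cfcₙ_mul k (fun t => t) h hk.continuousOn hk0 continuous_id'.continuousOn rfl]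
    exact cfcₙ_congr fun t _ => hkf t
  have hfy : cfcₙ f h * y = cfcₙ (fun t => f t * f t) h := by
    rw [cfcₙ_mul f f h hf.continuousOn hf0 hf.continuousOn hf0]
    conv_lhs => rw [← hkh]
    conv_rhs => enter [1]; rw [← hkh]
    simp only [hdef, mul_assoc]
    rw [hxy]
  have h1 : 1 ≤ ‖y‖ := by
    have ha : 1 ≤ ‖cfcₙ (fun t => f t * f t) h‖ := by
      have := norm_apply_le_norm_cfcₙ (fun t => f t * f t) h ht₀ (hf.mul hf).continuousOn
        (by simp [hf0])
      simpa [hf1] using this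
    have hb : ‖cfcₙ f h‖ ≤ 1 := norm_cfcₙ_le fun t _ => hfle t
    rw [← hfy] at ha
    calc 1 ≤ ‖cfcₙ f h‖ * ‖y‖ := ha.trans (norm_mul_le _ _)
      _ ≤ 1 * ‖y‖ := by gcongr
      _ = ‖y‖ := one_mul _
  have h2 : ‖x * cfcₙ f h‖ * ‖x * cfcₙ f h‖ ≤ 2 * |t₀| := by
    rw [← CStarRing.norm_star_mul_self, star_mul, ← mul_assoc, mul_assoc _ (star x) x, ← hdef,
      (cfcₙ_predicate f h : IsSelfAdjoint _).star_eq]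
    have : cfcₙ f h * h * cfcₙ f h = cfcₙ (fun t => f t * t * f t) h := by
      rw [cfcₙ_mul (fun t => f t * t) f h (hf.mul continuous_id').continuousOn (by simp)
        hf.continuousOn hf0, cfcₙ_mul f (fun t => t) h hf.continuousOn hf0
        continuous_id'.continuousOn rfl, cfcₙ_id' ℝ h]
    rw [this]
    refine norm_cfcₙ_le fun t _ => ?_
    by_cases ht : f t = 0
    · simp [ht]
    have h1 := hfsupp t ht
    have h2 := abs_sub_abs_le_abs_sub t t₀
    have h3 : |t| ≤ 2 * |t₀| := by linarith
    rw [Real.norm_eq_abs, abs_mul, abs_mul]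
    calc |f t| * |t| * |f t| ≤ 1 * (2 * |t₀|) * 1 := by
          gcongr <;> exact hfle t
      _ = _ := by ring
  have h3 : 1 ≤ C * ‖x * cfcₙ f h‖ := h1.trans hyn
  rw [div_le_iff₀ (by positivity)]
  nlinarith [norm_nonneg (x * cfcₙ f h)]

/-- An element `x` of a closed *-subalgebra `S` for which `x S` is closed is relatively regular: it
has a generalized inverse in `S`. -/
theorem exists_mul_mul_eq_self_of_isClosed_range (hS : IsClosed (S : Set B)) {x : B} (hxS : x ∈ S)
    (hx : IsClosed ((fun s => x * s) '' (S : Set B))) : ∃ G ∈ S, x * G * x = x := by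
  obtain ⟨ε, hε, hgap⟩ := exists_gap_of_isClosed_range hS hxS hx
  have hh : IsSelfAdjoint (star x * x) := .star_mul_self x
  -- `g` agrees with `t ↦ 1 / t` on the nonzero part of the spectrum.
  let g : ℝ → ℝ := fun t => t / max (t ^ 2) (ε ^ 2)
  have hg : Continuous g := continuous_id.div (by fun_prop)
    fun t => (lt_max_of_lt_right (by positivity)).ne'
  have hg0 : g 0 = 0 := by simp [g]
  have hgS : cfcₙ g (star x * x) ∈ S := by
    have : IsClosed (S : Set B) := hS
    exact cfcₙ_mem g (mul_mem (star_mem hxS) hxS)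
  have key : star x * x * cfcₙ g (star x * x) * (star x * x) = star x * x := by
    set h := star x * x
    have : h * cfcₙ g h * h = cfcₙ (fun t => t * g t * t) h := by
      rw [cfcₙ_mul (fun t => t * g t) (fun t => t) h (continuous_id'.mul hg).continuousOn (by simp)
        continuous_id'.continuousOn rfl, cfcₙ_mul (fun t => t) g h continuous_id'.continuousOn rfl
        hg.continuousOn hg0, cfcₙ_id' ℝ h]
    rw [this]
    conv_rhs => rw [← cfcₙ_id' ℝ h]
    refine cfcₙ_congr fun t ht => ?_
    by_cases h0 : t = 0
    · simp [h0]
    have h1 := hgap t ht h0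
    have h2 : ε ^ 2 ≤ t ^ 2 := by
      rw [← sq_abs t]; gcongr
    simp only [g]
    rw [max_eq_left h2]
    field_simp
  refine ⟨cfcₙ g (star x * x) * star x, mul_mem hgS (star_mem hxS), ?_⟩
  have hs : star (cfcₙ g (star x * x)) = cfcₙ g (star x * x) :=
    (cfcₙ_predicate g _ : IsSelfAdjoint _).star_eq
  set a := cfcₙ g (star x * x)
  have hx1 : x * (a * star x) * x = x * (a * (star x * x)) := by simp only [mul_assoc]
  have hx2 : star x * (x * (a * (star x * x))) = star x * x := by
    simpa only [mul_assoc] using key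
  rw [hx1, ← sub_eq_zero, ← CStarRing.star_mul_self_eq_zero_iff]
  rw [star_sub, sub_mul, mul_sub (star x), hx2, sub_self, sub_zero, star_mul, mul_assoc, mul_sub,
    hx2, sub_self, mul_zero]

end Regular

section MatrixRegular

variable {B : Type} [CStarAlgebra B] {S : NonUnitalStarSubalgebra ℂ B} {X Y Z : Type}

/-- The matrix has all its entries in `S`. -/
def EntriesIn (S : NonUnitalStarSubalgebra ℂ B) (G : Matrix X Y B) : Prop := ∀ i j, G i j ∈ S

theorem EntriesIn.mul [Fintype Y] {G : Matrix X Y B} {H : Matrix Y Z B} (hG : EntriesIn S G)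
    (hH : EntriesIn S H) : EntriesIn S (G * H) :=
  fun i j => sum_mem fun k _ => mul_mem (hG i k) (hH k j)

theorem EntriesIn.sub {G H : Matrix X Y B} (hG : EntriesIn S G)
    (hH : EntriesIn S H) : EntriesIn S (G - H) :=
  fun i j => sub_mem (hG i j) (hH i j)

theorem EntriesIn.conjTranspose {G : Matrix X Y B} (hG : EntriesIn S G) :
    EntriesIn S G.conjTranspose :=
  fun i j => star_mem (hG j i)

theorem EntriesIn.mulVec [Fintype Y] {G : Matrix X Y B} (hG : EntriesIn S G) {a : Y → B}
    (ha : ∀ j, a j ∈ S) (i : X) : (G.mulVec a) i ∈ S :=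
  sum_mem fun k _ => mul_mem (hG i k) (ha k)

/-- The matrices with entries in `S`, as a *-subalgebra of the C*-algebra of matrices over `B`. -/
def cstarMatrixSubalgebra (S : NonUnitalStarSubalgebra ℂ B) (Z : Type) [Fintype Z]
    [DecidableEq Z] : NonUnitalStarSubalgebra ℂ (CStarMatrix Z Z B) where
  carrier := {G | ∀ i j, G i j ∈ S}
  zero_mem' _ _ := zero_mem _
  add_mem' hG hH i j := add_mem (hG i j) (hH i j)
  mul_mem' {G H} hG hH i j := by
    rw [CStarMatrix.mul_apply]
    exact sum_mem fun k _ => mul_mem (hG i k) (hH k j)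
  smul_mem' c _ hG i j := SMulMemClass.smul_mem c (hG i j)
  star_mem' hG i j := star_mem (hG j i)

theorem continuous_cstarMatrix_entry [Fintype Z] [DecidableEq Z] (i j : Z) :
    Continuous fun G : CStarMatrix Z Z B => G i j :=
  (continuous_apply j).comp (continuous_apply i)

/-- A rectangular matrix `x` over a closed *-subalgebra `S` for which `x Sⁿ` is closed has a
generalized inverse over `S`. -/
theorem exists_matrix_mul_mul_eq_self [Fintype X] [Fintype Y] (hS : IsClosed (S : Set B))
    {x : Matrix Y X B} (hxS : EntriesIn S x)
    (hx : IsClosed (x.mulVec '' {a : X → B | ∀ i, a i ∈ S})) :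
    ∃ G : Matrix X Y B, EntriesIn S G ∧ x * G * x = x := by
  classical
  let _ : PartialOrder B := CStarAlgebra.spectralOrder B
  have : StarOrderedRing B := CStarAlgebra.spectralOrderedRing B
  let x' : CStarMatrix (X ⊕ Y) (X ⊕ Y) B := CStarMatrix.ofMatrix (Matrix.fromBlocks 0 0 x 0)
  have hl (s : CStarMatrix (X ⊕ Y) (X ⊕ Y) B) (i : X) (z : X ⊕ Y) : (x' * s) (Sum.inl i) z = 0 := by
    rw [CStarMatrix.mul_apply, Fintype.sum_sum_type]
    simp [x']
  have hr (s : CStarMatrix (X ⊕ Y) (X ⊕ Y) B) (i : Y) (z : X ⊕ Y) :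
      (x' * s) (Sum.inr i) z = x.mulVec (fun j => s (Sum.inl j) z) i := by
    rw [CStarMatrix.mul_apply, Fintype.sum_sum_type]
    simp [x', Matrix.mulVec, dotProduct]
  have hS' : IsClosed (cstarMatrixSubalgebra S (X ⊕ Y) : Set (CStarMatrix (X ⊕ Y) (X ⊕ Y) B)) := by
    have : (cstarMatrixSubalgebra S (X ⊕ Y) : Set (CStarMatrix (X ⊕ Y) (X ⊕ Y) B)) =
        ⋂ i, ⋂ j, (fun G => G i j) ⁻¹' (S : Set B) := by
      ext G
      simp only [Set.mem_iInter]
      rfl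
    rw [this]
    exact isClosed_iInter fun i => isClosed_iInter fun j =>
      hS.preimage (continuous_cstarMatrix_entry i j)
  have hx'S : x' ∈ cstarMatrixSubalgebra S (X ⊕ Y) := by
    rintro (i | i) (j | j)
    · exact zero_mem S
    · exact zero_mem S
    · exact hxS i j
    · exact zero_mem S
  obtain ⟨G, hG, hxG⟩ := exists_mul_mul_eq_self_of_isClosed_range hS' hx'S (by
    have : ((fun s => x' * s) '' (cstarMatrixSubalgebra S (X ⊕ Y) :
        Set (CStarMatrix (X ⊕ Y) (X ⊕ Y) B))) =
        ⋂ z, ((⋂ i, {t | t (Sum.inl i) z = 0}) ∩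
          (fun t : CStarMatrix (X ⊕ Y) (X ⊕ Y) B => fun j => t (Sum.inr j) z) ⁻¹'
            (x.mulVec '' {a : X → B | ∀ i, a i ∈ S})) := by
      ext t
      simp only [Set.mem_iInter, Set.mem_inter_iff, Set.mem_preimage, Set.mem_ofPred_eq]
      constructor
      · rintro ⟨s, hs, rfl⟩ z
        refine ⟨fun i => hl s i z, fun j => s (Sum.inl j) z, fun j => hs _ _, ?_⟩
        funext i
        exact (hr s i z).symm
      · intro h
        choose h0 a ha hat using h
        refine ⟨CStarMatrix.ofMatrix (Matrix.of fun i z => Sum.elim (a z) 0 i), ?_, ?_⟩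
        · rintro (i | i) z
          · exact ha z i
          · exact zero_mem S
        · ext i z
          rcases i with i | i
          · exact (hl _ i z).trans (h0 z i).symm
          · exact (hr _ i z).trans (congrFun (hat z) i)
    rw [this]
    refine isClosed_iInter fun z => IsClosed.inter (isClosed_iInter fun i => ?_) (hx.preimage ?_)
    · exact isClosed_eq (continuous_cstarMatrix_entry _ _) continuous_const
    · exact continuous_pi fun j => continuous_cstarMatrix_entry _ _)
  refine ⟨fun i j => G (Sum.inl i) (Sum.inr j), fun i j => hG _ _, ?_⟩
  ext i j
  have h := congrFun (congrFun hxG (Sum.inr i)) (Sum.inl j)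
  have e1 : (x' * G * x') (Sum.inr i) (Sum.inl j) =
      ∑ k, (x' * G) (Sum.inr i) (Sum.inr k) * x k j := by
    rw [CStarMatrix.mul_apply, Fintype.sum_sum_type]
    simp [x']
  rw [e1] at h
  simp only [hr] at h
  exact h

end MatrixRegular

/-! ### The finite model as a complex of matrices -/

section Mat

variable {Γ : Type} [Group Γ] {X Y Z : Type}

section General

variable {B : Type} [Ring B] [Algebra ℂ B] (u : Γ →* B)

theorem freeMod_map_apply [Fintype X] (φ : FreeMod Γ X →ₗ[MonoidAlgebra ℚ Γ] FreeMod Γ Y)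
    (w : FreeMod Γ X) (y : Y) : φ w y = ∑ x, w x * φ (Finsupp.single x 1) y := by
  classical
  induction w using Finsupp.induction_linear with
  | zero => simp
  | add a b ha hb => simp [ha, hb, add_mul, Finset.sum_add_distrib]
  | single x r =>
    rw [Finset.sum_eq_single x]
    · rw [Finsupp.single_eq_same, ← smul_eq_mul, ← Finsupp.smul_apply, ← map_smul,
        Finsupp.smul_single, smul_eq_mul, mul_one]
    · intro z _ hz
      rw [Finsupp.single_eq_of_ne hz, zero_mul]
    · simp

/-- The matrix over `B` of a homomorphism of free `ℚΓ`-modules, given a homomorphism from `Γ` to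
the multiplicative monoid of `B`; it acts on columns as the map induced on cochains. -/
def toMatrix (φ : FreeMod Γ X →ₗ[MonoidAlgebra ℚ Γ] FreeMod Γ Y) : Matrix X Y B :=
  fun x y => groupRingHom u (φ (Finsupp.single x 1) y)

theorem toMatrix_comp [Fintype Y] (ψ : FreeMod Γ Y →ₗ[MonoidAlgebra ℚ Γ] FreeMod Γ Z)
    (φ : FreeMod Γ X →ₗ[MonoidAlgebra ℚ Γ] FreeMod Γ Y) :
    toMatrix u (ψ ∘ₗ φ) = toMatrix u φ * toMatrix u ψ := by
  ext x z
  rw [Matrix.mul_apply]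
  change groupRingHom u (ψ (φ (Finsupp.single x 1)) z) = _
  rw [freeMod_map_apply, map_sum]
  simp only [map_mul]
  rfl

theorem toMatrix_zero : toMatrix u (0 : FreeMod Γ X →ₗ[MonoidAlgebra ℚ Γ] FreeMod Γ Y) = 0 := by
  ext x y
  exact map_zero _

end General

/-- The image `g ↦ (π(g))_π` as a homomorphism. -/
def groupEltHom (Γ : Type) [Group Γ] : Γ →* BoundedFamily Γ where
  toFun := groupElt
  map_one' := groupElt_one
  map_mul' := groupElt_mul

theorem star_groupElt (g : Γ) : star (groupElt g) = groupElt g⁻¹ := by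
  refine BoundedFamily.ext fun π => ?_
  change star (π g : BigOp Γ) = (π g⁻¹ : BigOp Γ)
  rw [map_inv, ← Unitary.star_eq_inv, Unitary.coe_star]

variable {A : NonUnitalStarSubalgebra ℂ (BoundedFamily Γ)}

theorem coe_repHom_leftMulRep (hA : CStarAug Γ ≤ A) (r : MonoidAlgebra ℚ Γ) (a : A) :
    (repHom (leftMulRep A hA) r a : BoundedFamily Γ) =
      groupRingHom (groupEltHom Γ) r * (a : BoundedFamily Γ) := by
  induction r using MonoidAlgebra.induction_linear with
  | zero => simp
  | add r s hr hs => simp [hr, hs, add_mul]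
  | single g c =>
    rw [repHom_single, groupRingHom_single]
    simp
    rfl

theorem coe_pull_leftMulRep [Fintype Y] (hA : CStarAug Γ ≤ A)
    (φ : FreeMod Γ X →ₗ[MonoidAlgebra ℚ Γ] FreeMod Γ Y) (c : Y → A) (x : X) :
    (pull (repHom (leftMulRep A hA)) φ c x : BoundedFamily Γ) =
      (toMatrix (groupEltHom Γ) φ).mulVec (fun y => (c y : BoundedFamily Γ)) x := by
  rw [pull_apply, evalCochain_eq_sum]
  simp only [AddSubmonoidClass.coe_finsetSum, coe_repHom_leftMulRep]
  rfl

theorem coe_push_leftMulRep [Fintype X] (hA : CStarAug Γ ≤ A)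
    (φ : FreeMod Γ X →ₗ[MonoidAlgebra ℚ Γ] FreeMod Γ Y) (c : X →₀ A) (y : Y) :
    (push (repHom (leftMulRep A hA)) φ c y : BoundedFamily Γ) =
      (toMatrix (groupEltHom Γ) φ).conjTranspose.mulVec (fun x => (c x : BoundedFamily Γ)) y := by
  rw [push_apply]
  simp only [AddSubmonoidClass.coe_finsetSum, coe_repHom_leftMulRep]
  refine Finset.sum_congr rfl fun x _ => ?_
  rw [← star_groupRingHom (groupEltHom Γ) star_groupElt]
  rfl

end Mat

/-! ### Relative contractions of the finite model -/

section Unit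

variable {Γ : Type} [Group Γ] {X Y Z : Type} {B : Type} [CStarAlgebra B]

/-- The subalgebra `A` is a left module over `Γ`, which acts through the unitary elements `u g`, and
`e` is a self-adjoint unit of `A`. -/
structure IsUnitOf (u : Γ →* B) (A : NonUnitalStarSubalgebra ℂ B) (e : B) : Prop where
  star_hom : ∀ g, star (u g) = u g⁻¹
  hom_mul_mem : ∀ g, ∀ a ∈ A, u g * a ∈ A
  mem : e ∈ A
  star_eq : star e = e
  mul_left : ∀ a ∈ A, e * a = a

namespace IsUnitOf

variable {u : Γ →* B} {A : NonUnitalStarSubalgebra ℂ B} {e : B}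

theorem mul_right (he : IsUnitOf u A e) (a : B) (ha : a ∈ A) : a * e = a := by
  have := congrArg star (he.mul_left _ (star_mem ha))
  rwa [star_mul, star_star, he.star_eq] at this

theorem groupRingHom_mul_mem (he : IsUnitOf u A e) (r : MonoidAlgebra ℚ Γ) {a : B} (ha : a ∈ A) :
    groupRingHom u r * a ∈ A := by
  induction r using MonoidAlgebra.induction_linear with
  | zero => simp
  | add r s hr hs => rw [map_add, add_mul]; exact add_mem hr hs
  | single g c =>
    rw [groupRingHom_single, smul_mul_assoc]
    exact SMulMemClass.smul_mem _ (he.hom_mul_mem g a ha)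

/-- The unit of `A` commutes with the group ring: `e r = e r e = r e`. -/
theorem commute (he : IsUnitOf u A e) (r : MonoidAlgebra ℚ Γ) :
    e * groupRingHom u r = groupRingHom u r * e := by
  have key (r : MonoidAlgebra ℚ Γ) : e * (groupRingHom u r * e) = groupRingHom u r * e :=
    he.mul_left _ (he.groupRingHom_mul_mem r he.mem)
  have h := congrArg star (key (groupRingInv r).unop)
  rw [star_mul, star_mul, ← star_groupRingHom _ he.star_hom, star_star, he.star_eq, mul_assoc,
    key] at h
  exact h.symm

theorem toMatrix_mul_smul [Fintype Y] (he : IsUnitOf u A e)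
    (φ : FreeMod Γ X →ₗ[MonoidAlgebra ℚ Γ] FreeMod Γ Y) (G : Matrix Y Z B) :
    toMatrix u φ * (e • G) = e • (toMatrix u φ * G) := by
  ext i j
  rw [Matrix.smul_apply, Matrix.mul_apply, Matrix.mul_apply, smul_eq_mul, Finset.mul_sum]
  refine Finset.sum_congr rfl fun k _ => ?_
  rw [Matrix.smul_apply, smul_eq_mul, ← mul_assoc, ← mul_assoc]
  exact congrArg (· * G k j) (he.commute _).symm

theorem conjTranspose_smul (he : IsUnitOf u A e)
    (φ : FreeMod Γ X →ₗ[MonoidAlgebra ℚ Γ] FreeMod Γ Y) :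
    (e • toMatrix u φ).conjTranspose = e • (toMatrix u φ).conjTranspose := by
  ext i j
  change star (e * toMatrix u φ j i) = e * star (toMatrix u φ j i)
  rw [toMatrix, he.commute, star_mul, he.star_eq]

theorem entriesIn_smul_toMatrix (he : IsUnitOf u A e)
    (φ : FreeMod Γ X →ₗ[MonoidAlgebra ℚ Γ] FreeMod Γ Y) : EntriesIn A (e • toMatrix u φ) := by
  intro i j
  rw [Matrix.smul_apply, smul_eq_mul, toMatrix, he.commute]
  exact he.groupRingHom_mul_mem _ he.mem

theorem entriesIn_toMatrix_mul [Fintype Y] (he : IsUnitOf u A e)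
    (φ : FreeMod Γ X →ₗ[MonoidAlgebra ℚ Γ] FreeMod Γ Y) {G : Matrix Y Z B} (hG : EntriesIn A G) :
    EntriesIn A (toMatrix u φ * G) :=
  fun _ j => sum_mem fun k _ => he.groupRingHom_mul_mem _ (hG k j)

theorem entriesIn_conjTranspose_mul [Fintype Y] (he : IsUnitOf u A e)
    (φ : FreeMod Γ Y →ₗ[MonoidAlgebra ℚ Γ] FreeMod Γ X) {G : Matrix Y Z B} (hG : EntriesIn A G) :
    EntriesIn A ((toMatrix u φ).conjTranspose * G) := by
  refine fun i j => sum_mem fun k _ => ?_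
  change star (groupRingHom u (φ (Finsupp.single k 1) i)) * G k j ∈ A
  rw [star_groupRingHom _ he.star_hom]
  exact he.groupRingHom_mul_mem _ (hG k j)

theorem smul_of_entriesIn (he : IsUnitOf u A e) {G : Matrix X Y B} (hG : EntriesIn A G) :
    e • G = G := by
  ext i j
  exact he.mul_left _ (hG i j)

theorem mul_smul_of_entriesIn [Fintype Y] (he : IsUnitOf u A e) {G : Matrix X Y B}
    (hG : EntriesIn A G) (H : Matrix Y Z B) : G * (e • H) = G * H := by
  ext i j
  rw [Matrix.mul_apply, Matrix.mul_apply]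
  refine Finset.sum_congr rfl fun k _ => ?_
  rw [Matrix.smul_apply, smul_eq_mul, ← mul_assoc, he.mul_right _ (hG i k)]

theorem conjTranspose_mul_smul [Fintype Y] (he : IsUnitOf u A e)
    (φ : FreeMod Γ Y →ₗ[MonoidAlgebra ℚ Γ] FreeMod Γ X) (G : Matrix Y Z B) :
    (toMatrix u φ).conjTranspose * (e • G) = e • ((toMatrix u φ).conjTranspose * G) := by
  ext i j
  rw [Matrix.smul_apply, Matrix.mul_apply, Matrix.mul_apply, smul_eq_mul, Finset.mul_sum]
  refine Finset.sum_congr rfl fun k _ => ?_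
  rw [Matrix.smul_apply, smul_eq_mul, ← mul_assoc, ← mul_assoc]
  refine congrArg (· * G k j) ?_
  change star (groupRingHom u (φ (Finsupp.single k 1) i)) * e =
    e * star (groupRingHom u (φ (Finsupp.single k 1) i))
  rw [star_groupRingHom _ he.star_hom, he.commute]

theorem toMatrix_mulVec_mem [Fintype X] (he : IsUnitOf u A e)
    (φ : FreeMod Γ Y →ₗ[MonoidAlgebra ℚ Γ] FreeMod Γ X) {a : X → B} (ha : ∀ i, a i ∈ A) (i : Y) :
    (toMatrix u φ).mulVec a i ∈ A :=
  sum_mem fun k _ => he.groupRingHom_mul_mem _ (ha k)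

theorem conjTranspose_mulVec_mem [Fintype X] (he : IsUnitOf u A e)
    (φ : FreeMod Γ X →ₗ[MonoidAlgebra ℚ Γ] FreeMod Γ Y) {a : X → B} (ha : ∀ i, a i ∈ A) (i : Y) :
    (toMatrix u φ).conjTranspose.mulVec a i ∈ A := by
  refine sum_mem fun k _ => ?_
  change star (groupRingHom u (φ (Finsupp.single k 1) i)) * a k ∈ A
  rw [star_groupRingHom _ he.star_hom]
  exact he.groupRingHom_mul_mem _ (ha k)

end IsUnitOf

end Unit

namespace FiniteModel

section Contraction

variable {Γ : Type} [Group Γ] {m : ℕ} (M : FiniteModel Γ m) {B : Type} [CStarAlgebra B]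
  (u : Γ →* B) (A : NonUnitalStarSubalgebra ℂ B) (e : B) (k : ℕ)

/-- The differential `d k` is relatively regular over the algebra `A` with unit `e`. -/
def RelRegular [Fintype (M.X k)] [Fintype (M.X (k + 1))] : Prop :=
  ∃ Y : Matrix (M.X k) (M.X (k + 1)) B, EntriesIn A Y ∧
    toMatrix u (M.d k) * Y * toMatrix u (M.d k) = e • toMatrix u (M.d k)

/-- The cochain complex of the finite model is contractible over `A` in degree `k + 1`. As `q` is
the projection to the summand of the free module that models the resolution, the contraction is one
of `e q` and not of `e`. -/
def RelContractible [Fintype (M.X k)] [Fintype (M.X (k + 1))] [Fintype (M.X (k + 2))] : Prop :=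
  ∃ (G : Matrix (M.X (k + 1)) (M.X (k + 2)) B) (Y : Matrix (M.X k) (M.X (k + 1)) B),
    EntriesIn A G ∧ EntriesIn A Y ∧
    e • toMatrix u (M.q (k + 1)) = G * toMatrix u (M.d (k + 1)) + toMatrix u (M.d k) * Y

/-- Exactness in degree `k + 1` of the complex of `A`-valued cochains on the finite model. -/
def MatCochainExact [Fintype (M.X k)] [Fintype (M.X (k + 1))] : Prop :=
  ∀ c : M.X (k + 1) → B, (∀ i, c i ∈ A) → (toMatrix u (M.q (k + 1))).mulVec c = c →
    (toMatrix u (M.d (k + 1))).mulVec c = 0 →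
    ∃ b : M.X k → B, (∀ i, b i ∈ A) ∧ (toMatrix u (M.d k)).mulVec b = c

/-- Exactness in degree `k + 1` of the complex of `A`-valued chains on the finite model. -/
def MatChainExact [Fintype (M.X (k + 1))] [Fintype (M.X (k + 2))] : Prop :=
  ∀ c : M.X (k + 1) → B, (∀ i, c i ∈ A) → (toMatrix u (M.q (k + 1))).conjTranspose.mulVec c = c →
    (toMatrix u (M.d k)).conjTranspose.mulVec c = 0 →
    ∃ b : M.X (k + 2) → B, (∀ i, b i ∈ A) ∧
      (toMatrix u (M.d (k + 1))).conjTranspose.mulVec b = c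

section Identities

theorem toMatrix_d_mul_d [Fintype (M.X (k + 1))] :
    toMatrix u (M.d (k + 1)) * toMatrix u (M.d k) = 0 := by
  rw [← toMatrix_comp, M.d_d, toMatrix_zero]

theorem toMatrix_q_mul_d [Fintype (M.X (k + 1))] :
    toMatrix u (M.q (k + 1)) * toMatrix u (M.d k) = toMatrix u (M.d k) := by
  rw [← toMatrix_comp, M.d_q]

theorem toMatrix_d_mul_q [Fintype (M.X k)] :
    toMatrix u (M.d k) * toMatrix u (M.q k) = toMatrix u (M.d k) := by
  rw [← toMatrix_comp, M.q_d]

theorem toMatrix_q_mul_q [Fintype (M.X k)] :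
    toMatrix u (M.q k) * toMatrix u (M.q k) = toMatrix u (M.q k) := by
  rw [← toMatrix_comp, M.q_q]

end Identities

variable {M u A e k}

theorem RelContractible.relRegular [Fintype (M.X k)] [Fintype (M.X (k + 1))] [Fintype (M.X (k + 2))]
    (h : M.RelContractible u A e k) : M.RelRegular u A e k := by
  obtain ⟨G, Y, -, hY, h⟩ := h
  refine ⟨Y, hY, ?_⟩
  have := congrArg (· * toMatrix u (M.d k)) h
  simpa only [Matrix.smul_mul, toMatrix_q_mul_d, Matrix.add_mul, Matrix.mul_assoc,
    toMatrix_d_mul_d, Matrix.mul_zero, zero_add] using this.symm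

theorem RelContractible.relRegular_succ [Fintype (M.X k)] [Fintype (M.X (k + 1))]
    [Fintype (M.X (k + 2))] (he : IsUnitOf u A e)
    (h : M.RelContractible u A e k) : M.RelRegular u A e (k + 1) := by
  obtain ⟨G, Y, hG, -, h⟩ := h
  refine ⟨G, hG, ?_⟩
  have := congrArg (toMatrix u (M.d (k + 1)) * ·) h
  simp only [he.toMatrix_mul_smul, toMatrix_d_mul_q, Matrix.mul_add] at this
  rw [← Matrix.mul_assoc _ _ Y, toMatrix_d_mul_d, Matrix.zero_mul, add_zero,
    ← Matrix.mul_assoc] at this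
  exact this.symm

/-- A column-wise solution of `D Y = P`. -/
theorem exists_matrix_mul_eq {X Y Z : Type} [Fintype Y] {D : Matrix X Y B} {P : Matrix X Z B}
    (h : ∀ z, ∃ b : Y → B, (∀ i, b i ∈ A) ∧ D.mulVec b = fun x => P x z) :
    ∃ Q : Matrix Y Z B, EntriesIn A Q ∧ D * Q = P := by
  choose b hb hD using h
  exact ⟨fun y z => b z y, fun y z => hb z y, by ext x z; exact congrFun (hD z) x⟩

/-- A generalized inverse of `D (k + 1)` splits off the cocycles in degree `k + 1`. Exactness makes
the columns of the projection to the cocycles coboundaries, which gives the other half of the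
contraction. -/
theorem RelRegular.relContractible_of_cochain [Fintype (M.X k)] [Fintype (M.X (k + 1))]
    [Fintype (M.X (k + 2))] (he : IsUnitOf u A e)
    (h : M.RelRegular u A e (k + 1)) (hex : M.MatCochainExact u A k) :
    M.RelContractible u A e k := by
  obtain ⟨G, hG, h⟩ := h
  have hqG := he.entriesIn_toMatrix_mul (M.q (k + 1)) hG
  -- the projection to the cocycles along the range of `q G`
  let P := e • toMatrix u (M.q (k + 1)) - toMatrix u (M.q (k + 1)) * G * toMatrix u (M.d (k + 1))
  have hP : EntriesIn A P := by
    refine (he.entriesIn_smul_toMatrix _).sub ?_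
    rw [← he.mul_smul_of_entriesIn hqG]
    exact hqG.mul (he.entriesIn_smul_toMatrix _)
  have hqP : toMatrix u (M.q (k + 1)) * P = P := by
    rw [Matrix.mul_sub, he.toMatrix_mul_smul, toMatrix_q_mul_q, ← Matrix.mul_assoc,
      ← Matrix.mul_assoc, toMatrix_q_mul_q]
  have hdP : toMatrix u (M.d (k + 1)) * P = 0 := by
    rw [Matrix.mul_sub, he.toMatrix_mul_smul, toMatrix_d_mul_q, ← Matrix.mul_assoc,
      ← Matrix.mul_assoc, toMatrix_d_mul_q, h, sub_self]
  obtain ⟨Y, hY, hDY⟩ := exists_matrix_mul_eq (A := A) (D := toMatrix u (M.d k)) (P := P)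
    fun z => hex _ (fun i => hP i z) (funext fun i => congrFun (congrFun hqP i) z)
      (funext fun i => congrFun (congrFun hdP i) z)
  exact ⟨_, Y, hqG, hY, by rw [hDY, add_sub_cancel]⟩

theorem RelRegular.conjTranspose [Fintype (M.X k)] [Fintype (M.X (k + 1))]
    (he : IsUnitOf u A e) (h : M.RelRegular u A e k) :
    ∃ Y : Matrix (M.X (k + 1)) (M.X k) B, EntriesIn A Y ∧
      (toMatrix u (M.d k)).conjTranspose * Y * (toMatrix u (M.d k)).conjTranspose =
        e • (toMatrix u (M.d k)).conjTranspose := by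
  obtain ⟨Y, hY, h⟩ := h
  refine ⟨Y.conjTranspose, hY.conjTranspose, ?_⟩
  rw [← he.conjTranspose_smul, ← h, Matrix.conjTranspose_mul, Matrix.conjTranspose_mul,
    Matrix.mul_assoc]

/-- The counterpart for chains: a generalized inverse of the adjoint of `D k` splits off the cycles
in degree `k + 1`, and the adjoint of a contraction of chains is one of cochains. -/
theorem RelRegular.relContractible_of_chain [Fintype (M.X k)] [Fintype (M.X (k + 1))]
    [Fintype (M.X (k + 2))] (he : IsUnitOf u A e)
    (h : M.RelRegular u A e k) (hex : M.MatChainExact u A k) :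
    M.RelContractible u A e k := by
  obtain ⟨G, hG, h⟩ := h.conjTranspose he
  have hqG := he.entriesIn_conjTranspose_mul (M.q (k + 1)) hG
  have hqq : (toMatrix u (M.q (k + 1))).conjTranspose * (toMatrix u (M.q (k + 1))).conjTranspose =
      (toMatrix u (M.q (k + 1))).conjTranspose := by
    rw [← Matrix.conjTranspose_mul, toMatrix_q_mul_q]
  have hdq : (toMatrix u (M.d k)).conjTranspose * (toMatrix u (M.q (k + 1))).conjTranspose =
      (toMatrix u (M.d k)).conjTranspose := by
    rw [← Matrix.conjTranspose_mul, toMatrix_q_mul_d]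
  let P := e • (toMatrix u (M.q (k + 1))).conjTranspose -
    (toMatrix u (M.q (k + 1))).conjTranspose * G * (toMatrix u (M.d k)).conjTranspose
  have hP : EntriesIn A P := by
    refine EntriesIn.sub ?_ ?_
    · rw [← he.conjTranspose_smul]
      exact (he.entriesIn_smul_toMatrix _).conjTranspose
    · rw [← he.mul_smul_of_entriesIn hqG, ← he.conjTranspose_smul]
      exact hqG.mul (he.entriesIn_smul_toMatrix _).conjTranspose
  have hqP : (toMatrix u (M.q (k + 1))).conjTranspose * P = P := by
    rw [Matrix.mul_sub, he.conjTranspose_mul_smul, hqq, ← Matrix.mul_assoc,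
      ← Matrix.mul_assoc, hqq]
  have hdP : (toMatrix u (M.d k)).conjTranspose * P = 0 := by
    rw [Matrix.mul_sub, he.conjTranspose_mul_smul, hdq, ← Matrix.mul_assoc,
      ← Matrix.mul_assoc, hdq, h, sub_self]
  obtain ⟨Y, hY, hDY⟩ := exists_matrix_mul_eq (A := A)
    (D := (toMatrix u (M.d (k + 1))).conjTranspose) (P := P)
    fun z => hex _ (fun i => hP i z) (funext fun i => congrFun (congrFun hqP i) z)
      (funext fun i => congrFun (congrFun hdP i) z)
  refine ⟨Y.conjTranspose, G.conjTranspose * toMatrix u (M.q (k + 1)), hY.conjTranspose, ?_, ?_⟩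
  · simpa [Matrix.conjTranspose_mul] using hqG.conjTranspose
  · have h1 : P + (toMatrix u (M.q (k + 1))).conjTranspose * G *
        (toMatrix u (M.d k)).conjTranspose =
        e • (toMatrix u (M.q (k + 1))).conjTranspose := sub_add_cancel _ _
    rw [← he.conjTranspose_smul] at h1
    have h2 := congrArg Matrix.conjTranspose h1
    rw [Matrix.conjTranspose_conjTranspose, ← hDY] at h2
    rw [← h2]
    simp only [Matrix.conjTranspose_add, Matrix.conjTranspose_mul,
      Matrix.conjTranspose_conjTranspose, Matrix.mul_assoc]

section Extend

variable {C : NonUnitalStarSubalgebra ℂ B}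

theorem RelContractible.matCochainExact [Fintype (M.X k)] [Fintype (M.X (k + 1))]
    [Fintype (M.X (k + 2))] (he : IsUnitOf u A e) (hCA : C ≤ A) (h : M.RelContractible u C e k) :
    M.MatCochainExact u A k := by
  obtain ⟨G, Y, -, hY, h⟩ := h
  intro c hc hq hd
  refine ⟨Y.mulVec c, EntriesIn.mulVec (fun i j => hCA (hY i j)) hc, ?_⟩
  have h1 := congrArg (Matrix.mulVec · c) h
  simp only [Matrix.smul_mulVec, hq, Matrix.add_mulVec, ← Matrix.mulVec_mulVec, hd,
    Matrix.mulVec_zero, zero_add] at h1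
  rw [← h1]
  exact funext fun i => he.mul_left _ (hc i)

theorem RelContractible.matChainExact [Fintype (M.X k)] [Fintype (M.X (k + 1))]
    [Fintype (M.X (k + 2))] (he : IsUnitOf u A e) (hCA : C ≤ A) (h : M.RelContractible u C e k) :
    M.MatChainExact u A k := by
  obtain ⟨G, Y, hG, -, h⟩ := h
  intro c hc hq hd
  refine ⟨G.conjTranspose.mulVec c,
    EntriesIn.mulVec (fun i j => hCA (hG.conjTranspose i j)) hc, ?_⟩
  have h1 := congrArg (fun N => Matrix.mulVec (Matrix.conjTranspose N) c) h
  simp only [he.conjTranspose_smul, Matrix.conjTranspose_add, Matrix.conjTranspose_mul,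
    Matrix.smul_mulVec, hq, Matrix.add_mulVec, ← Matrix.mulVec_mulVec, hd,
    Matrix.mulVec_zero, add_zero] at h1
  rw [← h1]
  exact funext fun i => he.mul_left _ (hc i)

/-- A relatively regular matrix has closed range, as the set of fixed points of `D G`. -/
theorem isClosed_range_of_mul_mul {X Y : Type} [Fintype X] [Fintype Y] (hA : IsClosed (A : Set B))
    (he : IsUnitOf u A e)
    {D : Matrix Y X B} {G : Matrix X Y B} (hD : ∀ a : X → B, (∀ i, a i ∈ A) → ∀ i, D.mulVec a i ∈ A)
    (hG : EntriesIn A G) (h : D * G * D = e • D) :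
    IsClosed (D.mulVec '' {a : X → B | ∀ i, a i ∈ A}) := by
  have : D.mulVec '' {a : X → B | ∀ i, a i ∈ A} =
      {b | ∀ i, b i ∈ A} ∩ {b | D.mulVec (G.mulVec b) = b} := by
    ext b
    constructor
    · rintro ⟨a, ha, rfl⟩
      refine ⟨hD a ha, ?_⟩
      rw [Set.mem_ofPred_eq, Matrix.mulVec_mulVec, Matrix.mulVec_mulVec, h,
        Matrix.smul_mulVec]
      exact funext fun i => he.mul_left _ (hD a ha i)
    · rintro ⟨hb, h⟩
      exact ⟨G.mulVec b, hG.mulVec hb, h⟩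
  rw [this]
  refine IsClosed.inter ?_ (isClosed_eq ?_ continuous_id)
  · simp only [Set.ofPred_forall]
    exact isClosed_iInter fun i => hA.preimage (continuous_apply i)
  · exact Continuous.matrix_mulVec continuous_const
      (Continuous.matrix_mulVec continuous_const continuous_id)

variable [Fintype (M.X k)] [Fintype (M.X (k + 1))]

theorem RelRegular.isClosed_range (hA : IsClosed (A : Set B)) (he : IsUnitOf u A e) (hCA : C ≤ A)
    (h : M.RelRegular u C e k) :
    IsClosed ((toMatrix u (M.d k)).mulVec '' {a | ∀ i, a i ∈ A}) := by
  obtain ⟨Y, hY, h⟩ := h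
  exact isClosed_range_of_mul_mul hA he (fun a => he.toMatrix_mulVec_mem _)
    (fun i j => hCA (hY i j)) h

theorem RelRegular.isClosed_range_conjTranspose (hA : IsClosed (A : Set B)) (he : IsUnitOf u A e)
    (hC : IsUnitOf u C e) (hCA : C ≤ A) (h : M.RelRegular u C e k) :
    IsClosed ((toMatrix u (M.d k)).conjTranspose.mulVec '' {a | ∀ i, a i ∈ A}) := by
  obtain ⟨Y, hY, h⟩ := h.conjTranspose hC
  exact isClosed_range_of_mul_mul hA he (fun a => he.conjTranspose_mulVec_mem _)
    (fun i j => hCA (hY i j)) h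

theorem image_smul_mulVec {X Y : Type} [Fintype X] (he : IsUnitOf u A e) {D : Matrix Y X B}
    (hD : ∀ a : X → B, (∀ i, a i ∈ A) → ∀ i, D.mulVec a i ∈ A) :
    (e • D).mulVec '' {a : X → B | ∀ i, a i ∈ A} = D.mulVec '' {a : X → B | ∀ i, a i ∈ A} := by
  refine Set.image_congr fun a ha => ?_
  rw [Matrix.smul_mulVec]
  exact funext fun i => he.mul_left _ (hD a ha i)

theorem relRegular_of_isClosed (hA : IsClosed (A : Set B)) (he : IsUnitOf u A e)
    (h : IsClosed ((toMatrix u (M.d k)).mulVec '' {a | ∀ i, a i ∈ A})) :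
    M.RelRegular u A e k := by
  rw [← image_smul_mulVec he (fun a => he.toMatrix_mulVec_mem _)] at h
  obtain ⟨G, hG, h⟩ := exists_matrix_mul_mul_eq_self hA (he.entriesIn_smul_toMatrix _) h
  refine ⟨G, hG, ?_⟩
  rw [he.mul_smul_of_entriesIn (EntriesIn.mul (he.entriesIn_smul_toMatrix _) hG), Matrix.smul_mul,
    ← he.toMatrix_mul_smul, he.smul_of_entriesIn hG] at h
  exact h

theorem relRegular_of_isClosed_conjTranspose (hA : IsClosed (A : Set B)) (he : IsUnitOf u A e)
    (h : IsClosed ((toMatrix u (M.d k)).conjTranspose.mulVec '' {a | ∀ i, a i ∈ A})) :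
    M.RelRegular u A e k := by
  rw [← image_smul_mulVec he (fun a => he.conjTranspose_mulVec_mem _),
    ← he.conjTranspose_smul] at h
  obtain ⟨G, hG, h⟩ := exists_matrix_mul_mul_eq_self hA
    (he.entriesIn_smul_toMatrix _).conjTranspose h
  refine ⟨G.conjTranspose, hG.conjTranspose, ?_⟩
  have h := congrArg Matrix.conjTranspose h
  rw [Matrix.conjTranspose_mul, Matrix.conjTranspose_mul, Matrix.conjTranspose_conjTranspose,
    ← Matrix.mul_assoc, he.mul_smul_of_entriesIn (EntriesIn.mul (he.entriesIn_smul_toMatrix _)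
    hG.conjTranspose), Matrix.smul_mul,
    ← he.toMatrix_mul_smul, he.smul_of_entriesIn hG.conjTranspose] at h
  exact h

end Extend

end Contraction

end FiniteModel

/-! ### The cohomological and homological criteria in terms of contractions -/

namespace FiniteModel

variable {Γ : Type} [Group Γ] {m : ℕ} (M : FiniteModel Γ m)

/-- The cochain complex of the finite model is contractible over `A` in the degrees `1, …, n`. -/
def ContractibleUpTo {B : Type} [CStarAlgebra B] (u : Γ →* B) (A : NonUnitalStarSubalgebra ℂ B)
    (e : B) (n : ℕ) : Prop :=
  ∀ k < n, ∀ [Fintype (M.X k)] [Fintype (M.X (k + 1))] [Fintype (M.X (k + 2))],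
    M.RelContractible u A e k

section LeftMul

variable {A : NonUnitalStarSubalgebra ℂ (BoundedFamily Γ)} (hA : CStarAug Γ ≤ A) (k : ℕ)

theorem cochainExact_leftMulRep_iff [Fintype (M.X k)] [Fintype (M.X (k + 1))] :
    M.CochainExact (repHom (leftMulRep A hA)) k ↔ M.MatCochainExact (groupEltHom Γ) A k := by
  constructor
  · intro h c hc hq hd
    obtain ⟨b, hb⟩ := h (fun i => ⟨c i, hc i⟩)
      (funext fun i => Subtype.ext ((coe_pull_leftMulRep hA _ _ i).trans (congrFun hq i)))
      (funext fun i => Subtype.ext ((coe_pull_leftMulRep hA _ _ i).trans (congrFun hd i)))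
    exact ⟨fun i => b i, fun i => (b i).2, funext fun i =>
      (coe_pull_leftMulRep hA _ _ i).symm.trans (congrArg Subtype.val (congrFun hb i))⟩
  · intro h c hq hd
    obtain ⟨b, hb, hbc⟩ := h (fun i => c i) (fun i => (c i).2)
      (funext fun i =>
        (coe_pull_leftMulRep hA _ _ i).symm.trans (congrArg Subtype.val (congrFun hq i)))
      (funext fun i =>
        (coe_pull_leftMulRep hA _ _ i).symm.trans (congrArg Subtype.val (congrFun hd i)))
    exact ⟨fun i => ⟨b i, hb i⟩, funext fun i => Subtype.ext
      ((coe_pull_leftMulRep hA _ _ i).trans (congrFun hbc i))⟩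

theorem chainExact_leftMulRep_iff [Fintype (M.X (k + 1))] [Fintype (M.X (k + 2))] :
    M.ChainExact (repHom (leftMulRep A hA)) k ↔ M.MatChainExact (groupEltHom Γ) A k := by
  constructor
  · intro h c hc hq hd
    obtain ⟨b, hb⟩ := h (Finsupp.equivFunOnFinite.symm fun i => ⟨c i, hc i⟩)
      (Finsupp.ext fun i => Subtype.ext ((coe_push_leftMulRep hA _ _ i).trans (congrFun hq i)))
      (Finsupp.ext fun i => Subtype.ext ((coe_push_leftMulRep hA _ _ i).trans (congrFun hd i)))
    exact ⟨fun i => b i, fun i => (b i).2, funext fun i =>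
      (coe_push_leftMulRep hA _ _ i).symm.trans (congrArg Subtype.val (DFunLike.congr_fun hb i))⟩
  · intro h c hq hd
    obtain ⟨b, hb, hbc⟩ := h (fun i => c i) (fun i => (c i).2)
      (funext fun i =>
        (coe_push_leftMulRep hA _ _ i).symm.trans (congrArg Subtype.val (DFunLike.congr_fun hq i)))
      (funext fun i =>
        (coe_push_leftMulRep hA _ _ i).symm.trans (congrArg Subtype.val (DFunLike.congr_fun hd i)))
    exact ⟨Finsupp.equivFunOnFinite.symm fun i => ⟨b i, hb i⟩, Finsupp.ext fun i => Subtype.ext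
      ((coe_push_leftMulRep hA _ _ i).trans (congrFun hbc i))⟩

theorem isClosedEmbedding_coe_pi {B X : Type} [TopologicalSpace B] {S : Set B} (hS : IsClosed S) :
    Topology.IsClosedEmbedding fun (c : X → S) (i : X) => (c i : B) := by
  refine ⟨⟨Topology.IsInducing.piMap fun _ => Topology.IsInducing.subtypeVal,
    fun c c' h => funext fun i => Subtype.ext (congrFun h i)⟩, ?_⟩
  have : Set.range (fun (c : X → S) (i : X) => (c i : B)) = Set.univ.pi fun _ => S := by
    ext c
    constructor
    · rintro ⟨c, rfl⟩ i _
      exact (c i).2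
    · intro h
      exact ⟨fun i => ⟨c i, h i trivial⟩, rfl⟩
  rw [this]
  exact isClosed_set_pi fun _ _ => hS

theorem isClosed_range_pull_leftMulRep_iff [Fintype (M.X k)]
    (hcl : IsClosed (A : Set (BoundedFamily Γ))) :
    IsClosed (Set.range (pull (repHom (leftMulRep A hA)) (M.d k))) ↔
      IsClosed ((toMatrix (groupEltHom Γ) (M.d k)).mulVec '' {a | ∀ i, a i ∈ A}) := by
  rw [(isClosedEmbedding_coe_pi (X := M.X (k + 1)) hcl).isClosed_iff_image_isClosed,
    ← Set.range_comp]
  refine iff_of_eq (congrArg IsClosed ?_)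
  ext c
  constructor
  · rintro ⟨b, rfl⟩
    exact ⟨fun i => b i, fun i => (b i).2, funext fun i => (coe_pull_leftMulRep hA _ _ i).symm⟩
  · rintro ⟨b, hb, rfl⟩
    exact ⟨fun i => ⟨b i, hb i⟩, funext fun i => coe_pull_leftMulRep hA _ _ i⟩

theorem isClosed_range_push_leftMulRep_iff [Fintype (M.X k)] [Fintype (M.X (k + 1))]
    (hcl : IsClosed (A : Set (BoundedFamily Γ))) :
    IsClosed {c : M.X k → A | Finsupp.equivFunOnFinite.symm c ∈
      Set.range (push (repHom (leftMulRep A hA)) (M.d k))} ↔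
      IsClosed ((toMatrix (groupEltHom Γ) (M.d k)).conjTranspose.mulVec '' {a | ∀ i, a i ∈ A}) := by
  rw [(isClosedEmbedding_coe_pi (X := M.X k) hcl).isClosed_iff_image_isClosed]
  refine iff_of_eq (congrArg IsClosed ?_)
  ext c
  constructor
  · rintro ⟨b, ⟨a, ha⟩, rfl⟩
    refine ⟨fun i => a i, fun i => (a i).2,
      funext fun i => (coe_push_leftMulRep hA _ _ i).symm.trans ?_⟩
    rw [ha]
    rfl
  · rintro ⟨b, hb, rfl⟩
    refine ⟨fun i => ⟨_, ?_⟩, ⟨Finsupp.equivFunOnFinite.symm fun i => ⟨b i, hb i⟩, ?_⟩, rfl⟩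
    · have := (push (repHom (leftMulRep A hA)) (M.d k)
        (Finsupp.equivFunOnFinite.symm fun i => ⟨b i, hb i⟩) i).2
      rw [coe_push_leftMulRep] at this
      exact this
    · exact Finsupp.ext fun i => Subtype.ext (coe_push_leftMulRep hA _ _ i)

theorem continuous_leftMulRep (g : Γ) : Continuous (leftMulRep A hA g) :=
  Continuous.subtype_mk (continuous_const.mul continuous_subtype_val) _

variable {hA} {C : NonUnitalStarSubalgebra ℂ (BoundedFamily Γ)} {e : BoundedFamily Γ} {n : ℕ}

/-- A closed range of the last differential makes it relatively regular, and by exactness this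
passes down from `D (k + 1)` to a contraction in degree `k + 1` and to `D k`. -/
theorem contractibleUpTo_of_cohomologyCriterion (hm : n + 1 ≤ m)
    (hcl : IsClosed (A : Set (BoundedFamily Γ))) (he : IsUnitOf (groupEltHom Γ) A e)
    (h : CohomologyCriterion (leftMulRep A hA) n) :
    M.ContractibleUpTo (groupEltHom Γ) A e n := by
  obtain ⟨h1, h2⟩ := h
  have hfin (k : ℕ) (hk : k ≤ n + 1) : Fintype (M.X k) :=
    have := M.finite k (hk.trans hm)
    Fintype.ofFinite _
  -- descending induction on `k`
  have hreg (j : ℕ) : ∀ k, k + j = n → ∀ [Fintype (M.X k)] [Fintype (M.X (k + 1))],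
      M.RelRegular (groupEltHom Γ) A e k := by
    induction j with
    | zero =>
      rintro k rfl _ _
      rw [add_zero, M.cohomologyHausdorff_iff (continuous_leftMulRep hA),
        M.isClosed_range_pull_leftMulRep_iff hA k hcl] at h2
      exact relRegular_of_isClosed hcl he h2
    | succ j ih =>
      intro k hk _ _
      let _ := hfin (k + 2) (by omega)
      have := h1 (k + 1) (by omega) (by omega)
      rw [M.subsingleton_groupCohomology_iff, cochainExact_leftMulRep_iff] at this
      exact ((ih (k + 1) (by omega)).relContractible_of_cochain he this).relRegular
  intro k hk _ _ _
  have := h1 (k + 1) (by omega) (by omega)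
  rw [M.subsingleton_groupCohomology_iff, cochainExact_leftMulRep_iff] at this
  exact (hreg (n - (k + 1)) (k + 1) (by omega)).relContractible_of_cochain he this

/-- A closed range of the adjoint of the first differential makes it relatively regular, and by
exactness this passes up from `D k` to a contraction in degree `k + 1` and to `D (k + 1)`. -/
theorem contractibleUpTo_of_homologyCriterion (hm : n + 1 ≤ m)
    (hcl : IsClosed (A : Set (BoundedFamily Γ))) (he : IsUnitOf (groupEltHom Γ) A e)
    (h : HomologyCriterion (leftMulRep A hA) n) :
    M.ContractibleUpTo (groupEltHom Γ) A e n := by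
  obtain ⟨h1, h2⟩ := h
  have hfin (k : ℕ) (hk : k ≤ n + 1) : Fintype (M.X k) :=
    have := M.finite k (hk.trans hm)
    Fintype.ofFinite _
  have hreg (k : ℕ) : k ≤ n → ∀ [Fintype (M.X k)] [Fintype (M.X (k + 1))],
      M.RelRegular (groupEltHom Γ) A e k := by
    induction k with
    | zero =>
      intro _ _ _
      rw [M.homologyZeroHausdorff_iff (continuous_leftMulRep hA)] at h2
      exact relRegular_of_isClosed_conjTranspose hcl he
        ((M.isClosed_range_push_leftMulRep_iff hA 0 hcl).1 h2)
    | succ k ih =>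
      intro hk _ _
      let _ := hfin k (by omega)
      have := h1 (k + 1) (by omega) (by omega)
      rw [M.subsingleton_groupHomology_iff, chainExact_leftMulRep_iff] at this
      exact ((ih (by omega)).relContractible_of_chain he this).relRegular_succ he
  intro k hk _ _ _
  have := h1 (k + 1) (by omega) (by omega)
  rw [M.subsingleton_groupHomology_iff, chainExact_leftMulRep_iff] at this
  exact (hreg k hk.le).relContractible_of_chain he this

theorem ContractibleUpTo.cohomologyCriterion (hm : n + 1 ≤ m) (hn : 0 < n)
    (hcl : IsClosed (A : Set (BoundedFamily Γ))) (he : IsUnitOf (groupEltHom Γ) A e)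
    (hC : IsUnitOf (groupEltHom Γ) C e) (hCA : C ≤ A)
    (h : M.ContractibleUpTo (groupEltHom Γ) C e n) :
    CohomologyCriterion (leftMulRep A hA) n := by
  have hfin (k : ℕ) (hk : k ≤ n + 1) : Fintype (M.X k) :=
    have := M.finite k (hk.trans hm)
    Fintype.ofFinite _
  obtain ⟨n, rfl⟩ := Nat.exists_eq_succ_of_ne_zero hn.ne'
  refine ⟨fun k hk1 hkn => ?_, ?_⟩
  · obtain ⟨k, rfl⟩ := Nat.exists_eq_succ_of_ne_zero (Nat.one_le_iff_ne_zero.1 hk1)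
    let _ := hfin k (by omega)
    let _ := hfin (k + 1) (by omega)
    let _ := hfin (k + 2) (by omega)
    rw [M.subsingleton_groupCohomology_iff, cochainExact_leftMulRep_iff]
    exact (h k (by omega)).matCochainExact he hCA
  · let _ := hfin n (by omega)
    let _ := hfin (n + 1) (by omega)
    let _ := hfin (n + 2) (by omega)
    rw [M.cohomologyHausdorff_iff (continuous_leftMulRep hA),
      M.isClosed_range_pull_leftMulRep_iff hA _ hcl]
    exact ((h n (by omega)).relRegular_succ hC).isClosed_range hcl he hCA

theorem ContractibleUpTo.homologyCriterion (hm : n + 1 ≤ m) (hn : 0 < n)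
    (hcl : IsClosed (A : Set (BoundedFamily Γ))) (he : IsUnitOf (groupEltHom Γ) A e)
    (hC : IsUnitOf (groupEltHom Γ) C e) (hCA : C ≤ A)
    (h : M.ContractibleUpTo (groupEltHom Γ) C e n) :
    HomologyCriterion (leftMulRep A hA) n := by
  have hfin (k : ℕ) (hk : k ≤ n + 1) : Fintype (M.X k) :=
    have := M.finite k (hk.trans hm)
    Fintype.ofFinite _
  refine ⟨fun k hk1 hkn => ?_, ?_⟩
  · obtain ⟨k, rfl⟩ := Nat.exists_eq_succ_of_ne_zero (Nat.one_le_iff_ne_zero.1 hk1)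
    let _ := hfin k (by omega)
    let _ := hfin (k + 1) (by omega)
    let _ := hfin (k + 2) (by omega)
    rw [M.subsingleton_groupHomology_iff, chainExact_leftMulRep_iff]
    exact (h k (by omega)).matChainExact he hCA
  · let _ := hfin 0 (by omega)
    let _ := hfin 1 (by omega)
    let _ := hfin 2 (by omega)
    rw [M.homologyZeroHausdorff_iff (continuous_leftMulRep hA)]
    exact (M.isClosed_range_push_leftMulRep_iff hA 0 hcl).2
      ((h 0 hn).relRegular.isClosed_range_conjTranspose hcl he hC hCA)

end LeftMul

end FiniteModel

/-! ### Unitary representations and matrices -/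

section ActVec

variable {Γ : Type} [Group Γ] {X Y Z : Type} {B : Type} [CStarAlgebra B]
  {H : Type} [NormedAddCommGroup H] [InnerProductSpace ℂ H] [CompleteSpace H]

/-- The action of matrices over `B` on columns of vectors of a Hilbert space on which `B` acts. -/
def actVec [Fintype Y] (θ : B →⋆ₐ[ℂ] (H →L[ℂ] H)) (N : Matrix X Y B) (c : Y → H) : X → H :=
  fun x => ∑ y, θ (N x y) (c y)

section

variable (θ : B →⋆ₐ[ℂ] (H →L[ℂ] H))

theorem actVec_mul [Fintype Y] [Fintype Z] (N : Matrix X Y B) (K : Matrix Y Z B) (c : Z → H) :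
    actVec θ (N * K) c = actVec θ N (actVec θ K c) := by
  ext x
  simp only [actVec, Matrix.mul_apply, map_sum]
  rw [Finset.sum_comm]
  refine Finset.sum_congr rfl fun z _ => ?_
  simp

theorem actVec_add [Fintype Y] (N K : Matrix X Y B) (c : Y → H) :
    actVec θ (N + K) c = actVec θ N c + actVec θ K c := by
  ext x
  simp [actVec, Finset.sum_add_distrib]

theorem actVec_smul [Fintype Y] (e : B) (N : Matrix X Y B) (c : Y → H) (x : X) :
    actVec θ (e • N) c x = θ e (actVec θ N c x) := by
  simp [actVec]

theorem actVec_zero_right [Fintype Y] (N : Matrix X Y B) :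
    actVec θ N 0 = 0 := by
  ext x
  simp [actVec]

end

/-- The underlying homomorphism of a unitary representation to the bounded operators. -/
def unitaryHom (π : Γ →* unitary (H →L[ℂ] H)) : Γ →* (H →L[ℂ] H) :=
  (unitary (H →L[ℂ] H)).subtype.comp π

theorem star_unitaryHom (π : Γ →* unitary (H →L[ℂ] H)) (g : Γ) :
    star (unitaryHom π g) = unitaryHom π g⁻¹ := by
  change star (π g : H →L[ℂ] H) = (π g⁻¹ : H →L[ℂ] H)
  rw [map_inv, ← Unitary.star_eq_inv, Unitary.coe_star]

/-- A unitary representation from a homomorphism to the bounded operators that is compatible with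
adjoints. -/
def unitaryOfStar (ρ : Γ →* (H →L[ℂ] H)) (h : ∀ g, star (ρ g) = ρ g⁻¹) :
    Γ →* unitary (H →L[ℂ] H) where
  toFun g := ⟨ρ g, by
    rw [Unitary.mem_iff, h, ← map_mul, ← map_mul]
    simp⟩
  map_one' := Subtype.ext (map_one ρ)
  map_mul' g g' := Subtype.ext (map_mul ρ g g')

theorem repHom_unitaryRep (π : Γ →* unitary (H →L[ℂ] H)) (r : MonoidAlgebra ℚ Γ) (v : H) :
    repHom (unitaryRep π) r v = groupRingHom (unitaryHom π) r v := by
  induction r using MonoidAlgebra.induction_linear with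
  | zero => simp
  | add r s hr hs => simp [hr, hs]
  | single g c =>
    rw [repHom_single, groupRingHom_single]
    rfl

theorem actVec_toMatrix [Fintype Y] (θ : B →⋆ₐ[ℂ] (H →L[ℂ] H)) {u : Γ →* B}
    {π : Γ →* unitary (H →L[ℂ] H)} (h : ∀ g, θ (u g) = unitaryHom π g)
    (φ : FreeMod Γ X →ₗ[MonoidAlgebra ℚ Γ] FreeMod Γ Y) (c : Y → H) :
    actVec θ (toMatrix u φ) c = pull (repHom (unitaryRep π)) φ c := by
  ext x
  rw [pull_apply, evalCochain_eq_sum]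
  refine Finset.sum_congr rfl fun y _ => ?_
  rw [repHom_unitaryRep, toMatrix, map_groupRingHom θ u _ h]

theorem pull_map {V W : Type} [AddCommGroup V] [Module ℂ V] [AddCommGroup W] [Module ℂ W]
    {α : MonoidAlgebra ℚ Γ →+* Module.End ℂ V} {β : MonoidAlgebra ℚ Γ →+* Module.End ℂ W}
    (T : V →+ W) (hT : ∀ r v, T (α r v) = β r (T v))
    (φ : FreeMod Γ X →ₗ[MonoidAlgebra ℚ Γ] FreeMod Γ Y) (c : Y → V) (x : X) :
    T (pull α φ c x) = pull β φ (fun y => T (c y)) x := by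
  rw [pull_apply, pull_apply]
  generalize φ (Finsupp.single x 1) = w
  induction w using Finsupp.induction_linear with
  | zero => simp
  | add a b ha hb => simp [ha, hb]
  | single y r => rw [evalCochain_single, evalCochain_single, hT]

theorem map_repHom_unitaryRep {H' : Type} [NormedAddCommGroup H'] [InnerProductSpace ℂ H']
    [CompleteSpace H'] (π : Γ →* unitary (H →L[ℂ] H)) (σ : Γ →* unitary (H' →L[ℂ] H'))
    (T : H →L[ℂ] H') (hT : ∀ g, T ∘L unitaryHom π g = unitaryHom σ g ∘L T)
    (r : MonoidAlgebra ℚ Γ) (v : H) :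
    T (repHom (unitaryRep π) r v) = repHom (unitaryRep σ) r (T v) := by
  induction r using MonoidAlgebra.induction_linear with
  | zero => simp
  | add r s hr hs => simp [hr, hs]
  | single g c =>
    rw [repHom_single, repHom_single]
    simp only [map_smul]
    exact congrArg _ (DFunLike.congr_fun (hT g) v)

end ActVec

/-! ### Transport of unitary representations along partial isometries -/

section Transport

open ContinuousLinearMap

variable {Γ : Type} [Group Γ] {V H : Type} [NormedAddCommGroup H] [InnerProductSpace ℂ H]
  [CompleteSpace H] [NormedAddCommGroup V] [InnerProductSpace ℂ V] [CompleteSpace V]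

/-- If `T` is a partial isometry whose initial space is invariant under `π`, then `π` on the initial
space and the trivial representation on the complement of the range form a unitary representation
for which `T` is an intertwiner. -/
theorem exists_unitary_transport (π : Γ →* unitary (V →L[ℂ] V)) (T : V →L[ℂ] H)
    (hT : T ∘L adjoint T ∘L T = T)
    (hπ : ∀ g, (adjoint T ∘L T) ∘L unitaryHom π g = unitaryHom π g ∘L (adjoint T ∘L T)) :
    ∃ σ : Γ →* unitary (H →L[ℂ] H), (∀ g, T ∘L unitaryHom π g = unitaryHom σ g ∘L T) ∧
      ∀ g, adjoint T ∘L unitaryHom σ g = unitaryHom π g ∘L adjoint T := by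
  have hT1 (v : V) : T (adjoint T (T v)) = T v := DFunLike.congr_fun hT v
  have hT' : adjoint T ∘L T ∘L adjoint T = adjoint T := by
    have := congrArg adjoint hT
    rwa [adjoint_comp, adjoint_comp, adjoint_adjoint, comp_assoc] at this
  have hT2 (v : H) : adjoint T (T (adjoint T v)) = adjoint T v := DFunLike.congr_fun hT' v
  have hπ' (g : Γ) (v : V) : adjoint T (T (unitaryHom π g v)) = unitaryHom π g (adjoint T (T v)) :=
    DFunLike.congr_fun (hπ g) v
  let ρ : Γ →* (H →L[ℂ] H) :=
    { toFun := fun g => T ∘L unitaryHom π g ∘L adjoint T + (1 - T ∘L adjoint T)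
      map_one' := by
        ext1 v
        rw [map_one]
        exact add_sub_cancel (T (adjoint T v)) v
      map_mul' := fun g h => by
        ext1 v
        change T (unitaryHom π (g * h) (adjoint T v)) + (v - T (adjoint T v)) =
          T (unitaryHom π g (adjoint T (T (unitaryHom π h (adjoint T v)) +
            (v - T (adjoint T v))))) +
          ((T (unitaryHom π h (adjoint T v)) + (v - T (adjoint T v))) -
            T (adjoint T (T (unitaryHom π h (adjoint T v)) + (v - T (adjoint T v)))))
        rw [map_add (adjoint T), map_sub (adjoint T), hT2, sub_self, add_zero, hπ', hT2, map_mul,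
          add_sub_cancel_left]
        rfl }
  have hadj (g : Γ) : adjoint (T ∘L unitaryHom π g ∘L adjoint T + (1 - T ∘L adjoint T)) =
      T ∘L unitaryHom π g⁻¹ ∘L adjoint T + (1 - T ∘L adjoint T) := by
    have h1 : adjoint (1 : H →L[ℂ] H) = 1 := star_one _
    have h2 : adjoint (unitaryHom π g) = unitaryHom π g⁻¹ := star_unitaryHom π g
    rw [map_add, map_sub, adjoint_comp, adjoint_comp, adjoint_comp, adjoint_adjoint, h1, h2,
      comp_assoc]
  refine ⟨unitaryOfStar ρ hadj, fun g => ?_, fun g => ?_⟩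
  · ext1 v
    change T (unitaryHom π g v) = T (unitaryHom π g (adjoint T (T v))) + (T v - T (adjoint T (T v)))
    rw [← hπ', hT1, hT1, sub_self, add_zero]
  · ext1 v
    change adjoint T (T (unitaryHom π g (adjoint T v)) + (v - T (adjoint T v))) = _
    rw [map_add, map_sub, hT2, sub_self, add_zero, hπ', hT2]
    rfl

/-- An isometric embedding of a closed invariant subspace, extended by zero to the orthogonal
complement, is a partial isometry with invariant initial space. -/
theorem exists_partialIsometry_of_invariant (π : Γ →* unitary (V →L[ℂ] V)) (W : Submodule ℂ V)
    [CompleteSpace W] (hinv : ∀ g, ∀ v ∈ W, unitaryHom π g v ∈ W) (J : W →ₗᵢ[ℂ] H) :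
    ∃ T : V →L[ℂ] H, T ∘L adjoint T ∘L T = T ∧
      (∀ g, (adjoint T ∘L T) ∘L unitaryHom π g = unitaryHom π g ∘L (adjoint T ∘L T)) ∧
      ∀ v ∈ W, adjoint T (T v) = v := by
  let T : V →L[ℂ] H := J.toContinuousLinearMap ∘L W.orthogonalProjectionOnto
  have hT : adjoint T ∘L T = W.starProjection := by
    have h1 : adjoint J.toContinuousLinearMap ∘L J.toContinuousLinearMap = 1 :=
      (norm_map_iff_adjoint_comp_self _).1 J.norm_map
    rw [adjoint_comp, W.adjoint_orthogonalProjectionOnto, comp_assoc,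
      ← comp_assoc (adjoint J.toContinuousLinearMap), h1]
    rfl
  have hT' (v : V) : adjoint T (T v) = W.starProjection v := DFunLike.congr_fun hT v
  refine ⟨T, ?_, fun g => ?_, fun v hv => ?_⟩
  · ext1 v
    change T (adjoint T (T v)) = T v
    rw [hT']
    exact congrArg J (Subtype.ext (congrArg Subtype.val
      (W.orthogonalProjectionOnto_mem_subspace_eq_self (W.orthogonalProjectionOnto v))))
  · rw [hT]
    ext1 v
    refine Submodule.eq_starProjection_of_mem_of_inner_eq_zero
      (hinv g _ (W.starProjection_apply_mem v)) fun w hw => ?_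
    change inner ℂ (unitaryHom π g v - unitaryHom π g (W.starProjection v)) w = 0
    rw [← map_sub, ← adjoint_inner_right]
    have h2 : adjoint (unitaryHom π g) = unitaryHom π g⁻¹ := star_unitaryHom π g
    rw [h2]
    exact W.starProjection_inner_eq_zero _ _ (hinv _ _ hw)
  · rw [hT', Submodule.starProjection_eq_self_iff.2 hv]

/-- Finitely many vectors of a unitary representation lie in an invariant closed subspace that
embeds in `BigHilbert Γ`: an orthonormal basis of the subspace that they generate has at most
`max |Γ| ℵ₀` elements, as each generator has countably many nonzero coordinates. -/
theorem exists_partialIsometry_bigHilbert (π : Γ →* unitary (V →L[ℂ] V)) {X : Type} [Finite X]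
    (c : X → V) : ∃ T : V →L[ℂ] BigHilbert Γ, T ∘L adjoint T ∘L T = T ∧
      (∀ g, (adjoint T ∘L T) ∘L unitaryHom π g = unitaryHom π g ∘L (adjoint T ∘L T)) ∧
      ∀ x, adjoint T (T (c x)) = c x := by
  let w : Γ × X → V := fun p => unitaryHom π p.1 (c p.2)
  let W : Submodule ℂ V := (Submodule.span ℂ (Set.range w)).topologicalClosure
  have hWc : IsClosed (W : Set V) := Submodule.isClosed_topologicalClosure _
  have : CompleteSpace W := hWc.completeSpace_coe
  have hwW (p : Γ × X) : w p ∈ W :=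
    Submodule.le_topologicalClosure _ (Submodule.subset_span ⟨p, rfl⟩)
  have hinv (g : Γ) (v : V) (hv : v ∈ W) : unitaryHom π g v ∈ W := by
    have : W ≤ W.comap (unitaryHom π g : V →ₗ[ℂ] V) := by
      refine Submodule.topologicalClosure_minimal _ ?_ (hWc.preimage (unitaryHom π g).continuous)
      rw [Submodule.span_le]
      rintro _ ⟨p, rfl⟩
      refine hwW (g * p.1, p.2) |> fun h => ?_
      change unitaryHom π g (unitaryHom π p.1 (c p.2)) ∈ W
      change unitaryHom π (g * p.1) (c p.2) ∈ W at h
      rwa [map_mul] at h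
    exact this hv
  obtain ⟨I, b, hb⟩ := exists_hilbertBasis ℂ W
  -- each basis vector has a nonzero coefficient in some generator
  have hex (i : I) : ∃ p, inner ℂ (b i) (⟨w p, hwW p⟩ : W) ≠ 0 := by
    by_contra! h
    have h1 : W ≤ (ℂ ∙ (b i : V))ᗮ := by
      refine Submodule.topologicalClosure_minimal _ ?_ (Submodule.isClosed_orthogonal _)
      rw [Submodule.span_le]
      rintro _ ⟨p, rfl⟩
      exact Submodule.mem_orthogonal_singleton_iff_inner_right.2 (h p)
    have h2 := Submodule.mem_orthogonal_singleton_iff_inner_right.1 (h1 (b i).2)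
    have h3 := b.orthonormal.1 i
    rw [inner_self_eq_zero, Submodule.coe_eq_zero] at h2
    simp [h2] at h3
  choose p hp using hex
  have hcount (q : Γ × X) : Countable {i : I // p i = q} := by
    have h1 : Summable fun i => ‖b.repr ⟨w q, hwW q⟩ i‖ ^ (2 : ENNReal).toReal :=
      (lp.memℓp (b.repr ⟨w q, hwW q⟩)).summable (by norm_num)
    refine (h1.countable_support.mono fun i (hi : p i = q) => ?_).to_subtype
    have := hp i
    rw [hi] at this
    rw [Function.mem_support, b.repr_apply_apply]
    simpa using this
  have hX : Countable X := inferInstance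
  obtain ⟨jX, hjX⟩ := exists_injective_nat X
  choose j hj using fun q => exists_injective_nat {i : I // p i = q}
  let ι : I → Γ × ℕ := fun i => ((p i).1, Nat.pair (jX (p i).2) (j (p i) ⟨i, rfl⟩))
  have hι : Function.Injective ι := by
    intro i i' h
    obtain ⟨h1, h2⟩ := Prod.ext_iff.1 h
    obtain ⟨h3, h4⟩ := Nat.pair_eq_pair.1 h2
    have h5 : p i = p i' := Prod.ext h1 (hjX h3)
    have h6 (q q' : Γ × X) (hq : q = q') (hi : p i = q) (hi' : p i' = q')
        (h : j q ⟨i, hi⟩ = j q' ⟨i', hi'⟩) : i = i' := by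
      subst hq
      exact congrArg Subtype.val (hj q h)
    exact h6 _ _ h5 rfl rfl h4
  classical
  have horth : Orthonormal ℂ fun i : I => (lp.single 2 (ι i) (1 : ℂ) : BigHilbert Γ) := by
    constructor
    · intro i
      rw [lp.norm_single (by norm_num)]
      simp
    · intro i i' hii'
      rw [lp.inner_single_left]
      simp [hι.ne hii']
  let J : W →ₗᵢ[ℂ] BigHilbert Γ :=
    (horth.orthogonalFamily.linearIsometry).comp b.repr.toLinearIsometry
  obtain ⟨T, h1, h2, h3⟩ := exists_partialIsometry_of_invariant π W hinv J
  refine ⟨T, h1, h2, fun x => h3 _ ?_⟩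
  have := hwW (1, x)
  simpa [w] using this

end Transport

/-! ### Vanishing of cohomology from contractions -/

section Vanishing

open ContinuousLinearMap

variable {Γ : Type} [Group Γ]

/-- The component at `σ` as a *-homomorphism. -/
def appHom (σ : BigRep Γ) : BoundedFamily Γ →⋆ₐ[ℂ] BigOp Γ where
  toFun T := T.app σ
  map_one' := rfl
  map_mul' _ _ := rfl
  map_zero' := rfl
  map_add' _ _ := rfl
  commutes' _ := rfl
  map_star' _ := rfl

/-- A contraction of the cochain complex over any algebra of bounded families acts on the cochains
of every representation on `BigHilbert Γ`; by transport along a partial isometry it makes cocycles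
in any unitary representation coboundaries. -/
theorem FiniteModel.RelContractible.cochainExact {m : ℕ} {M : FiniteModel Γ m} {k : ℕ}
    [Fintype (M.X k)] [Fintype (M.X (k + 1))] [Fintype (M.X (k + 2))]
    {A : NonUnitalStarSubalgebra ℂ (BoundedFamily Γ)} {e : BoundedFamily Γ}
    (h : M.RelContractible (groupEltHom Γ) A e k) (hes : star e = e)
    (hinv : ∀ g, groupElt g * (1 - e) = 1 - e) {V : Type} [NormedAddCommGroup V]
    [InnerProductSpace ℂ V] [CompleteSpace V] (π : Γ →* unitary (V →L[ℂ] V))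
    (hV : e = 1 ∨ ∀ v : V, (∀ g : Γ, (π g : V →L[ℂ] V) v = v) → v = 0) :
    M.CochainExact (repHom (unitaryRep π)) k := by
  intro c hq hd
  obtain ⟨T, h1, h2, h3⟩ := exists_partialIsometry_bigHilbert π c
  obtain ⟨σ, hσ, hσ'⟩ := exists_unitary_transport π T h1 h2
  obtain ⟨G, Y, -, -, h⟩ := h
  have hθ (g : Γ) : appHom σ (groupEltHom Γ g) = unitaryHom σ g := rfl
  let c' : M.X (k + 1) → BigHilbert Γ := fun x => T (c x)
  have hact {Z : Type} (φ : FreeMod Γ Z →ₗ[MonoidAlgebra ℚ Γ] FreeMod Γ (M.X (k + 1))) :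
      actVec (appHom σ) (toMatrix (groupEltHom Γ) φ) c' =
        fun z => T (pull (repHom (unitaryRep π)) φ c z) := by
    rw [actVec_toMatrix _ hθ]
    exact funext fun z => (pull_map (T : V →+ BigHilbert Γ)
      (map_repHom_unitaryRep π σ T hσ) φ c z).symm
  -- the components of `1 - e` are projections to invariant vectors
  have he (x : M.X (k + 1)) : appHom σ e (c' x) = c' x := by
    rcases hV with rfl | hV
    · rw [map_one]
      rfl
    · have hp (g : Γ) (v : BigHilbert Γ) :
          unitaryHom σ g (appHom σ (1 - e) v) = appHom σ (1 - e) v := by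
        rw [← hθ]
        exact DFunLike.congr_fun (congrArg (appHom σ) (hinv g)) v
      have h0 : appHom σ (1 - e) (c' x) = 0 := by
        refine ext_inner_left ℂ fun v => ?_
        have hs : adjoint (appHom σ (1 - e)) = appHom σ (1 - e) := by
          rw [← star_eq_adjoint, ← map_star, star_sub, star_one, hes]
        rw [← hs, adjoint_inner_right, ← adjoint_inner_left, inner_zero_right,
          hV (adjoint T (appHom σ (1 - e) v)) fun g => ?_, inner_zero_left]
        exact (DFunLike.congr_fun (hσ' g) _).symm.trans (congrArg (adjoint T) (hp g v))
      rw [map_sub, map_one] at h0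
      exact (sub_eq_zero.1 h0).symm
  have key : c' =
      actVec (appHom σ) (toMatrix (groupEltHom Γ) (M.d k)) (actVec (appHom σ) Y c') := by
    have h4 : actVec (appHom σ) (toMatrix (groupEltHom Γ) (M.d (k + 1))) c' = 0 := by
      rw [hact, hd]
      exact funext fun z => map_zero T
    have h5 := congrArg (actVec (appHom σ) · c') h
    simp only [actVec_add, actVec_mul, h4, actVec_zero_right, zero_add] at h5
    rw [← h5]
    funext x
    rw [actVec_smul, hact, hq]
    exact (he x).symm
  refine ⟨fun x => adjoint T (actVec (appHom σ) Y c' x), funext fun x => ?_⟩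
  refine (pull_map (adjoint T : BigHilbert Γ →+ V)
    (map_repHom_unitaryRep σ π (adjoint T) hσ') (M.d k) _ x).symm.trans ?_
  rw [← actVec_toMatrix _ hθ, ← key]
  exact h3 x

end Vanishing

/-! ### The unit of an augmentation ideal -/

section Augmentation

variable {Γ : Type} [Group Γ]

theorem barD_zero_single (x : Fin 1 → Γ) :
    barD Γ 0 (Finsupp.single x 1) =
      Finsupp.single default (MonoidAlgebra.single (x 0) 1 - MonoidAlgebra.single 1 1) := by
  rw [barD_single, Fin.sum_univ_one]
  have h (i : Fin 0 → Γ) (r : MonoidAlgebra ℚ Γ) :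
      (Finsupp.single i r : FreeMod Γ (Fin 0 → Γ)) = Finsupp.single default r := by
    rw [Subsingleton.elim i default]
  rw [h, h (Fin.contractNth _ _ _), ← Finsupp.single_add, sub_eq_add_neg,
    ← MonoidAlgebra.single_neg]
  simp

theorem pull_barD_zero_apply {V : Type} [AddCommGroup V] [Module ℂ V] (ρ : Representation ℂ Γ V)
    (c : (Fin 0 → Γ) → V) (x : Fin 1 → Γ) :
    pull (repHom ρ) (barD Γ 0) c x = ρ (x 0) (c default) - c default := by
  rw [pull_apply, barD_zero_single, evalCochain_single, map_sub, LinearMap.sub_apply, repHom_single,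
    repHom_single]
  simp

theorem toMatrix_barD_zero_apply {B : Type} [Ring B] [Algebra ℂ B] (u : Γ →* B) (x : Fin 1 → Γ) :
    toMatrix u (barD Γ 0) x default = u (x 0) - 1 := by
  rw [toMatrix, barD_zero_single, Finsupp.single_eq_same, map_sub, groupRingHom_single,
    groupRingHom_single]
  simp

/-- The augmentation ideal of `ℚΓ`, the range of `barD Γ 0`, is finitely generated as a left ideal:
a homotopy from the identity of the bar resolution to a map that factors through the finite model
expresses it by the images of the basis of the finite model in degree one and by one further element,
as the bar resolution has rank one in degree zero. -/
theorem FiniteModel.exists_augmentation_generators {m : ℕ} (M : FiniteModel Γ m) (hm : 1 ≤ m) :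
    ∃ (J : Type) (_ : Finite J) (φ : FreeMod Γ J →ₗ[MonoidAlgebra ℚ Γ] FreeMod Γ (Fin 1 → Γ))
      (ψ : FreeMod Γ (Fin 1 → Γ) →ₗ[MonoidAlgebra ℚ Γ] FreeMod Γ J),
      barD Γ 0 ∘ₗ φ ∘ₗ ψ = barD Γ 0 := by
  let φ : FreeMod Γ (M.X 1 ⊕ Unit) →ₗ[MonoidAlgebra ℚ Γ] FreeMod Γ (Fin 1 → Γ) :=
    Finsupp.linearCombination _ (Sum.elim (fun x => M.f 1 (Finsupp.single x 1))
      fun _ => M.h 0 (Finsupp.single default 1))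
  let i₁ : FreeMod Γ (M.X 1) →ₗ[MonoidAlgebra ℚ Γ] FreeMod Γ (M.X 1 ⊕ Unit) :=
    Finsupp.lmapDomain _ _ Sum.inl
  let i₂ : FreeMod Γ (Fin 0 → Γ) →ₗ[MonoidAlgebra ℚ Γ] FreeMod Γ (M.X 1 ⊕ Unit) :=
    Finsupp.lmapDomain _ _ fun _ => Sum.inr ()
  have h₁ : φ ∘ₗ i₁ = M.f 1 := by
    refine Finsupp.lhom_ext' fun x => LinearMap.ext_ring ?_
    simp [φ, i₁]
  have h₂ : φ ∘ₗ i₂ = M.h 0 := by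
    refine Finsupp.lhom_ext' fun x => LinearMap.ext_ring ?_
    rw [Subsingleton.elim x default]
    simp [φ, i₂]
  have := M.finite 1 hm
  refine ⟨M.X 1 ⊕ Unit, inferInstance, φ, i₁ ∘ₗ M.g 1 - i₂ ∘ₗ barD Γ 0, ?_⟩
  have e1 : φ ∘ₗ (i₁ ∘ₗ M.g 1 - i₂ ∘ₗ barD Γ 0) = M.f 1 ∘ₗ M.g 1 - M.h 0 ∘ₗ barD Γ 0 := by
    rw [LinearMap.comp_sub, ← LinearMap.comp_assoc, ← LinearMap.comp_assoc, h₁, h₂]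
  have e2 (w : FreeMod Γ (Fin 0 → Γ)) : M.f 0 (M.g 0 w) = w + barD Γ 0 (M.h 0 w) :=
    LinearMap.congr_fun M.fg_zero w
  rw [e1]
  refine LinearMap.ext fun w => ?_
  change barD Γ 0 (M.f 1 (M.g 1 w) - M.h 0 (barD Γ 0 w)) = barD Γ 0 w
  have e3 : M.f 0 (M.d 0 (M.g 1 w)) = barD Γ 0 (M.f 1 (M.g 1 w)) :=
    LinearMap.congr_fun (M.f_d 0) (M.g 1 w)
  have e4 : M.g 0 (barD Γ 0 w) = M.d 0 (M.g 1 w) := LinearMap.congr_fun (M.g_d 0) w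
  rw [map_sub, ← e3, ← e4, e2, add_sub_cancel_right]

variable {A : NonUnitalStarSubalgebra ℂ (BoundedFamily Γ)}

theorem groupRingHom_barD_zero_mem (hA : CStarAug Γ ≤ A) (w : FreeMod Γ (Fin 1 → Γ)) :
    groupRingHom (groupEltHom Γ) (barD Γ 0 w default) ∈ A := by
  induction w using Finsupp.induction_linear with
  | zero => simp
  | add a b ha hb => rw [map_add, Finsupp.add_apply, map_add]; exact add_mem ha hb
  | single x r =>
    have : (Finsupp.single x r : FreeMod Γ (Fin 1 → Γ)) = r • Finsupp.single x 1 := by simp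
    rw [this, map_smul, Finsupp.smul_apply, smul_eq_mul, map_mul]
    have h := toMatrix_barD_zero_apply (groupEltHom Γ) x
    rw [toMatrix] at h
    rw [h]
    have h2 := (repHom (leftMulRep A hA) r ⟨_, hA (groupElt_sub_one_mem (x 0))⟩).2
    rwa [coe_repHom_leftMulRep] at h2

theorem entriesIn_toMatrix_barD_zero_comp (hA : CStarAug Γ ≤ A) {J : Type}
    (φ : FreeMod Γ J →ₗ[MonoidAlgebra ℚ Γ] FreeMod Γ (Fin 1 → Γ)) :
    EntriesIn A (toMatrix (groupEltHom Γ) (barD Γ 0 ∘ₗ φ)) := by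
  intro j i
  rw [Subsingleton.elim i default]
  exact groupRingHom_barD_zero_mem hA _

/-- An element of `W*₀Γ` annihilates the invariant vectors of every representation, as they are
images of intertwiners from the trivial representation. -/
theorem app_apply_eq_zero_of_invariant {T : BoundedFamily Γ} (hT : T ∈ WStarAug Γ) (π : BigRep Γ)
    {w : BigHilbert Γ} (hw : ∀ g, (π g : BigOp Γ) w = w) : T.app π w = 0 := by
  obtain ⟨hTW, hT0⟩ := hT
  obtain ⟨u, hu⟩ := exists_ne (0 : BigHilbert Γ)
  let S : BigOp Γ := InnerProductSpace.rankOne ℂ w u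
  have hS (g : Γ) : S * ((1 : BigRep Γ) g : BigOp Γ) = (π g : BigOp Γ) * S := by
    refine ContinuousLinearMap.ext fun v => ?_
    change S v = (π g : BigOp Γ) (S v)
    simp only [S, InnerProductSpace.rankOne_apply, map_smul, hw]
  have h := hTW 1 π S hS
  rw [show T.app 1 = 0 from hT0, mul_zero] at h
  have h2 := DFunLike.congr_fun h u
  change 0 = T.app π (S u) at h2
  rw [InnerProductSpace.rankOne_apply, map_smul, eq_comm, smul_eq_zero] at h2
  exact h2.resolve_left (inner_self_ne_zero.2 hu)

/-- An element `e` of an algebra of families that vanish at the trivial representation is a unit of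
the algebra if `1 - e` is invariant, as the components of `1 - e` then have invariant vectors as
values. -/
theorem isUnitOf_of_invariant (hA : CStarAug Γ ≤ A) (hAW : A ≤ WStarAug Γ) {e : BoundedFamily Γ}
    (he : e ∈ A) (hinv : ∀ g, groupElt g * (1 - e) = 1 - e) : IsUnitOf (groupEltHom Γ) A e := by
  have hkill (T : BoundedFamily Γ) (hT : T ∈ A) : T * e = T := by
    suffices h : T * (1 - e) = 0 by rwa [mul_sub, mul_one, sub_eq_zero, eq_comm] at h
    refine BoundedFamily.ext fun π => ContinuousLinearMap.ext fun v => ?_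
    exact app_apply_eq_zero_of_invariant (hAW hT) π fun g =>
      DFunLike.congr_fun (congrArg (BoundedFamily.app · π) (hinv g)) v
  have hstar : star e = e := by
    have h := hkill (star e) (star_mem he)
    have h1 := congrArg star h
    rw [star_mul, star_star] at h1
    rw [← h, h1]
  refine ⟨star_groupElt, fun g a ha => groupElt_mul_mem hA g ha, he, hstar, fun a ha => ?_⟩
  have h := congrArg star (hkill _ (star_mem ha))
  rwa [star_mul, star_star, hstar] at h

theorem isUnitOf_one (hA : (CStar Γ).toNonUnitalStarSubalgebra ≤ A) :
    IsUnitOf (groupEltHom Γ) A 1 :=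
  ⟨star_groupElt, fun g _ ha => groupElt_mul_mem ((cstarAug_le_cstar Γ).trans hA) g ha,
    hA (one_mem (CStar Γ)), star_one _, fun a _ => one_mul a⟩

/-- A generalized inverse of a column of generators of the augmentation ideal gives the unit of the
algebra. -/
theorem exists_invariant_of_mul_mul [Fintype (Fin 0 → Γ)] {J : Type} [Fintype J]
    (hA : CStarAug Γ ≤ A)
    {φ : FreeMod Γ J →ₗ[MonoidAlgebra ℚ Γ] FreeMod Γ (Fin 1 → Γ)}
    {ψ : FreeMod Γ (Fin 1 → Γ) →ₗ[MonoidAlgebra ℚ Γ] FreeMod Γ J}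
    (hψ : barD Γ 0 ∘ₗ φ ∘ₗ ψ = barD Γ 0) {G : Matrix (Fin 0 → Γ) J (BoundedFamily Γ)}
    (hG : EntriesIn A G) (h : toMatrix (groupEltHom Γ) (barD Γ 0 ∘ₗ φ) * G *
      toMatrix (groupEltHom Γ) (barD Γ 0 ∘ₗ φ) = toMatrix (groupEltHom Γ) (barD Γ 0 ∘ₗ φ)) :
    ∃ e ∈ A, e = (G * toMatrix (groupEltHom Γ) (barD Γ 0 ∘ₗ φ)) default default ∧
      ∀ g, groupElt g * (1 - e) = 1 - e := by
  refine ⟨_, (hG.mul (entriesIn_toMatrix_barD_zero_comp hA φ)) default default, rfl, fun g => ?_⟩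
  have h1 : toMatrix (groupEltHom Γ) (barD Γ 0) *
      (G * toMatrix (groupEltHom Γ) (barD Γ 0 ∘ₗ φ)) = toMatrix (groupEltHom Γ) (barD Γ 0) := by
    have : toMatrix (groupEltHom Γ) (barD Γ 0) =
        toMatrix (groupEltHom Γ) ψ * toMatrix (groupEltHom Γ) (barD Γ 0 ∘ₗ φ) := by
      rw [← toMatrix_comp, LinearMap.comp_assoc, hψ]
    rw [this, Matrix.mul_assoc, ← Matrix.mul_assoc _ G, h]
  have h2 := congrFun (congrFun h1 fun _ => g) default
  rw [Matrix.mul_apply, Fintype.sum_subsingleton _ default, toMatrix_barD_zero_apply] at h2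
  set e := (G * toMatrix (groupEltHom Γ) (barD Γ 0 ∘ₗ φ)) default default
  change (groupElt g - 1) * e = groupElt g - 1 at h2
  rw [sub_mul, one_mul] at h2
  rw [mul_sub, mul_one, ← sub_eq_zero]
  rw [← sub_eq_zero] at h2
  rw [← neg_eq_zero, ← h2]
  abel

/-- The vanishing of the first cohomology with coefficients in `A` gives the unit `e` of `A`: the
coboundary of `1` has values in `A`, and `e` is an element of `A` with the same coboundary. -/
theorem exists_invariant_of_cohomologyCriterion (hA : CStarAug Γ ≤ A) {n : ℕ} (hn : 0 < n)
    (h : CohomologyCriterion (leftMulRep A hA) n) :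
    ∃ e ∈ A, ∀ g, groupElt g * (1 - e) = 1 - e := by
  have h1 := h.1 1 le_rfl hn
  rw [subsingleton_groupCohomology_succ_iff] at h1
  -- the cocycle `g ↦ g - 1`, the coboundary of `1`, which need not be in `A`
  let c : (Fin 1 → Γ) → A := fun x => ⟨groupElt (x 0) - 1, hA (groupElt_sub_one_mem (x 0))⟩
  have hc : pull (repHom (leftMulRep A hA)) (barD Γ 1) c = 0 := by
    funext x
    let T : A →+ (⊤ : NonUnitalStarSubalgebra ℂ (BoundedFamily Γ)) :=
      { toFun := fun a => ⟨a, trivial⟩, map_zero' := rfl, map_add' := fun _ _ => rfl }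
    have hT : Function.Injective T := fun a b h =>
      Subtype.ext (congrArg (fun z : (⊤ : NonUnitalStarSubalgebra ℂ (BoundedFamily Γ)) => z.1) h)
    refine hT ?_
    rw [pull_map (β := repHom (leftMulRep ⊤ le_top)) T fun r v => Subtype.ext
      ((coe_repHom_leftMulRep hA r v).trans (coe_repHom_leftMulRep le_top r (T v)).symm)]
    have : (fun y => T (c y)) = pull (repHom (leftMulRep ⊤ le_top)) (barD Γ 0)
        fun _ => ⟨1, trivial⟩ := by
      funext y
      rw [pull_barD_zero_apply]
      refine Subtype.ext ?_
      change groupElt (y 0) - 1 = groupElt (y 0) * 1 - 1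
      rw [mul_one]
    rw [this, ← pull_comp, barD_comp_barD, pull_zero]
    exact (map_zero T).symm
  obtain ⟨b, hb⟩ := h1 c hc
  refine ⟨b default, (b default).2, fun g => ?_⟩
  have h2 := congrFun hb fun _ => g
  rw [pull_barD_zero_apply] at h2
  have h3 : groupElt g * (b default : BoundedFamily Γ) - b default = groupElt g - 1 :=
    congrArg Subtype.val h2
  rw [mul_sub, mul_one, sub_eq_sub_iff_sub_eq_sub, ← h3]

/-- If `H_0` is Hausdorff, then the adjoint of a finite column of generators of the augmentation
ideal has a closed range, and its generalized inverse gives the unit of `A`. -/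
theorem exists_invariant_of_homologyCriterion {m : ℕ} (M : FiniteModel Γ m) (hm : 1 ≤ m)
    (hcl : IsClosed (A : Set (BoundedFamily Γ))) (hA : CStarAug Γ ≤ A) {n : ℕ}
    (h : HomologyCriterion (leftMulRep A hA) n) :
    ∃ e ∈ A, ∀ g, groupElt g * (1 - e) = 1 - e := by
  obtain ⟨J, hJ, φ, ψ, hψ⟩ := M.exists_augmentation_generators hm
  let _ := Fintype.ofFinite J
  let _ : Fintype (Fin 0 → Γ) := Fintype.ofSubsingleton default
  have h0 := (homologyZeroHausdorff_iff _).1 h.2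
  have hE := entriesIn_toMatrix_barD_zero_comp hA φ
  have hr : IsClosed ((toMatrix (groupEltHom Γ) (barD Γ 0 ∘ₗ φ)).conjTranspose.mulVec ''
      {a | ∀ i, a i ∈ A}) := by
    have h1 := IsClosed.preimage (f := fun f : (Fin 0 → Γ) → BoundedFamily Γ => f default)
      (continuous_apply _) (hcl.isClosedEmbedding_subtypeVal.isClosed_iff_image_isClosed.1 h0)
    convert h1 using 1
    ext f
    constructor
    · rintro ⟨a, ha, rfl⟩
      let a' : J →₀ A := Finsupp.equivFunOnFinite.symm fun j => ⟨a j, ha j⟩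
      refine ⟨push (repHom (leftMulRep A hA)) (barD Γ 0 ∘ₗ φ) a' default, ?_,
        coe_push_leftMulRep hA _ a' _⟩
      change Finsupp.single default (push (repHom (leftMulRep A hA)) (barD Γ 0 ∘ₗ φ) a' default) ∈
        Set.range (push (repHom (leftMulRep A hA)) (barD Γ 0))
      rw [single_default_eq, push_comp]
      exact ⟨_, rfl⟩
    · rintro ⟨v, ⟨c, hc⟩, hv⟩
      rw [← hψ, ← LinearMap.comp_assoc, push_comp] at hc
      refine ⟨fun j => push (repHom (leftMulRep A hA)) ψ c j, fun j => Subtype.property _,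
        funext fun i => ?_⟩
      rw [← coe_push_leftMulRep hA, hc, Subsingleton.elim i default, Finsupp.single_eq_same]
      exact hv
  obtain ⟨G, hG, hGE⟩ := exists_matrix_mul_mul_eq_self hcl hE.conjTranspose hr
  have h2 := congrArg Matrix.conjTranspose hGE
  rw [Matrix.conjTranspose_mul, Matrix.conjTranspose_mul, Matrix.conjTranspose_conjTranspose,
    ← Matrix.mul_assoc] at h2
  obtain ⟨e, he, -, hinv⟩ := exists_invariant_of_mul_mul hA hψ hG.conjTranspose h2
  exact ⟨e, he, hinv⟩

end Augmentation

/-! ### The Kazhdan constant -/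

section Kazhdan

open ContinuousLinearMap

variable {Γ : Type} [Group Γ]

/-- The restriction of a unitary representation to a closed invariant subspace. -/
theorem exists_subrepresentation {V : Type} [NormedAddCommGroup V] [InnerProductSpace ℂ V]
    [CompleteSpace V] (π : Γ →* unitary (V →L[ℂ] V)) (W : Submodule ℂ V) [CompleteSpace W]
    (hinv : ∀ g, ∀ v ∈ W, unitaryHom π g v ∈ W) :
    ∃ σ : Γ →* unitary (W →L[ℂ] W), ∀ g, W.subtypeL ∘L unitaryHom σ g =
      unitaryHom π g ∘L W.subtypeL := by
  have hadj (g : Γ) : adjoint (unitaryHom π g) = unitaryHom π g⁻¹ := star_unitaryHom π g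
  let ρ (g : Γ) : W →L[ℂ] W := (unitaryHom π g ∘L W.subtypeL).codRestrict W fun w => hinv g w w.2
  let ρ' : Γ →* (W →L[ℂ] W) :=
    { toFun := ρ
      map_one' := by
        ext w
        change unitaryHom π 1 w = w
        rw [map_one]
        rfl
      map_mul' := fun g h => by
        ext w
        change unitaryHom π (g * h) w = unitaryHom π g (unitaryHom π h w)
        rw [map_mul]
        rfl }
  refine ⟨unitaryOfStar ρ' fun g => ?_, fun g => rfl⟩
  refine ContinuousLinearMap.ext fun w => ext_inner_left ℂ fun w' => ?_
  rw [star_eq_adjoint, adjoint_inner_right]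
  change inner ℂ (unitaryHom π g w') (w : V) = inner ℂ (w' : V) (unitaryHom π g⁻¹ w)
  rw [← hadj, adjoint_inner_right]

section DirectSum

variable {ι H : Type} [NormedAddCommGroup H] [InnerProductSpace ℂ H] [CompleteSpace H]
  (σ : ι → Γ →* unitary (H →L[ℂ] H))

theorem norm_unitaryHom_apply {H : Type} [NormedAddCommGroup H] [InnerProductSpace ℂ H]
    [CompleteSpace H] (π : Γ →* unitary (H →L[ℂ] H)) (g : Γ) (v : H) :
    ‖unitaryHom π g v‖ = ‖v‖ :=
  ContinuousLinearMap.norm_map_of_mem_unitary (π g).2 v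

/-- The Hilbert space direct sum of a family of unitary representations on the same space. -/
theorem exists_directSum : ∃ π : Γ →* unitary (lp (fun _ : ι => H) 2 →L[ℂ] lp (fun _ : ι => H) 2),
    ∀ g f i, unitaryHom π g f i = unitaryHom (σ i) g (f i) := by
  let L (g : Γ) : lp (fun _ : ι => H) 2 →ₗᵢ[ℂ] lp (fun _ : ι => H) 2 :=
    { toFun := fun f => ⟨fun i => unitaryHom (σ i) g (f i), memℓp_gen (by
        simpa only [norm_unitaryHom_apply] using (lp.memℓp f).summable (by norm_num))⟩
      map_add' := fun f f' => lp.ext (funext fun i => map_add (unitaryHom (σ i) g) (f i) (f' i))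
      map_smul' := fun c f => lp.ext (funext fun i => map_smul (unitaryHom (σ i) g) c (f i))
      norm_map' := fun f => by
        rw [lp.norm_eq_tsum_rpow (by norm_num), lp.norm_eq_tsum_rpow (by norm_num)]
        simp [norm_unitaryHom_apply] }
  let ρ : Γ →* (lp (fun _ : ι => H) 2 →L[ℂ] lp (fun _ : ι => H) 2) :=
    { toFun := fun g => (L g).toContinuousLinearMap
      map_one' := by
        refine ContinuousLinearMap.ext fun f => lp.ext (funext fun i => ?_)
        change unitaryHom (σ i) 1 (f i) = f i
        rw [map_one]
        rfl
      map_mul' := fun g h => by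
        refine ContinuousLinearMap.ext fun f => lp.ext (funext fun i => ?_)
        change unitaryHom (σ i) (g * h) (f i) = unitaryHom (σ i) g (unitaryHom (σ i) h (f i))
        rw [map_mul]
        rfl }
  refine ⟨unitaryOfStar ρ fun g => ?_, fun g f i => rfl⟩
  refine ContinuousLinearMap.ext fun w => ext_inner_left ℂ fun w' => ?_
  rw [star_eq_adjoint, adjoint_inner_right, lp.inner_eq_tsum, lp.inner_eq_tsum]
  refine tsum_congr fun i => ?_
  change inner ℂ (unitaryHom (σ i) g (w' i)) (w i) = inner ℂ (w' i) (unitaryHom (σ i) g⁻¹ (w i))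
  rw [← star_unitaryHom, star_eq_adjoint, adjoint_inner_right]

end DirectSum

section Bound

variable {J : Type} {φ : FreeMod Γ J →ₗ[MonoidAlgebra ℚ Γ] FreeMod Γ (Fin 1 → Γ)}
  {ψ : FreeMod Γ (Fin 1 → Γ) →ₗ[MonoidAlgebra ℚ Γ] FreeMod Γ J}

theorem continuous_unitaryRep {V : Type} [NormedAddCommGroup V] [InnerProductSpace ℂ V]
    [CompleteSpace V] (π : Γ →* unitary (V →L[ℂ] V)) (g : Γ) : Continuous (unitaryRep π g) :=
  (π g : V →L[ℂ] V).continuous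

/-- The values of generators of the augmentation ideal at a vector. -/
def augmentationMap {V : Type} [NormedAddCommGroup V] [InnerProductSpace ℂ V]
    [CompleteSpace V] (φ : FreeMod Γ J →ₗ[MonoidAlgebra ℚ Γ] FreeMod Γ (Fin 1 → Γ))
    (π : Γ →* unitary (V →L[ℂ] V)) : V →L[ℂ] (J → V) where
  toFun v := pull (repHom (unitaryRep π)) (barD Γ 0 ∘ₗ φ) fun _ => v
  map_add' v w := map_add (pull (repHom (unitaryRep π)) (barD Γ 0 ∘ₗ φ)) (fun _ => v) fun _ => w
  map_smul' c v := map_smul (pull (repHom (unitaryRep π)) (barD Γ 0 ∘ₗ φ)) c fun _ => v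
  cont := (continuous_pull _ (continuous_repHom (continuous_unitaryRep π)) _).comp
    (continuous_pi fun _ => continuous_id)

/-- If the first cohomology of a unitary representation without invariant vectors vanishes, then
finitely many generators of the augmentation ideal bound the norm: the coboundaries are closed, and
the open mapping theorem applies. -/
theorem exists_norm_le_augmentationMap [Fintype J] (hψ : barD Γ 0 ∘ₗ φ ∘ₗ ψ = barD Γ 0)
    {V : Type} [NormedAddCommGroup V] [InnerProductSpace ℂ V]
    [CompleteSpace V] (π : Γ →* unitary (V →L[ℂ] V))
    (hV : ∀ v : V, (∀ g : Γ, (π g : V →L[ℂ] V) v = v) → v = 0)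
    (h1 : Subsingleton (groupCohomology (Rep.of (unitaryRep π)) 1)) :
    ∃ c : ℝ, 0 < c ∧ ∀ v : V, ‖v‖ ≤ c * ‖augmentationMap φ π v‖ := by
  rw [subsingleton_groupCohomology_succ_iff] at h1
  set α := repHom (unitaryRep π) with hα
  have hcont := continuous_repHom (continuous_unitaryRep π)
  have hconst (b : (Fin 0 → Γ) → V) : b = fun _ => b default :=
    funext fun i => congrArg b (Subsingleton.elim i default)
  have hψ' (b : (Fin 0 → Γ) → V) :
      pull α ψ (pull α (barD Γ 0 ∘ₗ φ) b) = pull α (barD Γ 0) b := by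
    rw [← pull_comp, LinearMap.comp_assoc, hψ]
  have hinj : Function.Injective (augmentationMap φ π) := by
    rw [injective_iff_map_eq_zero]
    intro v hv
    refine hV v fun g => ?_
    have h2 : pull α (barD Γ 0) (fun _ => v) = 0 := by
      rw [← hψ']
      change pull α ψ (augmentationMap φ π v) = 0
      rw [hv, map_zero]
    have h3 := congrFun h2 fun _ => g
    rw [pull_barD_zero_apply] at h3
    exact sub_eq_zero.1 h3
  have hcl : IsClosed (Set.range (augmentationMap φ π)) := by
    refine isClosed_of_closure_subset fun w hw => ?_
    have e1 : pull α (barD Γ 1) (pull α ψ w) = 0 := by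
      have hs : IsClosed {w | pull α (barD Γ 1) (pull α ψ w) = 0} :=
        isClosed_eq ((continuous_pull α hcont _).comp (continuous_pull α hcont _)) continuous_const
      refine closure_minimal ?_ hs hw
      rintro _ ⟨v, rfl⟩
      change pull α (barD Γ 1) (pull α ψ (pull α (barD Γ 0 ∘ₗ φ) fun _ => v)) = 0
      rw [hψ', ← pull_comp, barD_comp_barD, pull_zero]
    have e2 : pull α φ (pull α ψ w) = w := by
      have hs : IsClosed {w | pull α φ (pull α ψ w) = w} :=
        isClosed_eq ((continuous_pull α hcont _).comp (continuous_pull α hcont _)) continuous_id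
      refine closure_minimal ?_ hs hw
      rintro _ ⟨v, rfl⟩
      change pull α φ (pull α ψ (pull α (barD Γ 0 ∘ₗ φ) fun _ => v)) =
        pull α (barD Γ 0 ∘ₗ φ) fun _ => v
      rw [hψ', ← pull_comp]
    obtain ⟨b, hb⟩ := h1 _ e1
    refine ⟨b default, ?_⟩
    change pull α (barD Γ 0 ∘ₗ φ) (fun _ => b default) = w
    rw [← hconst b, pull_comp, hb, e2]
  obtain ⟨K, hK⟩ := (augmentationMap φ π).antilipschitz_of_injective_of_isClosed_range hinj hcl
  refine ⟨K + 1, by positivity, fun v => ?_⟩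
  have := hK.le_mul_dist v 0
  rw [dist_zero_right, map_zero, dist_zero_right] at this
  nlinarith [norm_nonneg (augmentationMap φ π v)]

theorem norm_augmentationMap_of_intertwiner [Fintype J] {V H : Type} [NormedAddCommGroup V]
    [InnerProductSpace ℂ V] [CompleteSpace V] [NormedAddCommGroup H] [InnerProductSpace ℂ H]
    [CompleteSpace H] (τ : Γ →* unitary (V →L[ℂ] V)) (π : Γ →* unitary (H →L[ℂ] H)) (s : H →L[ℂ] V)
    (hs : ∀ g, s ∘L unitaryHom π g = unitaryHom τ g ∘L s) (hn : ∀ x, ‖s x‖ = ‖x‖) (v : H) :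
    ‖augmentationMap φ π v‖ = ‖augmentationMap φ τ (s v)‖ := by
  have h (j : J) : s (augmentationMap φ π v j) = augmentationMap φ τ (s v) j :=
    pull_map (s : H →+ V) (map_repHom_unitaryRep π τ s hs) _ _ j
  refine le_antisymm ?_ ?_
  · refine (pi_norm_le_iff_of_nonneg (norm_nonneg _)).2 fun j => ?_
    rw [← hn, h]
    exact norm_le_pi_norm _ j
  · refine (pi_norm_le_iff_of_nonneg (norm_nonneg _)).2 fun j => ?_
    rw [← h, hn]
    exact norm_le_pi_norm _ j

/-- Property `(T_n)` bounds the norm of vectors orthogonal to the invariant vectors of any unitary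
representation. -/
theorem exists_norm_le_augmentationMap_orthogonal [Fintype J]
    (hψ : barD Γ 0 ∘ₗ φ ∘ₗ ψ = barD Γ 0) {n : ℕ} (hn : 0 < n) (hT : HasPropertyT Γ n)
    {V : Type} [NormedAddCommGroup V] [InnerProductSpace ℂ V] [CompleteSpace V]
    (τ : Γ →* unitary (V →L[ℂ] V)) :
    ∃ c : ℝ, 0 < c ∧ ∀ v : V, (∀ w, (∀ g, unitaryHom τ g w = w) → inner ℂ w v = 0) →
      ‖v‖ ≤ c * ‖augmentationMap φ τ v‖ := by
  let I : Submodule ℂ V :=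
    { carrier := {w | ∀ g, unitaryHom τ g w = w}
      add_mem' := fun ha hb g => by rw [map_add, ha, hb]
      zero_mem' := fun g => map_zero _
      smul_mem' := fun c a ha g => by rw [map_smul, ha] }
  have hIinv (g : Γ) (v : V) (hv : v ∈ Iᗮ) : unitaryHom τ g v ∈ Iᗮ := by
    intro w hw
    rw [← adjoint_inner_left, ← star_eq_adjoint, star_unitaryHom, hw]
    exact hv w hw
  obtain ⟨σ, hσ⟩ := exists_subrepresentation τ Iᗮ hIinv
  have hσ0 (v : Iᗮ) (hv : ∀ g : Γ, (σ g : Iᗮ →L[ℂ] Iᗮ) v = v) : v = 0 := by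
    have : (v : V) ∈ I := fun g =>
      (DFunLike.congr_fun (hσ g) v).symm.trans (congrArg Subtype.val (hv g))
    exact Subtype.ext (inner_self_eq_zero.1 (v.2 _ this))
  obtain ⟨c, hc, h⟩ := exists_norm_le_augmentationMap hψ σ hσ0 (hT _ σ hσ0 1 le_rfl hn)
  refine ⟨c, hc, fun v hv => ?_⟩
  have h1 := h ⟨v, fun w hw => hv w hw⟩
  rwa [norm_augmentationMap_of_intertwiner τ σ Iᗮ.subtypeL hσ fun _ => rfl] at h1

/-- The bound is uniform over all unitary representations on `BigHilbert Γ`, as one can consider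
them as subrepresentations of their direct sum. -/
theorem exists_uniform_norm_le_augmentationMap [Fintype J] (hψ : barD Γ 0 ∘ₗ φ ∘ₗ ψ = barD Γ 0)
    {n : ℕ} (hn : 0 < n) (hT : HasPropertyT Γ n) :
    ∃ c : ℝ, 0 < c ∧ ∀ (π : BigRep Γ) (v : BigHilbert Γ),
      (∀ w, (∀ g, (π g : BigOp Γ) w = w) → inner ℂ w v = 0) →
      ‖v‖ ≤ c * ‖augmentationMap φ π v‖ := by
  obtain ⟨τ, hτ⟩ := exists_directSum fun π : BigRep Γ => π
  obtain ⟨c, hc, h⟩ := exists_norm_le_augmentationMap_orthogonal hψ hn hT τ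
  refine ⟨c, hc, fun π v hv => ?_⟩
  classical
  let s : BigHilbert Γ →L[ℂ] lp (fun _ : BigRep Γ => BigHilbert Γ) 2 :=
    lp.singleContinuousLinearMap ℂ (fun _ : BigRep Γ => BigHilbert Γ) 2 π
  have hs (g : Γ) : s ∘L unitaryHom π g = unitaryHom τ g ∘L s := by
    refine ContinuousLinearMap.ext fun x => lp.ext (funext fun ρ => ?_)
    change (lp.single 2 π (unitaryHom π g x) : lp (fun _ : BigRep Γ => BigHilbert Γ) 2) ρ =
      unitaryHom τ g (lp.single 2 π x) ρ
    rw [hτ]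
    by_cases hρ : ρ = π
    · subst hρ
      rw [lp.single_apply_self, lp.single_apply_self]
    · rw [lp.single_apply_ne _ _ _ hρ, lp.single_apply_ne _ _ _ hρ, map_zero]
  have hn (x : BigHilbert Γ) : ‖s x‖ = ‖x‖ := lp.norm_single (by norm_num) _ _
  rw [norm_augmentationMap_of_intertwiner τ π s hs hn, ← hn v]
  refine h _ fun w hw => ?_
  change inner ℂ w (lp.single 2 π v) = 0
  rw [lp.inner_single_right]
  refine hv _ fun g => ?_
  have := congrArg (fun f : lp (fun _ : BigRep Γ => BigHilbert Γ) 2 => f π) (hw g)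
  rwa [hτ] at this

end Bound

end Kazhdan

/-! ### Closed ranges from lower bounds -/

section LowerBound

theorem isClosed_image_mulVec_of_norm_le {B X Y : Type} [CStarAlgebra B] [Fintype X] [Fintype Y]
    {A : NonUnitalStarSubalgebra ℂ B} (hA : IsClosed (A : Set B)) (D : Matrix Y X B) {c : ℝ}
    (hc : 0 < c) (h : ∀ a : X → B, (∀ i, a i ∈ A) → ∀ i, ‖a i‖ ≤ c * ‖D.mulVec a‖) :
    IsClosed (D.mulVec '' {a : X → B | ∀ i, a i ∈ A}) := by
  have hs : IsClosed {a : X → B | ∀ i, a i ∈ A} := by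
    simp only [Set.ofPred_forall]
    exact isClosed_iInter fun i => hA.preimage (continuous_apply i)
  have : CompleteSpace {a : X → B | ∀ i, a i ∈ A} := hs.completeSpace_coe
  rw [← Set.range_domRestrict]
  let L : (X → B) →L[ℂ] (Y → B) :=
    { toFun := D.mulVec
      map_add' := D.mulVec_add
      map_smul' := fun t a => D.mulVec_smul t a
      cont := Continuous.matrix_mulVec continuous_const continuous_id }
  refine AntilipschitzWith.isClosed_range (K := ⟨c, hc.le⟩) (f := Set.domRestrict _ D.mulVec) ?_
    (L.uniformContinuous.comp uniformContinuous_subtype_val)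
  refine AntilipschitzWith.of_le_mul_dist fun a b => ?_
  rw [Subtype.dist_eq, dist_eq_norm, dist_eq_norm]
  refine (pi_norm_le_iff_of_nonneg (mul_nonneg hc.le (norm_nonneg _))).2 fun i => ?_
  refine (h _ (fun i => sub_mem (a.2 i) (b.2 i)) i).trans (le_of_eq ?_)
  exact congrArg (c * ‖·‖) (D.mulVec_sub a.1 b.1)

end LowerBound

section Aug

variable {Γ : Type} [Group Γ]

theorem BoundedFamily.norm_app_le (T : BoundedFamily Γ) (π : BigRep Γ) : ‖T.app π‖ ≤ ‖T‖ :=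
  lp.norm_apply_le_norm ENNReal.top_ne_zero (E := fun _ : BigRep Γ => BigOp Γ) T π

theorem BoundedFamily.norm_le_of_forall {T : BoundedFamily Γ} {c : ℝ} (hc : 0 ≤ c)
    (h : ∀ π, ‖T.app π‖ ≤ c) : ‖T‖ ≤ c :=
  lp.norm_le_of_forall_le (E := fun _ : BigRep Γ => BigOp Γ) (f := T) hc h

theorem BoundedFamily.continuous_app (π : BigRep Γ) :
    Continuous fun T : BoundedFamily Γ => T.app π :=
  AddMonoidHomClass.continuous_of_bound (appHom π) 1 fun T => by
    rw [one_mul]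
    exact T.norm_app_le π

theorem cstar_le_wstar : CStar Γ ≤ WStar Γ := by
  refine StarSubalgebra.topologicalClosure_minimal (StarAlgebra.adjoin_le ?_) ?_
  · rintro _ ⟨g, rfl⟩ π σ S hS
    exact hS g
  · have : (WStar Γ : Set (BoundedFamily Γ)) = ⋂ (π : BigRep Γ) (σ : BigRep Γ) (S : BigOp Γ)
        (_ : ∀ g : Γ, S * (π g : BigOp Γ) = (σ g : BigOp Γ) * S),
        {T | S * T.app π = T.app σ * S} := by
      ext T
      simp only [Set.mem_iInter]
      rfl
    rw [this]
    refine isClosed_iInter fun π => isClosed_iInter fun σ => isClosed_iInter fun S =>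
      isClosed_iInter fun _ => isClosed_eq ?_ ?_
    · exact continuous_const.mul (BoundedFamily.continuous_app π)
    · exact (BoundedFamily.continuous_app σ).mul continuous_const

theorem cstarAug_le_wstarAug : CStarAug Γ ≤ WStarAug Γ :=
  fun _ hT => ⟨cstar_le_wstar hT.1, hT.2⟩

theorem isClosed_cstar : IsClosed ((CStar Γ).toNonUnitalStarSubalgebra : Set (BoundedFamily Γ)) :=
  StarSubalgebra.isClosed_topologicalClosure _

theorem isClosed_cstarAug : IsClosed (CStarAug Γ : Set (BoundedFamily Γ)) :=
  isClosed_cstar.inter (isClosed_eq (BoundedFamily.continuous_app 1) continuous_const)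

theorem app_mulVec_apply {X Y : Type} [Fintype Y] (N : Matrix X Y (BoundedFamily Γ))
    (a : Y → BoundedFamily Γ) (π : BigRep Γ) (v : BigHilbert Γ) (x : X) :
    (N.mulVec a x).app π v = actVec (appHom π) N (fun y => (a y).app π v) x := by
  change appHom π (∑ y, N x y * a y) v = _
  rw [map_sum, sum_apply]
  refine Finset.sum_congr rfl fun y _ => ?_
  rw [map_mul]
  rfl

/-- Property `(T_n)` gives a unit of `C*₀Γ`, the complement of the Kazhdan projection. It lies in
the left ideal generated by the augmentation ideal of the group ring, so it annihilates invariant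
vectors in every representation of the bounded families, which need not be normal. -/
theorem exists_invariant_of_hasPropertyT {m : ℕ} (M : FiniteModel Γ m) (hm : 1 ≤ m) {n : ℕ}
    (hn : 0 < n) (hT : HasPropertyT Γ n) :
    ∃ e ∈ CStarAug Γ, (∀ g, groupElt g * (1 - e) = 1 - e) ∧
      ∀ (H : Type) [NormedAddCommGroup H] [InnerProductSpace ℂ H] [CompleteSpace H]
        (θ : BoundedFamily Γ →⋆ₐ[ℂ] (H →L[ℂ] H)) (w : H), (∀ g, θ (groupElt g) w = w) →
        θ e w = 0 := by
  obtain ⟨J, hJ, φ, ψ, hψ⟩ := M.exists_augmentation_generators hm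
  let _ := Fintype.ofFinite J
  let _ : Fintype (Fin 0 → Γ) := Fintype.ofSubsingleton default
  obtain ⟨c, hc, h⟩ := exists_uniform_norm_le_augmentationMap hψ hn hT
  have hE := entriesIn_toMatrix_barD_zero_comp (le_refl (CStarAug Γ)) φ
  obtain ⟨G, hG, hGE⟩ := exists_matrix_mul_mul_eq_self isClosed_cstarAug hE
    (isClosed_image_mulVec_of_norm_le isClosed_cstarAug _ hc fun a ha i => by
      refine BoundedFamily.norm_le_of_forall (by positivity) fun π => ?_
      refine ContinuousLinearMap.opNorm_le_bound _ (by positivity) fun v => ?_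
      refine (h π ((a i).app π v) fun w hw => ?_).trans ?_
      · have h1 : (star (a i)).app π w = 0 :=
          app_apply_eq_zero_of_invariant (cstarAug_le_wstarAug (star_mem (ha i))) π hw
        have h2 : ContinuousLinearMap.adjoint ((a i).app π) w = 0 := h1
        rw [← ContinuousLinearMap.adjoint_inner_left, h2, inner_zero_left]
      · rw [mul_assoc]
        refine mul_le_mul_of_nonneg_left ?_ hc.le
        refine (pi_norm_le_iff_of_nonneg (by positivity)).2 fun j => ?_
        have h3 : augmentationMap φ π ((a i).app π v) j =
            ((toMatrix (groupEltHom Γ) (barD Γ 0 ∘ₗ φ)).mulVec a j).app π v := by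
          rw [app_mulVec_apply, actVec_toMatrix (π := π) (appHom π) fun g => rfl,
            Subsingleton.elim i default]
          refine congrArg (fun b => pull _ _ b j) (funext fun y => ?_)
          rw [Subsingleton.elim y default]
        rw [h3]
        refine (ContinuousLinearMap.le_opNorm _ _).trans ?_
        refine mul_le_mul_of_nonneg_right ?_ (norm_nonneg _)
        exact (BoundedFamily.norm_app_le _ _).trans (norm_le_pi_norm _ j))
  obtain ⟨e, he, hee, hinv⟩ := exists_invariant_of_mul_mul le_rfl hψ hG hGE
  refine ⟨e, he, hinv, fun H _ _ _ θ w hw => ?_⟩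
  let π : Γ →* unitary (H →L[ℂ] H) := unitaryOfStar ((θ : BoundedFamily Γ →* (H →L[ℂ] H)).comp
    (groupEltHom Γ)) fun g => by
      change star (θ (groupElt g)) = θ (groupElt g⁻¹)
      rw [← map_star, star_groupElt]
  have h0 : actVec θ (toMatrix (groupEltHom Γ) (barD Γ 0 ∘ₗ φ)) (fun _ => w) = 0 := by
    rw [actVec_toMatrix (π := π) θ fun g => rfl, pull_comp]
    have : pull (repHom (unitaryRep π)) (barD Γ 0) (fun _ => w) = 0 := by
      funext x
      rw [pull_barD_zero_apply]
      exact sub_eq_zero.2 (hw _)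
    rw [this, map_zero]
  have h1 : actVec θ (G * toMatrix (groupEltHom Γ) (barD Γ 0 ∘ₗ φ)) (fun _ => w) default = 0 := by
    rw [actVec_mul, h0, actVec_zero_right]
    rfl
  rw [actVec, Fintype.sum_subsingleton _ default, ← hee] at h1
  exact h1

end Aug

/-! ### Limits of representations along an ultrafilter -/

section Ultralimit

open Filter Topology
open scoped ComplexOrder

/-- The limit of a bounded sequence along a fixed nonprincipal ultrafilter. -/
def ultralim (a : ℕ → ℂ) : ℂ := limUnder (hyperfilter ℕ : Filter ℕ) a

theorem tendsto_ultralim {a : ℕ → ℂ} {C : ℝ} (h : ∀ j, ‖a j‖ ≤ C) :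
    Tendsto a (hyperfilter ℕ) (𝓝 (ultralim a)) := by
  obtain ⟨x, -, hx⟩ := (isCompact_closedBall (0 : ℂ) C).ultrafilter_le_nhds
    ((hyperfilter ℕ).map a) (by
      rw [le_principal_iff, Ultrafilter.coe_map, mem_map]
      exact univ_mem' fun j => by simpa using h j)
  exact tendsto_nhds_limUnder ⟨x, hx⟩

variable {K : Type} [NormedAddCommGroup K] [InnerProductSpace ℂ K] [CompleteSpace K] [Nontrivial K]

/-- The C*-algebra of bounded sequences of operators on a Hilbert space. -/
def BoundedSeq (K : Type) [NormedAddCommGroup K] [InnerProductSpace ℂ K] : Type :=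
  lp (fun _ : ℕ => K →L[ℂ] K) ⊤

instance : NormedRing (BoundedSeq K) :=
  inferInstanceAs (NormedRing (lp (fun _ : ℕ => K →L[ℂ] K) ⊤))

instance : StarRing (BoundedSeq K) :=
  inferInstanceAs (StarRing (lp (fun _ : ℕ => K →L[ℂ] K) ⊤))

instance : CompleteSpace (BoundedSeq K) :=
  inferInstanceAs (CompleteSpace (lp (fun _ : ℕ => K →L[ℂ] K) ⊤))

instance : CStarRing (BoundedSeq K) :=
  inferInstanceAs (CStarRing (lp (fun _ : ℕ => K →L[ℂ] K) ⊤))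

instance : NormedAlgebra ℂ (BoundedSeq K) :=
  inferInstanceAs (NormedAlgebra ℂ (lp (fun _ : ℕ => K →L[ℂ] K) ⊤))

instance : StarModule ℂ (BoundedSeq K) :=
  inferInstanceAs (StarModule ℂ (lp (fun _ : ℕ => K →L[ℂ] K) ⊤))

instance : CStarAlgebra (BoundedSeq K) where

/-- The operator in position `j` of a sequence. -/
def BoundedSeq.app (j : ℕ) : BoundedSeq K →⋆ₐ[ℂ] (K →L[ℂ] K) where
  toFun T := T.val j
  map_one' := rfl
  map_mul' _ _ := rfl
  map_zero' := rfl
  map_add' _ _ := rfl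
  commutes' _ := rfl
  map_star' _ := rfl

/-- A *-homomorphism to the bounded sequences of operators. -/
def starHomToSeq {B : Type} [CStarAlgebra B] (θ : ℕ → B →⋆ₐ[ℂ] (K →L[ℂ] K)) :
    B →⋆ₐ[ℂ] BoundedSeq K where
  toFun b := ⟨fun j => θ j b, memℓp_infty ⟨‖b‖, by
    rintro _ ⟨j, rfl⟩
    exact NonUnitalStarAlgHom.norm_apply_le (θ j) b⟩⟩
  map_one' := Subtype.ext (funext fun j => map_one (θ j))
  map_mul' a b := Subtype.ext (funext fun j => map_mul (θ j) a b)
  map_zero' := Subtype.ext (funext fun j => map_zero (θ j))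
  map_add' a b := Subtype.ext (funext fun j => map_add (θ j) a b)
  commutes' r := Subtype.ext (funext fun j => AlgHomClass.commutes (θ j) r)
  map_star' a := Subtype.ext (funext fun j => map_star (θ j) a)

theorem tendsto_vectorFunctional (u : K) (T : BoundedSeq K) :
    Tendsto (fun j => inner ℂ u (BoundedSeq.app j T u)) (hyperfilter ℕ)
      (𝓝 (ultralim fun j => inner ℂ u (BoundedSeq.app j T u))) := by
  refine tendsto_ultralim (C := ‖u‖ * (‖T‖ * ‖u‖)) fun j => (norm_inner_le_norm _ _).trans ?_
  gcongr
  refine (ContinuousLinearMap.le_opNorm _ _).trans ?_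
  gcongr
  exact NonUnitalStarAlgHom.norm_apply_le (BoundedSeq.app j) T

/-- The limit of the vector functionals of `u`. -/
def vectorFunctional (u : K) : BoundedSeq K →ₗ[ℂ] ℂ where
  toFun T := ultralim fun j => inner ℂ u (BoundedSeq.app j T u)
  map_add' S T := by
    refine tendsto_nhds_unique (tendsto_vectorFunctional u (S + T)) ?_
    refine ((tendsto_vectorFunctional u S).add (tendsto_vectorFunctional u T)).congr fun j => ?_
    rw [← inner_add_right]
    rfl
  map_smul' c T := by
    refine tendsto_nhds_unique (tendsto_vectorFunctional u (c • T)) ?_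
    refine ((tendsto_vectorFunctional u T).const_mul c).congr fun j => ?_
    rw [← inner_smul_right]
    rfl

theorem vectorFunctional_star_mul_self (u : K) (T : BoundedSeq K) :
    Tendsto (fun j => ((‖BoundedSeq.app j T u‖ ^ 2 : ℝ) : ℂ)) (hyperfilter ℕ)
      (𝓝 (vectorFunctional u (star T * T))) := by
  refine (tendsto_vectorFunctional u (star T * T)).congr fun j => ?_
  change inner ℂ u (ContinuousLinearMap.adjoint (BoundedSeq.app j T) (BoundedSeq.app j T u)) = _
  rw [ContinuousLinearMap.adjoint_inner_right, inner_self_eq_norm_sq_to_K]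
  simp

/-- Given representations of a C*-algebra on `K` and bounded sequences of vectors, there are a
representation and vectors in it whose norms are limits of the norms in the given sequences: the GNS
representation of a limit of vector states on the bounded sequences of operators, where a
sequence of vectors is represented by a sequence of operators of rank one. -/
theorem exists_limit_representation {B X : Type} [CStarAlgebra B] [Fintype X]
    (θ : ℕ → B →⋆ₐ[ℂ] (K →L[ℂ] K)) (v : ℕ → X → K) (hv : ∀ j x, ‖v j x‖ ≤ 1) :
    ∃ (H : Type) (_ : NormedAddCommGroup H) (_ : InnerProductSpace ℂ H) (_ : CompleteSpace H)
      (θ' : B →⋆ₐ[ℂ] (H →L[ℂ] H)) (ξ : X → H), ∀ b : X → B,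
      Tendsto (fun j => ‖∑ x, θ j (b x) (v j x)‖ ^ 2) (hyperfilter ℕ)
        (𝓝 (‖∑ x, θ' (b x) (ξ x)‖ ^ 2)) := by
  obtain ⟨u, hu⟩ := exists_norm_eq K zero_le_one
  let _ : PartialOrder (BoundedSeq K) := CStarAlgebra.spectralOrder _
  have : StarOrderedRing (BoundedSeq K) := CStarAlgebra.spectralOrderedRing _
  let f : BoundedSeq K →ₚ[ℂ] ℂ := PositiveLinearMap.mk₀ (vectorFunctional u) (by
    intro a ha
    obtain ⟨T, rfl⟩ := CStarAlgebra.nonneg_iff_eq_star_mul_self.1 ha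
    exact ge_of_tendsto' (vectorFunctional_star_mul_self u T) fun j =>
      Complex.zero_le_real.2 (sq_nonneg _))
  let R (x : X) : BoundedSeq K :=
    ⟨fun j => InnerProductSpace.rankOne ℂ (v j x) u, memℓp_infty ⟨1, by
      rintro _ ⟨j, rfl⟩
      simpa [hu] using hv j x⟩⟩
  refine ⟨f.GNS, inferInstance, inferInstance, inferInstance,
    f.gnsStarAlgHom.comp (starHomToSeq θ), fun x => (f.toPreGNS (R x) : f.GNS), fun b => ?_⟩
  let S : BoundedSeq K := ∑ x, starHomToSeq θ (b x) * R x
  have hS : ∑ x, (f.gnsStarAlgHom.comp (starHomToSeq θ)) (b x) (f.toPreGNS (R x) : f.GNS) =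
      (f.toPreGNS S : f.GNS) := by
    have h1 (x : X) : (f.gnsStarAlgHom.comp (starHomToSeq θ)) (b x) (f.toPreGNS (R x) : f.GNS) =
        (f.toPreGNS (starHomToSeq θ (b x) * R x) : f.GNS) :=
      f.gnsNonUnitalStarAlgHom_apply_coe
    simp only [h1]
    rw [map_sum]
    exact (map_sum (UniformSpace.Completion.toComplL : f.PreGNS →L[ℂ] f.GNS) _ _).symm
  have hSj (j : ℕ) : BoundedSeq.app j S u = ∑ x, θ j (b x) (v j x) := by
    rw [map_sum, sum_apply]
    refine Finset.sum_congr rfl fun x _ => ?_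
    rw [map_mul]
    change θ j (b x) (InnerProductSpace.rankOne ℂ (v j x) u u) = _
    rw [InnerProductSpace.rankOne_apply, inner_self_eq_norm_sq_to_K, hu]
    simp
  rw [hS, UniformSpace.Completion.norm_coe]
  have h1 := vectorFunctional_star_mul_self u S
  have h2 := f.preGNS_norm_sq (f.toPreGNS S)
  rw [show vectorFunctional u (star S * S) = ((‖f.toPreGNS S‖ ^ 2 : ℝ) : ℂ) by
    rw [Complex.ofReal_pow]; exact h2.symm] at h1
  have h3 := (Complex.continuous_re.tendsto _).comp h1
  refine h3.congr fun j => ?_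
  rw [← hSj]
  exact Complex.ofReal_re _

end Ultralimit

/-! ### The Laplacian of the finite model -/

namespace FiniteModel

open ContinuousLinearMap

variable {Γ : Type} [Group Γ] {m : ℕ} (M : FiniteModel Γ m)

section Def

variable {B : Type} [CStarAlgebra B] (u : Γ →* B) (k : ℕ) [Fintype (M.X k)] [Fintype (M.X (k + 1))]
  [Fintype (M.X (k + 2))] [DecidableEq (M.X (k + 1))]

/-- The Laplacian in degree `k + 1`. The middle term makes it positive on the kernel of the
idempotent `q`, which is not part of the resolution. -/
def laplacian : Matrix (M.X (k + 1)) (M.X (k + 1)) B :=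
  (toMatrix u (M.d (k + 1))).conjTranspose * toMatrix u (M.d (k + 1)) +
    (1 - toMatrix u (M.q (k + 1))).conjTranspose * (1 - toMatrix u (M.q (k + 1))) +
    toMatrix u (M.d k) * (toMatrix u (M.d k)).conjTranspose

theorem conjTranspose_laplacian : (M.laplacian u k).conjTranspose = M.laplacian u k := by
  simp [laplacian, Matrix.conjTranspose_mul]

theorem laplacian_mul_q : M.laplacian u k * toMatrix u (M.q (k + 1)) =
    (toMatrix u (M.d (k + 1))).conjTranspose * toMatrix u (M.d (k + 1)) +
      toMatrix u (M.d k) * (toMatrix u (M.d k)).conjTranspose * toMatrix u (M.q (k + 1)) := by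
  have h : (1 - toMatrix u (M.q (k + 1))) * toMatrix u (M.q (k + 1)) = 0 := by
    rw [Matrix.sub_mul, Matrix.one_mul, toMatrix_q_mul_q, sub_self]
  rw [laplacian, Matrix.add_mul, Matrix.add_mul, Matrix.mul_assoc, toMatrix_d_mul_q,
    Matrix.mul_assoc _ (1 - _), h, Matrix.mul_zero, add_zero]

theorem laplacian_mul_d : M.laplacian u k * toMatrix u (M.d k) =
    toMatrix u (M.d k) * (toMatrix u (M.d k)).conjTranspose * toMatrix u (M.d k) := by
  have h : (1 - toMatrix u (M.q (k + 1))) * toMatrix u (M.d k) = 0 := by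
    rw [Matrix.sub_mul, Matrix.one_mul, toMatrix_q_mul_d, sub_self]
  rw [laplacian, Matrix.add_mul, Matrix.add_mul, Matrix.mul_assoc, toMatrix_d_mul_d,
    Matrix.mul_assoc _ (1 - _), h, Matrix.mul_zero, Matrix.mul_zero, add_zero, zero_add]

/-- The Laplacian commutes with its last summand. -/
theorem laplacian_commute :
    M.laplacian u k * (toMatrix u (M.d k) * (toMatrix u (M.d k)).conjTranspose) =
    toMatrix u (M.d k) * (toMatrix u (M.d k)).conjTranspose * M.laplacian u k := by
  have h : M.laplacian u k * (toMatrix u (M.d k) * (toMatrix u (M.d k)).conjTranspose) =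
      toMatrix u (M.d k) * (toMatrix u (M.d k)).conjTranspose *
        (toMatrix u (M.d k) * (toMatrix u (M.d k)).conjTranspose) := by
    rw [← Matrix.mul_assoc, laplacian_mul_d, Matrix.mul_assoc]
  have h' := congrArg Matrix.conjTranspose h
  simp only [Matrix.conjTranspose_mul, Matrix.conjTranspose_conjTranspose,
    conjTranspose_laplacian] at h'
  rw [h, h']

end Def

section Kernel

variable {B : Type} [CStarAlgebra B] {H : Type} [NormedAddCommGroup H] [InnerProductSpace ℂ H]
  [CompleteSpace H] (θ : B →⋆ₐ[ℂ] (H →L[ℂ] H))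

theorem sum_inner_actVec {X Y : Type} [Fintype X] [Fintype Y] (N : Matrix X Y B) (ξ : Y → H)
    (ζ : X → H) :
    ∑ y, inner ℂ (ξ y) (actVec θ N.conjTranspose ζ y) = ∑ x, inner ℂ (actVec θ N ξ x) (ζ x) := by
  simp only [actVec, inner_sum, sum_inner]
  rw [Finset.sum_comm]
  refine Finset.sum_congr rfl fun x _ => Finset.sum_congr rfl fun y _ => ?_
  rw [Matrix.conjTranspose_apply, map_star, star_eq_adjoint, adjoint_inner_right]

theorem sum_inner_actVec_mul_self {X Y : Type} [Fintype X] [Fintype Y] (N : Matrix X Y B)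
    (ξ : Y → H) : ∑ y, inner ℂ (ξ y) (actVec θ (N.conjTranspose * N) ξ y) =
      ((∑ x, ‖actVec θ N ξ x‖ ^ 2 : ℝ) : ℂ) := by
  rw [actVec_mul, sum_inner_actVec]
  simp [inner_self_eq_norm_sq_to_K]

theorem actVec_one {X : Type} [Fintype X] [DecidableEq X] (ξ : X → H) :
    actVec θ (1 : Matrix X X B) ξ = ξ := by
  funext x
  rw [actVec, Finset.sum_eq_single x]
  · simp
  · intro y _ hy
    simp [Matrix.one_apply_ne hy.symm]
  · simp

variable (u : Γ →* B) (k : ℕ) [Fintype (M.X k)] [Fintype (M.X (k + 1))]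
  [Fintype (M.X (k + 2))] [DecidableEq (M.X (k + 1))]

/-- The Laplacian is a sum of three positive operators, so its kernel is the intersection of their
kernels. -/
theorem actVec_eq_zero_of_laplacian {ξ : M.X (k + 1) → H}
    (h : actVec θ (M.laplacian u k) ξ = 0) :
    actVec θ (toMatrix u (M.d (k + 1))) ξ = 0 ∧ actVec θ (toMatrix u (M.q (k + 1))) ξ = ξ ∧
      actVec θ (toMatrix u (M.d k)).conjTranspose ξ = 0 := by
  have h1 : ∑ x, inner ℂ (ξ x) (actVec θ (M.laplacian u k) ξ x) = 0 := by simp [h]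
  have h2 := sum_inner_actVec_mul_self θ (toMatrix u (M.d k)).conjTranspose ξ
  rw [Matrix.conjTranspose_conjTranspose] at h2
  simp only [laplacian, actVec_add, Pi.add_apply, inner_add_right, Finset.sum_add_distrib, h2,
    sum_inner_actVec_mul_self] at h1
  rw [← Complex.ofReal_add, ← Complex.ofReal_add, Complex.ofReal_eq_zero] at h1
  have hnn {Y : Type} [Fintype Y] (f : Y → H) : 0 ≤ ∑ y, ‖f y‖ ^ 2 :=
    Finset.sum_nonneg fun _ _ => sq_nonneg _
  have h0 {Y : Type} [Fintype Y] {f : Y → H} (hf : ∑ y, ‖f y‖ ^ 2 = 0) : f = 0 := by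
    funext y
    have := (Finset.sum_eq_zero_iff_of_nonneg fun y _ => sq_nonneg ‖f y‖).1 hf y (Finset.mem_univ y)
    simpa using this
  have a1 := hnn (actVec θ (toMatrix u (M.d (k + 1))) ξ)
  have a2 := hnn (actVec θ (1 - toMatrix u (M.q (k + 1))) ξ)
  have a3 := hnn (actVec θ (toMatrix u (M.d k)).conjTranspose ξ)
  refine ⟨h0 (by linarith), ?_, h0 (by linarith)⟩
  have h3 : actVec θ (1 - toMatrix u (M.q (k + 1))) ξ = 0 := h0 (by linarith)
  have h4 : actVec θ (1 - toMatrix u (M.q (k + 1)) + toMatrix u (M.q (k + 1))) ξ = ξ := by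
    rw [sub_add_cancel, actVec_one]
  rwa [actVec_add, h3, zero_add] at h4

end Kernel

section Bound

variable {M} {k : ℕ} [Fintype (M.X k)] [Fintype (M.X (k + 1))]
  [Fintype (M.X (k + 2))] [DecidableEq (M.X (k + 1))]
  {C : NonUnitalStarSubalgebra ℂ (BoundedFamily Γ)} {e : BoundedFamily Γ}

/-- Vanishing of the cohomology of unitary representations (without invariant vectors, unless
`e = 1`) makes the Laplacian injective on the range of `e` in any representation of the bounded
families. -/
theorem eq_zero_of_laplacian_eq_zero (he : IsUnitOf (groupEltHom Γ) C e)
    (hkill : e = 1 ∨ ∀ (H : Type) [NormedAddCommGroup H] [InnerProductSpace ℂ H] [CompleteSpace H]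
      (θ : BoundedFamily Γ →⋆ₐ[ℂ] (H →L[ℂ] H)) (w : H), (∀ g, θ (groupElt g) w = w) → θ e w = 0)
    (hex : ∀ (V : Type) [NormedAddCommGroup V] [InnerProductSpace ℂ V] [CompleteSpace V]
      (π : Γ →* unitary (V →L[ℂ] V)),
      (e = 1 ∨ ∀ v : V, (∀ g : Γ, (π g : V →L[ℂ] V) v = v) → v = 0) →
      M.CochainExact (repHom (unitaryRep π)) k)
    {H : Type} [NormedAddCommGroup H] [InnerProductSpace ℂ H] [CompleteSpace H]
    (θ : BoundedFamily Γ →⋆ₐ[ℂ] (H →L[ℂ] H)) {ξ : M.X (k + 1) → H}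
    (hξ : ∀ x, θ e (ξ x) = ξ x) (h : actVec θ (M.laplacian (groupEltHom Γ) k) ξ = 0) : ξ = 0 := by
  obtain ⟨hd, hq, hd'⟩ := M.actVec_eq_zero_of_laplacian θ _ k h
  let π : Γ →* unitary (H →L[ℂ] H) := unitaryOfStar ((θ : BoundedFamily Γ →* (H →L[ℂ] H)).comp
    (groupEltHom Γ)) fun g => by
      change star (θ (groupElt g)) = θ (groupElt g⁻¹)
      rw [← map_star, star_groupElt]
  let W : Submodule ℂ H :=
    { carrier := {w | θ e w = w}
      add_mem' := fun {a b} ha hb => by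
        rw [Set.mem_ofPred_eq] at *
        rw [map_add, ha, hb]
      zero_mem' := map_zero _
      smul_mem' := fun c a ha => by
        rw [Set.mem_ofPred_eq] at *
        rw [map_smul, ha] }
  have hW : IsClosed (W : Set H) := isClosed_eq (θ e).continuous continuous_id
  have : CompleteSpace W := hW.completeSpace_coe
  have hinv (g : Γ) (w : H) (hw : w ∈ W) : unitaryHom π g w ∈ W := by
    change θ e (θ (groupElt g) w) = θ (groupElt g) w
    have hc := he.commute (MonoidAlgebra.single g 1)
    rw [groupRingHom_single] at hc
    simp only [Rat.cast_one, one_smul] at hc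
    have h1 := DFunLike.congr_fun (congrArg θ hc) w
    rw [map_mul, map_mul] at h1
    refine h1.trans ?_
    change θ (groupElt g) (θ e w) = _
    rw [show θ e w = w from hw]
  obtain ⟨σ, hσ⟩ := exists_subrepresentation π W hinv
  have hσ0 : e = 1 ∨ ∀ v : W, (∀ g : Γ, (σ g : W →L[ℂ] W) v = v) → v = 0 := by
    refine hkill.imp_right fun hk v hv => Subtype.ext ?_
    have h1 : θ e v = v := v.2
    rw [← h1]
    exact hk H θ v fun g =>
      (DFunLike.congr_fun (hσ g) v).symm.trans (congrArg Subtype.val (hv g))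
  let ξ' : M.X (k + 1) → W := fun x => ⟨ξ x, hξ x⟩
  have hpull {X Y : Type} [Fintype Y] (φ : FreeMod Γ X →ₗ[MonoidAlgebra ℚ Γ] FreeMod Γ Y)
      (c : Y → W) (x : X) : (pull (repHom (unitaryRep σ)) φ c x : H) =
        actVec θ (toMatrix (groupEltHom Γ) φ) (fun y => (c y : H)) x := by
    rw [actVec_toMatrix (π := π) θ fun g => rfl]
    exact pull_map (W.subtypeL : W →+ H) (map_repHom_unitaryRep σ π W.subtypeL hσ) φ c x
  obtain ⟨b, hb⟩ := hex W σ hσ0 ξ'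
    (funext fun x => Subtype.ext ((hpull _ _ x).trans (congrFun hq x)))
    (funext fun x => Subtype.ext ((hpull _ _ x).trans (congrFun hd x)))
  have hb' : actVec θ (toMatrix (groupEltHom Γ) (M.d k)) (fun y => (b y : H)) = ξ :=
    funext fun x => (hpull _ _ x).symm.trans (congrArg Subtype.val (congrFun hb x))
  have h1 := sum_inner_actVec θ (toMatrix (groupEltHom Γ) (M.d k)) (fun y => (b y : H)) ξ
  rw [hb', hd'] at h1
  simp only [Pi.zero_apply, inner_zero_right, Finset.sum_const_zero, inner_self_eq_norm_sq_to_K]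
    at h1
  have h2 : ∑ x, ‖ξ x‖ ^ 2 = 0 := by
    refine Complex.ofReal_eq_zero.1 ?_
    rw [Complex.ofReal_sum]
    simpa using h1.symm
  funext x
  have := (Finset.sum_eq_zero_iff_of_nonneg fun y _ => sq_nonneg ‖ξ y‖).1 h2 x (Finset.mem_univ x)
  simpa using this

open Filter Topology in
/-- The Laplacian is bounded below on the range of `e`, uniformly in the representation: otherwise
there is a sequence of unit vectors on which it tends to zero, and a limit of the
representations along an ultrafilter has a nonzero vector in its kernel. -/
theorem exists_norm_le_laplacian (he : IsUnitOf (groupEltHom Γ) C e)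
    (hkill : e = 1 ∨ ∀ (H : Type) [NormedAddCommGroup H] [InnerProductSpace ℂ H] [CompleteSpace H]
      (θ : BoundedFamily Γ →⋆ₐ[ℂ] (H →L[ℂ] H)) (w : H), (∀ g, θ (groupElt g) w = w) → θ e w = 0)
    (hex : ∀ (V : Type) [NormedAddCommGroup V] [InnerProductSpace ℂ V] [CompleteSpace V]
      (π : Γ →* unitary (V →L[ℂ] V)),
      (e = 1 ∨ ∀ v : V, (∀ g : Γ, (π g : V →L[ℂ] V) v = v) → v = 0) →
      M.CochainExact (repHom (unitaryRep π)) k) :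
    ∃ c : ℝ, 0 < c ∧ ∀ (σ : BigRep Γ) (v : M.X (k + 1) → BigHilbert Γ),
      (∀ x, appHom σ e (v x) = v x) →
      ‖v‖ ≤ c * ‖actVec (appHom σ) (M.laplacian (groupEltHom Γ) k) v‖ := by
  by_contra! hcon
  choose σ v hv hlt using fun j : ℕ => hcon ((j : ℝ) + 1) (by positivity)
  have hpos (j : ℕ) : 0 < ‖v j‖ := (by positivity : (0 : ℝ) ≤ _).trans_lt (hlt j)
  -- unit vectors on which the Laplacian has norm at most `1 / (j + 1)`
  let w (j : ℕ) : M.X (k + 1) → BigHilbert Γ := ((‖v j‖⁻¹ : ℝ) : ℂ) • v j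
  have hw1 (j : ℕ) : ‖w j‖ = 1 := by
    simp only [w, norm_smul, Complex.norm_real, norm_inv, norm_norm]
    exact inv_mul_cancel₀ (hpos j).ne'
  have hact {X Y : Type} [Fintype Y] (θ : BoundedFamily Γ →⋆ₐ[ℂ] BigOp Γ)
      (N : Matrix X Y (BoundedFamily Γ)) (c : ℂ) (z : Y → BigHilbert Γ) :
      actVec θ N (c • z) = c • actVec θ N z := by
    funext x
    simp [actVec, Finset.smul_sum]
  have hlap (j : ℕ) : ‖actVec (appHom (σ j)) (M.laplacian (groupEltHom Γ) k) (w j)‖ ≤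
      1 / ((j : ℝ) + 1) := by
    rw [hact, norm_smul, Complex.norm_real, norm_inv, norm_norm, inv_mul_le_iff₀ (hpos j),
      mul_one_div, le_div_iff₀ (by positivity), mul_comm]
    exact (hlt j).le
  obtain ⟨H, _, _, _, θ, ξ, hlim⟩ := exists_limit_representation (fun j => appHom (σ j)) w
    fun j x => (norm_le_pi_norm (w j) x).trans (hw1 j).le
  have hzero (N : Matrix (M.X (k + 1)) (M.X (k + 1)) (BoundedFamily Γ))
      (hN : ∀ x, Tendsto (fun j => ‖actVec (appHom (σ j)) N (w j) x‖ ^ 2) (hyperfilter ℕ) (𝓝 0)) :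
      actVec θ N ξ = 0 := by
    funext x
    have : ‖actVec θ N ξ x‖ ^ 2 = 0 := tendsto_nhds_unique (hlim (N x)) (hN x)
    exact norm_eq_zero.1 (pow_eq_zero_iff two_ne_zero |>.1 this)
  have h1 : actVec θ (M.laplacian (groupEltHom Γ) k) ξ = 0 := by
    refine hzero _ fun x => ?_
    have h2 : Tendsto (fun j : ℕ => 1 / ((j : ℝ) + 1)) (hyperfilter ℕ) (𝓝 0) :=
      tendsto_one_div_add_atTop_nhds_zero_nat.mono_left Nat.hyperfilter_le_atTop
    have h3 := squeeze_zero (fun j => norm_nonneg _)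
      (fun j => (norm_le_pi_norm _ x).trans (hlap j)) h2
    simpa using h3.pow 2
  have h2 (x : M.X (k + 1)) : θ e (ξ x) = ξ x := by
    have h3 := hzero ((e - 1) • 1) fun x => by
      refine tendsto_const_nhds.congr fun j => ?_
      rw [actVec_smul, actVec_one, map_sub, map_one]
      have : appHom (σ j) e (w j x) = w j x := by
        simp only [w, Pi.smul_apply, map_smul, hv]
      change 0 = ‖appHom (σ j) e (w j x) - w j x‖ ^ 2
      rw [this, sub_self]
      simp
    have h4 := congrFun h3 x
    rw [actVec_smul, actVec_one, map_sub, map_one] at h4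
    exact sub_eq_zero.1 h4
  have h3 := eq_zero_of_laplacian_eq_zero he hkill hex θ h2 h1
  -- by finiteness of `M.X (k + 1)`, the limit of unit vectors is not zero
  have h4 (x : M.X (k + 1)) : ∀ᶠ j in (hyperfilter ℕ : Filter ℕ), ‖w j x‖ < 1 := by
    have h5 := hlim ((1 : Matrix (M.X (k + 1)) (M.X (k + 1)) (BoundedFamily Γ)) x)
    have h6 :
        ∑ y, θ ((1 : Matrix (M.X (k + 1)) (M.X (k + 1)) (BoundedFamily Γ)) x y) (ξ y) = 0 := by
      simp [h3]
    rw [h6, norm_zero, zero_pow two_ne_zero] at h5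
    filter_upwards [h5.eventually (gt_mem_nhds one_pos)] with j hj
    have h7 : ∑ y, appHom (σ j)
        ((1 : Matrix (M.X (k + 1)) (M.X (k + 1)) (BoundedFamily Γ)) x y) (w j y) = w j x :=
      congrFun (actVec_one (appHom (σ j)) (w j)) x
    rw [h7] at hj
    exact (sq_lt_one_iff₀ (norm_nonneg _)).1 hj
  obtain ⟨j, hj⟩ := (eventually_all.2 h4).exists
  exact (hw1 j).not_lt ((pi_norm_lt_iff one_pos).2 hj)

end Bound

end FiniteModel

/-! ### Contractions from the vanishing of unitary cohomology -/

namespace IsUnitOf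

variable {Γ : Type} [Group Γ] {B : Type} [CStarAlgebra B] {u : Γ →* B}
  {C : NonUnitalStarSubalgebra ℂ B} {e : B} {X Y Z : Type}

theorem star_mem_range (he : IsUnitOf u C e) {r : B} (hr : r ∈ (groupRingHom u).range) :
    star r ∈ (groupRingHom u).range := by
  obtain ⟨s, rfl⟩ := hr
  exact ⟨_, (star_groupRingHom u he.star_hom s).symm⟩

theorem mul_range_mem (he : IsUnitOf u C e) {r a : B} (hr : r ∈ (groupRingHom u).range)
    (ha : a ∈ C) : a * r ∈ C := by
  obtain ⟨s, hs⟩ := he.star_mem_range hr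
  have h := star_mem (he.groupRingHom_mul_mem s (star_mem ha))
  rwa [hs, star_mul, star_star, star_star] at h

theorem entriesIn_mul_range [Fintype Y] (he : IsUnitOf u C e) {G : Matrix X Y B} {N : Matrix Y Z B}
    (hG : EntriesIn C G) (hN : ∀ i j, N i j ∈ (groupRingHom u).range) : EntriesIn C (G * N) :=
  fun i j => sum_mem fun y _ => he.mul_range_mem (hN y j) (hG i y)

theorem range_mul_smul [Fintype Y] (he : IsUnitOf u C e) {N : Matrix X Y B}
    (hN : ∀ i j, N i j ∈ (groupRingHom u).range) (G : Matrix Y Z B) :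
    N * (e • G) = e • (N * G) := by
  ext i j
  rw [Matrix.smul_apply, Matrix.mul_apply, Matrix.mul_apply, smul_eq_mul, Finset.mul_sum]
  refine Finset.sum_congr rfl fun y _ => ?_
  obtain ⟨s, hs⟩ := hN i y
  rw [Matrix.smul_apply, smul_eq_mul, ← hs, ← mul_assoc, ← mul_assoc, he.commute]

theorem entriesIn_smul_range (he : IsUnitOf u C e) {N : Matrix X Y B}
    (hN : ∀ i j, N i j ∈ (groupRingHom u).range) : EntriesIn C (e • N) :=
  fun i j => he.mul_range_mem (hN i j) he.mem

theorem range_mulVec_mem [Fintype Y] (he : IsUnitOf u C e) {N : Matrix X Y B}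
    (hN : ∀ i j, N i j ∈ (groupRingHom u).range) {a : Y → B} (ha : ∀ i, a i ∈ C) (i : X) :
    N.mulVec a i ∈ C := by
  refine sum_mem fun y _ => ?_
  obtain ⟨s, hs⟩ := hN i y
  change N i y * a y ∈ C
  rw [← hs]
  exact he.groupRingHom_mul_mem _ (ha y)

/-- A matrix over the group ring that is bounded below on the columns over `C` has a left inverse
over `C`. -/
theorem exists_left_inverse [Fintype X] [DecidableEq X] (hC : IsClosed (C : Set B))
    (he : IsUnitOf u C e) {L : Matrix X X B} (hL : ∀ i j, L i j ∈ (groupRingHom u).range) {c : ℝ}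
    (hc : 0 < c) (h : ∀ a : X → B, (∀ i, a i ∈ C) → ∀ i, ‖a i‖ ≤ c * ‖L.mulVec a‖) :
    ∃ G : Matrix X X B, EntriesIn C G ∧ G * L = e • 1 := by
  have hcl := isClosed_image_mulVec_of_norm_le hC L hc h
  rw [← FiniteModel.image_smul_mulVec he fun a => he.range_mulVec_mem hL] at hcl
  obtain ⟨G, hG, hGL⟩ := exists_matrix_mul_mul_eq_self hC (he.entriesIn_smul_range hL) hcl
  refine ⟨G, hG, ?_⟩
  have h1 : ∀ i j, (1 : Matrix X X B) i j ∈ (groupRingHom u).range := by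
    intro i j
    rw [Matrix.one_apply]
    split_ifs
    exacts [one_mem _, zero_mem _]
  let P := G * L - e • 1
  have hP : EntriesIn C P := (he.entriesIn_mul_range hG hL).sub (he.entriesIn_smul_range h1)
  have hLP : L * P = 0 := by
    rw [he.mul_smul_of_entriesIn ((he.entriesIn_smul_range hL).mul hG), Matrix.smul_mul,
      ← he.range_mul_smul hL, he.smul_of_entriesIn hG] at hGL
    rw [Matrix.mul_sub, ← Matrix.mul_assoc, hGL, he.range_mul_smul hL, Matrix.mul_one, sub_self]
  have hP0 : P = 0 := by
    ext i j
    have h2 := h (fun i => P i j) (fun i => hP i j) i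
    rw [show L.mulVec (fun i => P i j) = 0 from funext fun i => congrFun (congrFun hLP i) j,
      norm_zero, mul_zero] at h2
    exact norm_le_zero_iff.1 h2
  exact sub_eq_zero.1 hP0

end IsUnitOf

namespace FiniteModel

variable {Γ : Type} [Group Γ] {m : ℕ} {M : FiniteModel Γ m} {k : ℕ}

theorem toMatrix_mem_range {B X Y : Type} [CStarAlgebra B] (u : Γ →* B)
    (φ : FreeMod Γ X →ₗ[MonoidAlgebra ℚ Γ] FreeMod Γ Y) (i : X) (j : Y) :
    toMatrix u φ i j ∈ (groupRingHom u).range := ⟨_, rfl⟩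

section Algebra

variable {B : Type} [CStarAlgebra B] {u : Γ →* B} {C : NonUnitalStarSubalgebra ℂ B} {e : B}
  [Fintype (M.X k)] [Fintype (M.X (k + 1))] [Fintype (M.X (k + 2))] [DecidableEq (M.X (k + 1))]

theorem laplacian_mem_range (he : IsUnitOf u C e) (i j : M.X (k + 1)) :
    M.laplacian u k i j ∈ (groupRingHom u).range := by
  have hone (i j) : (1 - toMatrix u (M.q (k + 1))) i j ∈ (groupRingHom u).range := by
    refine sub_mem ?_ (toMatrix_mem_range u _ i j)
    rw [Matrix.one_apply]
    split_ifs
    exacts [one_mem _, zero_mem _]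
  refine add_mem (add_mem ?_ ?_) ?_
  · exact sum_mem fun y _ => mul_mem (he.star_mem_range (toMatrix_mem_range u _ _ _))
      (toMatrix_mem_range u _ _ _)
  · exact sum_mem fun y _ => mul_mem (he.star_mem_range (hone _ _)) (hone _ _)
  · exact sum_mem fun y _ => mul_mem (toMatrix_mem_range u _ _ _)
      (he.star_mem_range (toMatrix_mem_range u _ _ _))

/-- Hodge theory: the inverse of the Laplacian commutes with its last summand, so it gives a
contraction. -/
theorem relContractible_of_left_inverse (he : IsUnitOf u C e)
    {G : Matrix (M.X (k + 1)) (M.X (k + 1)) B} (hG : EntriesIn C G)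
    (hGL : G * M.laplacian u k = e • (1 : Matrix (M.X (k + 1)) (M.X (k + 1)) B)) :
    M.RelContractible u C e k := by
  set L := M.laplacian u k with hL
  let D₀ := toMatrix u (M.d k)
  let D₁ := toMatrix u (M.d (k + 1))
  let Q := toMatrix u (M.q (k + 1))
  let N := D₀ * D₀.conjTranspose
  have hNr (i j) : N i j ∈ (groupRingHom u).range :=
    sum_mem fun y _ => mul_mem (toMatrix_mem_range u _ _ _)
      (he.star_mem_range (toMatrix_mem_range u _ _ _))
  have hmul {Z : Type} {K : Matrix Z (M.X (k + 1)) B} (hK : EntriesIn C K) :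
      K * (e • (1 : Matrix (M.X (k + 1)) (M.X (k + 1)) B)) = K := by
    rw [he.mul_smul_of_entriesIn hK, Matrix.mul_one]
  have hE : (e • (1 : Matrix (M.X (k + 1)) (M.X (k + 1)) B)).conjTranspose =
      e • (1 : Matrix (M.X (k + 1)) (M.X (k + 1)) B) := by
    ext i j
    simp only [Matrix.conjTranspose_apply, Matrix.smul_apply, smul_eq_mul, star_mul, he.star_eq]
    rw [Matrix.one_apply, Matrix.one_apply]
    by_cases hij : i = j
    · subst hij; simp
    · rw [if_neg hij, if_neg (Ne.symm hij)]; simp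
  have hLG' : L * G.conjTranspose = e • (1 : Matrix (M.X (k + 1)) (M.X (k + 1)) B) := by
    have h := congrArg Matrix.conjTranspose hGL
    rwa [Matrix.conjTranspose_mul, M.conjTranspose_laplacian, hE] at h
  have hGs : G.conjTranspose = G := by
    have h := Matrix.mul_assoc G L G.conjTranspose
    rw [hGL, hLG', hmul hG, Matrix.smul_mul, Matrix.one_mul,
      he.smul_of_entriesIn hG.conjTranspose] at h
    exact h
  have hLG : L * G = e • (1 : Matrix (M.X (k + 1)) (M.X (k + 1)) B) := by rw [← hLG', hGs]
  have hcomm : G * N = N * G := by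
    have h : G * (N * L) * G = G * (L * N) * G := by rw [M.laplacian_commute]
    rw [← Matrix.mul_assoc G L, hGL, Matrix.smul_mul, Matrix.one_mul, ← Matrix.mul_assoc G N,
      Matrix.mul_assoc _ L, hLG, hmul (he.entriesIn_mul_range hG hNr), Matrix.smul_mul,
      ← he.range_mul_smul hNr, he.smul_of_entriesIn hG] at h
    exact h
  have hGD : EntriesIn C (G * D₁.conjTranspose) := by
    refine he.entriesIn_mul_range hG fun i j => he.star_mem_range (toMatrix_mem_range u _ _ _)
  refine ⟨G * D₁.conjTranspose, D₀.conjTranspose * G * Q, hGD, ?_, ?_⟩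
  · exact he.entriesIn_mul_range (he.entriesIn_conjTranspose_mul _ hG) (toMatrix_mem_range u _)
  · calc e • Q = (e • (1 : Matrix (M.X (k + 1)) (M.X (k + 1)) B)) * Q := by
          rw [Matrix.smul_mul, Matrix.one_mul]
      _ = G * (D₁.conjTranspose * D₁ + N * Q) := by
        rw [← hGL, Matrix.mul_assoc, hL, M.laplacian_mul_q]
      _ = G * D₁.conjTranspose * D₁ + D₀ * (D₀.conjTranspose * G * Q) := by
        rw [Matrix.mul_add, ← Matrix.mul_assoc G N, hcomm]
        simp only [N, Matrix.mul_assoc]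

end Algebra

/-- The vanishing of the cohomology of unitary representations gives a contraction over `C`: the
lower bound for the Laplacian on vectors is one on columns over `C`, as the components of elements
of `C` have their values in the range of `e`. -/
theorem relContractible_of_cochainExact [Fintype (M.X k)] [Fintype (M.X (k + 1))]
    [Fintype (M.X (k + 2))] {C : NonUnitalStarSubalgebra ℂ (BoundedFamily Γ)} {e : BoundedFamily Γ}
    (hC : IsClosed (C : Set (BoundedFamily Γ))) (he : IsUnitOf (groupEltHom Γ) C e)
    (hkill : e = 1 ∨ ∀ (H : Type) [NormedAddCommGroup H] [InnerProductSpace ℂ H] [CompleteSpace H]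
      (θ : BoundedFamily Γ →⋆ₐ[ℂ] (H →L[ℂ] H)) (w : H), (∀ g, θ (groupElt g) w = w) → θ e w = 0)
    (hex : ∀ (V : Type) [NormedAddCommGroup V] [InnerProductSpace ℂ V] [CompleteSpace V]
      (π : Γ →* unitary (V →L[ℂ] V)),
      (e = 1 ∨ ∀ v : V, (∀ g : Γ, (π g : V →L[ℂ] V) v = v) → v = 0) →
      M.CochainExact (repHom (unitaryRep π)) k) :
    M.RelContractible (groupEltHom Γ) C e k := by
  classical
  obtain ⟨c, hc, h⟩ := exists_norm_le_laplacian (M := M) (k := k) he hkill hex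
  have hb (a : M.X (k + 1) → BoundedFamily Γ) (ha : ∀ i, a i ∈ C) (i : M.X (k + 1)) :
      ‖a i‖ ≤ c * ‖(M.laplacian (groupEltHom Γ) k).mulVec a‖ := by
    have h0 : 0 ≤ c * ‖(M.laplacian (groupEltHom Γ) k).mulVec a‖ :=
      mul_nonneg hc.le (norm_nonneg _)
    refine BoundedFamily.norm_le_of_forall h0 fun σ => ?_
    refine ContinuousLinearMap.opNorm_le_bound _ h0 fun v => ?_
    refine (norm_le_pi_norm (fun i => (a i).app σ v) i).trans ?_
    refine (h σ (fun i => (a i).app σ v) fun x =>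
      DFunLike.congr_fun (congrArg (appHom σ) (he.mul_left _ (ha x))) v).trans ?_
    rw [mul_assoc]
    refine mul_le_mul_of_nonneg_left ?_ hc.le
    refine (pi_norm_le_iff_of_nonneg (mul_nonneg (norm_nonneg _) (norm_nonneg _))).2 fun j => ?_
    rw [← app_mulVec_apply]
    refine (ContinuousLinearMap.le_opNorm _ _).trans ?_
    refine mul_le_mul_of_nonneg_right ?_ (norm_nonneg _)
    exact (BoundedFamily.norm_app_le _ _).trans (norm_le_pi_norm _ j)
  obtain ⟨G, hG, hGL⟩ := he.exists_left_inverse hC (laplacian_mem_range (M := M) (k := k) he) hc hb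
  exact relContractible_of_left_inverse he hG hGL

/-- If the cohomology of unitary representations vanishes up to degree `n`, there are contractions
over `C` up to that degree. The alternatives `e = 1` and "no invariant vectors" treat the properties
`[Tₙ]` and `(Tₙ)` at once. -/
theorem contractibleUpTo_of_subsingleton {n : ℕ} {C : NonUnitalStarSubalgebra ℂ (BoundedFamily Γ)}
    {e : BoundedFamily Γ}
    (hC : IsClosed (C : Set (BoundedFamily Γ))) (he : IsUnitOf (groupEltHom Γ) C e)
    (hkill : e = 1 ∨ ∀ (H : Type) [NormedAddCommGroup H] [InnerProductSpace ℂ H] [CompleteSpace H]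
      (θ : BoundedFamily Γ →⋆ₐ[ℂ] (H →L[ℂ] H)) (w : H), (∀ g, θ (groupElt g) w = w) → θ e w = 0)
    (hT : ∀ (V : Type) [NormedAddCommGroup V] [InnerProductSpace ℂ V] [CompleteSpace V]
      (π : Γ →* unitary (V →L[ℂ] V)),
      (e = 1 ∨ ∀ v : V, (∀ g : Γ, (π g : V →L[ℂ] V) v = v) → v = 0) →
      ∀ j, 1 ≤ j → j ≤ n → Subsingleton (groupCohomology (Rep.of (unitaryRep π)) j)) :
    M.ContractibleUpTo (groupEltHom Γ) C e n := by
  intro k hk _ _ _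
  refine relContractible_of_cochainExact hC he hkill fun V _ _ _ π hπ => ?_
  rw [← M.subsingleton_groupCohomology_iff]
  exact hT V π hπ (k + 1) (by omega) (by omega)

/-- Contractions over any algebra of bounded families make the cohomology of unitary representations
vanish, of those without invariant vectors unless `e = 1`. -/
theorem ContractibleUpTo.subsingleton {n : ℕ} (hm : n + 1 ≤ m)
    {A : NonUnitalStarSubalgebra ℂ (BoundedFamily Γ)} {e : BoundedFamily Γ}
    (h : M.ContractibleUpTo (groupEltHom Γ) A e n) (hes : star e = e)
    (hinv : ∀ g, groupElt g * (1 - e) = 1 - e) {V : Type} [NormedAddCommGroup V]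
    [InnerProductSpace ℂ V] [CompleteSpace V] (π : Γ →* unitary (V →L[ℂ] V))
    (hV : e = 1 ∨ ∀ v : V, (∀ g : Γ, (π g : V →L[ℂ] V) v = v) → v = 0) (j : ℕ) (hj : 1 ≤ j)
    (hjn : j ≤ n) : Subsingleton (groupCohomology (Rep.of (unitaryRep π)) j) := by
  obtain ⟨k, rfl⟩ := Nat.exists_eq_succ_of_ne_zero (Nat.one_le_iff_ne_zero.1 hj)
  have hfin (k : ℕ) (hk : k ≤ n + 1) : Fintype (M.X k) :=
    have := M.finite k (hk.trans hm)
    Fintype.ofFinite _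
  let _ := hfin k (by omega)
  let _ := hfin (k + 1) (by omega)
  let _ := hfin (k + 2) (by omega)
  rw [M.subsingleton_groupCohomology_iff]
  exact (h k (by omega)).cochainExact hes hinv π hV

end FiniteModel

/-! ### The equivalences for an intermediate algebra -/

section Main

variable {Γ : Type} [Group Γ] {n : ℕ} {A : NonUnitalStarSubalgebra ℂ (BoundedFamily Γ)}

/-- The equivalences for property `[T_n]`. From the property, contractions exist over `C*Γ` and
hence over `A`; from the criteria, they exist over `A`, which suffices for all unitary
representations. -/
theorem bracketT_tfae (hΓ : IsTypeFP Γ (n + 1)) (hn : 0 < n)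
    (hcl : IsClosed (A : Set (BoundedFamily Γ))) (hCA : (CStar Γ).toNonUnitalStarSubalgebra ≤ A) :
    [HasPropertyBracketT Γ n,
      CohomologyCriterion (leftMulRep A ((cstarAug_le_cstar Γ).trans hCA)) n,
      HomologyCriterion (leftMulRep A ((cstarAug_le_cstar Γ).trans hCA)) n].TFAE := by
  obtain ⟨M⟩ := hΓ.nonempty_finiteModel
  have hC := isUnitOf_one (le_refl (CStar Γ).toNonUnitalStarSubalgebra)
  have hA := isUnitOf_one hCA
  have h1 (hT : HasPropertyBracketT Γ n) : M.ContractibleUpTo (groupEltHom Γ)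
      (CStar Γ).toNonUnitalStarSubalgebra 1 n :=
    FiniteModel.contractibleUpTo_of_subsingleton isClosed_cstar hC (Or.inl rfl)
      fun V _ _ _ π _ => hT V π
  have h2 (h : M.ContractibleUpTo (groupEltHom Γ) A 1 n) : HasPropertyBracketT Γ n :=
    fun V _ _ _ π => h.subsingleton le_rfl (star_one _) (fun g => by simp) π (Or.inl rfl)
  tfae_have 1 → 2 := fun hT => (h1 hT).cohomologyCriterion M le_rfl hn hcl hA hC hCA
  tfae_have 1 → 3 := fun hT => (h1 hT).homologyCriterion M le_rfl hn hcl hA hC hCA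
  tfae_have 2 → 1 := fun h => h2 (M.contractibleUpTo_of_cohomologyCriterion le_rfl hcl hA h)
  tfae_have 3 → 1 := fun h => h2 (M.contractibleUpTo_of_homologyCriterion le_rfl hcl hA h)
  tfae_finish

/-- The equivalences for property `(T_n)`. Each condition provides the unit `e` of `A` on which the
contractions rely. -/
theorem propertyT_tfae (hΓ : IsTypeFP Γ (n + 1)) (hn : 0 < n)
    (hcl : IsClosed (A : Set (BoundedFamily Γ))) (hCA : CStarAug Γ ≤ A) (hAW : A ≤ WStarAug Γ) :
    [HasPropertyT Γ n, CohomologyCriterion (leftMulRep A hCA) n,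
      HomologyCriterion (leftMulRep A hCA) n].TFAE := by
  obtain ⟨M⟩ := hΓ.nonempty_finiteModel
  have h1 (hT : HasPropertyT Γ n) : ∃ e, IsUnitOf (groupEltHom Γ) A e ∧
      IsUnitOf (groupEltHom Γ) (CStarAug Γ) e ∧
      M.ContractibleUpTo (groupEltHom Γ) (CStarAug Γ) e n := by
    obtain ⟨e, he, hinv, hkill⟩ := exists_invariant_of_hasPropertyT M (by omega) hn hT
    have hC := isUnitOf_of_invariant le_rfl cstarAug_le_wstarAug he hinv
    have hA := isUnitOf_of_invariant hCA hAW (hCA he) hinv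
    refine ⟨e, hA, hC, FiniteModel.contractibleUpTo_of_subsingleton isClosed_cstarAug hC
      (Or.inr hkill) fun V _ _ _ π hπ => hT V π ?_⟩
    -- `e = 1` is impossible, as `e` vanishes at the trivial representation
    refine hπ.resolve_left fun h => ?_
    obtain ⟨v, hv⟩ := exists_ne (0 : BigHilbert Γ)
    refine hv ?_
    have h0 : e.app 1 = 0 := he.2
    rw [h] at h0
    exact DFunLike.congr_fun h0 v
  have h2 {e : BoundedFamily Γ} (he : IsUnitOf (groupEltHom Γ) A e)
      (hinv : ∀ g, groupElt g * (1 - e) = 1 - e)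
      (h : M.ContractibleUpTo (groupEltHom Γ) A e n) : HasPropertyT Γ n :=
    fun V _ _ _ π hπ => h.subsingleton le_rfl he.star_eq hinv π (Or.inr hπ)
  tfae_have 1 → 2 := fun hT => by
    obtain ⟨e, hA, hC, h⟩ := h1 hT
    exact h.cohomologyCriterion M le_rfl hn hcl hA hC hCA
  tfae_have 1 → 3 := fun hT => by
    obtain ⟨e, hA, hC, h⟩ := h1 hT
    exact h.homologyCriterion M le_rfl hn hcl hA hC hCA
  tfae_have 2 → 1 := fun h => by
    obtain ⟨e, he, hinv⟩ := exists_invariant_of_cohomologyCriterion hCA hn h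
    have hA := isUnitOf_of_invariant hCA hAW he hinv
    exact h2 hA hinv (M.contractibleUpTo_of_cohomologyCriterion le_rfl hcl hA h)
  tfae_have 3 → 1 := fun h => by
    obtain ⟨e, he, hinv⟩ := exists_invariant_of_homologyCriterion M (by omega) hcl hCA h
    have hA := isUnitOf_of_invariant hCA hAW he hinv
    exact h2 hA hinv (M.contractibleUpTo_of_homologyCriterion le_rfl hcl hA h)
  tfae_finish

end Main

end

theorem theorem1p4 (Γ : Type) [Group Γ] (hΓ : IsTypeFPInfty Γ) (n : ℕ) (hn : 0 < n) :
    -- `[T_n]` and `C*Γ`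
    [HasPropertyBracketT Γ n,
      CohomologyCriterion
        (leftMulRep (CStar Γ).toNonUnitalStarSubalgebra (cstarAug_le_cstar Γ)) n,
      HomologyCriterion
        (leftMulRep (CStar Γ).toNonUnitalStarSubalgebra (cstarAug_le_cstar Γ)) n].TFAE ∧
    -- `(T_n)` and `C*₀Γ`
    [HasPropertyT Γ n,
      CohomologyCriterion (leftMulRep (CStarAug Γ) le_rfl) n,
      HomologyCriterion (leftMulRep (CStarAug Γ) le_rfl) n].TFAE ∧
    -- `[T_n]` and intermediate C*-algebras `C*Γ ⊆ A ⊆ W*Γ`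
    (∀ (A : NonUnitalStarSubalgebra ℂ (BoundedFamily Γ)), IsClosed (A : Set (BoundedFamily Γ)) →
      ∀ (hCA : (CStar Γ).toNonUnitalStarSubalgebra ≤ A),
      A ≤ (WStar Γ).toNonUnitalStarSubalgebra →
      [HasPropertyBracketT Γ n,
        CohomologyCriterion (leftMulRep A ((cstarAug_le_cstar Γ).trans hCA)) n,
        HomologyCriterion (leftMulRep A ((cstarAug_le_cstar Γ).trans hCA)) n].TFAE) ∧
    -- `(T_n)` and intermediate C*-algebras `C*₀Γ ⊆ A ⊆ W*₀Γ`
    (∀ (A : NonUnitalStarSubalgebra ℂ (BoundedFamily Γ)), IsClosed (A : Set (BoundedFamily Γ)) →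
      ∀ (hCA : CStarAug Γ ≤ A), A ≤ WStarAug Γ →
      [HasPropertyT Γ n,
        CohomologyCriterion (leftMulRep A hCA) n,
        HomologyCriterion (leftMulRep A hCA) n].TFAE) := by
  exact ⟨bracketT_tfae (hΓ (n + 1)) hn isClosed_cstar le_rfl,
    propertyT_tfae (hΓ (n + 1)) hn isClosed_cstarAug le_rfl cstarAug_le_wstarAug,
    fun A hcl hCA _ => bracketT_tfae (hΓ (n + 1)) hn hcl hCA,
    fun A hcl hCA hAW => propertyT_tfae (hΓ (n + 1)) hn hcl hCA hAW⟩
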